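/- **Setting.** Let $k$ be a field. A quasi-Hopf algebra $(H,\Delta,\varepsilon,\Phi,S,\alpha,\beta)$ over $k$ is understood in Drinfeld's sense, with $S$ an anti-morphism of algebras that is not required to be bijective; write $\Phi=X^1\otimes X^2\otimes X^3$ and $\Phi^{-1}=x^1\otimes x^2\otimes x^3$. It is quasitriangular (QT) if it is equipped with an invertible $R=R^1\otimes R^2\in H\otimes H$ such that $(\Delta\otimes\mathrm{id})(R)=\Phi_{312}R_{13}\Phi^{-1}_{132}R_{23}\Phi$, $(\mathrm{id}\otimes\Delta)(R)=\Phi^{-1}_{231}R_{13}\Phi_{213}R_{12}\Phi^{-1}$ and $\Delta^{\rm cop}(h)R=R\Delta(h)$ for all $h\in H$. Here $\Phi_{312}=X^2\otimes X^3\otimes X^1$, $\Phi_{213}=X^2\otimes X^1\otimes X^3$, $\Phi^{-1}_{132}=x^1\otimes x^3\otimes x^2$ and $\Phi^{-1}_{231}=x^3\otimes x^1\otimes x^2$. Put $R_{21}=R^2\otimes R^1$ and $u=S(R^2x^2\beta S(x^3))\,\alpha\, R^1x^1$. The category ${}_H\mathcal M^{\rm fd}$ of finite-dimensional left $H$-modules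 is monoidal, with $H$ acting on $V\otimes W$ through $\Delta$, on the unit $k$ through $\varepsilon$, and with associativity constraint $(v\otimes w)\otimes z\mapsto X^1v\otimes(X^2w\otimes X^3z)$. It is braided by $c_{V,W}(v\otimes w)=R^2w\otimes R^1v$, and it is left rigid with $V^*$ the dual space, $(h\varphi)(v)=\varphi(S(h)v)$, $\mathrm{ev}_V(\varphi\otimes v)=\varphi(\alpha v)$ and $\mathrm{coev}_V(1)=\sum_i\beta e_i\otimes e^i$, where $(e_i)$ is a basis of $V$ with dual basis $(e^i)$. A *ribbon category* is a left rigid braided category with a natural automorphism $\eta$ of the identity functor such that $\eta_{V\otimes W}=(\eta_V\otimes\eta_W)c_{W,V}c_{V,W}$ and $\eta_{V^*}=(\eta_V)^*$. For a left rigid braided category $(\mathcal C,c)$, the category $\mathcal R(\mathcal C,c)$ has as objects the pairs $(V,\eta_V)$ with $\eta_V$ an automorphism of $V\in\mathcal C$ such that $$\eta_V^{-2}=(\mathrm{id}_V\otimes \mathrm{ev}_V)\circ\big(c_{V^*,V}\,c_{V,V^*}\,\mathrm{coev}_V\otimes \mathrm{id}_V\big)$$ (associativity and unit constraints suppressed).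 A morphism $(V,\eta_V)\to(W,\eta_W)$ is a morphism $f:V\to W$ of $\mathcal C$ with $\eta_Wf=f\eta_V$. The ribbon structure of $\mathcal R(\mathcal C,c)$ is given by $(V,\eta_V)\otimes(W,\eta_W)=(V\otimes W,(\eta_V\otimes\eta_W)c_{W,V}c_{V,W})$, the unit $(\underline 1,\mathrm{id})$, the constraints and the braiding of $\mathcal C$, duals $(V^*,(\eta_V)^*)$ with $\mathrm{ev}_V$ and $\mathrm{coev}_V$, and twist $\eta_V$. **Theorem.** Let $(H,R)$ be a QT quasi-Hopf algebra over $k$, and let $H(\theta)=H[\theta]/\langle\theta^2-uS(u)\rangle$, where $\theta$ commutes with $H$. 1. $\mathcal R({}_H\mathcal M^{\rm fd},c)$ is a ribbon category with the structure just described. 2. $H(\theta)$ carries a QT quasi-Hopf algebra structure that extends $\Delta,\varepsilon,S$ from $H$ by $\Delta(\theta)=(\theta\otimes\theta)(R_{21}R)^{-1}$, $\varepsilon(\theta)=1$, $S(\theta)=\theta$, and whose reassociator, $\alpha$, $\beta$ and $R$-matrix are those of $H$. The element $\theta$ is invertible, $\eta=\theta^{-1}$ is central in $H(\theta)$, $\Delta(\eta)=(\eta\otimes\eta)R_{21}R$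 and $S(\eta)=\eta$; hence ${}_{H(\theta)}\mathcal M^{\rm fd}$ is a ribbon category with twist $v\mapsto\theta^{-1}v$. 3. For every object $(V,\eta_V)$ of $\mathcal R({}_H\mathcal M^{\rm fd},c)$, $\eta_V^{-2}$ is the action of $uS(u)$ on $V$. The functor $F:\mathcal R({}_H\mathcal M^{\rm fd},c)\to{}_{H(\theta)}\mathcal M^{\rm fd}$ that sends $(V,\eta_V)$ to the $H$-module $V$ with $\theta$ acting by $\eta_V^{-1}$, and is the identity on morphisms, is an isomorphism of ribbon categories: it has a strict two-sided inverse functor, it is a strict monoidal and braided functor, and it maps twists to twists and the duals, with their evaluation and coevaluation, to the duals. -/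

import Mathlib

open CategoryTheory MonoidalCategory
open scoped TensorProduct Polynomial

universe u w

noncomputable section

namespace QHopf

/-! ### Linear-algebra notation on tensor powers -/

section Maps

variable {k : Type u} {H : Type w} [Field k] [Ring H] [Algebra k H]

/-- `Δ ⊗ id`, with values in `H ⊗ (H ⊗ H)`. -/
def comulLeft (Δ : H →ₐ[k] H ⊗[k] H) : H ⊗[k] H →ₐ[k] H ⊗[k] (H ⊗[k] H) :=
  (Algebra.TensorProduct.assoc k k k H H H).toAlgHom.comp
    (Algebra.TensorProduct.map Δ (AlgHom.id k H))

/-- `id ⊗ Δ`. -/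
def comulRight (Δ : H →ₐ[k] H ⊗[k] H) : H ⊗[k] H →ₐ[k] H ⊗[k] (H ⊗[k] H) :=
  Algebra.TensorProduct.map (AlgHom.id k H) Δ

variable (k H)

/-- `a ⊗ b ↦ a ⊗ b ⊗ 1`. -/
def incl12 : H ⊗[k] H →ₐ[k] H ⊗[k] (H ⊗[k] H) :=
  Algebra.TensorProduct.map (AlgHom.id k H) Algebra.TensorProduct.includeLeft

/-- `a ⊗ b ↦ 1 ⊗ a ⊗ b`. -/
def incl23 : H ⊗[k] H →ₐ[k] H ⊗[k] (H ⊗[k] H) :=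
  Algebra.TensorProduct.includeRight

/-- `a ⊗ b ↦ a ⊗ 1 ⊗ b`. -/
def incl13 : H ⊗[k] H →ₐ[k] H ⊗[k] (H ⊗[k] H) :=
  Algebra.TensorProduct.map (AlgHom.id k H) Algebra.TensorProduct.includeRight

/-- `a ⊗ b ↦ b ⊗ a`. -/
def flip2 : H ⊗[k] H ≃ₐ[k] H ⊗[k] H := Algebra.TensorProduct.comm k H H

/-- `a ⊗ b ⊗ c ↦ b ⊗ a ⊗ c`. -/
def perm213 : H ⊗[k] (H ⊗[k] H) ≃ₐ[k] H ⊗[k] (H ⊗[k] H) :=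
  Algebra.TensorProduct.leftComm k H H H

/-- `a ⊗ b ⊗ c ↦ a ⊗ c ⊗ b`. -/
def perm132 : H ⊗[k] (H ⊗[k] H) ≃ₐ[k] H ⊗[k] (H ⊗[k] H) :=
  Algebra.TensorProduct.congr AlgEquiv.refl (flip2 k H)

/-- `a ⊗ b ⊗ c ↦ b ⊗ c ⊗ a`. -/
def perm312 : H ⊗[k] (H ⊗[k] H) ≃ₐ[k] H ⊗[k] (H ⊗[k] H) :=
  (Algebra.TensorProduct.comm k H (H ⊗[k] H)).trans
    (Algebra.TensorProduct.assoc k k k H H H)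

variable {k H}

/-- `a ⊗ b ↦ f a * g b`. -/
def mulMap (f g : H →ₗ[k] H) : H ⊗[k] H →ₗ[k] H :=
  LinearMap.mul' k H ∘ₗ TensorProduct.map f g

/-- `a ⊗ b ⊗ c ↦ f a * (g b * h c)`. -/
def mulMap₃ (f g h : H →ₗ[k] H) : H ⊗[k] (H ⊗[k] H) →ₗ[k] H :=
  LinearMap.mul' k H ∘ₗ TensorProduct.map f (mulMap g h)

end Maps

/-! ### Quasi-Hopf algebras -/

/-- A quasi-Hopf algebra structure on the associative unital `k`-algebra `H`; the antipode is not
required to be bijective. -/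
structure QuasiHopfAlgebra (k : Type u) (H : Type w) [Field k] [Ring H] [Algebra k H] where
  /-- the comultiplication -/
  Δ : H →ₐ[k] H ⊗[k] H
  /-- the counit -/
  counit : H →ₐ[k] k
  /-- the reassociator -/
  Φ : (H ⊗[k] (H ⊗[k] H))ˣ
  /-- the antipode, an anti-morphism of algebras -/
  S : H →ₗ[k] H
  /-- the distinguished element `α` -/
  α : H
  /-- the distinguished element `β` -/
  β : H
  quasi_coassoc : ∀ h : H,
    comulRight Δ (Δ h) = (Φ : H ⊗[k] (H ⊗[k] H)) * comulLeft Δ (Δ h) * ((Φ⁻¹ : (_)ˣ) : _)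
  id_counit : ∀ h : H,
    TensorProduct.rid k H (Algebra.TensorProduct.map (AlgHom.id k H) counit (Δ h)) = h
  counit_id : ∀ h : H,
    TensorProduct.lid k H (Algebra.TensorProduct.map counit (AlgHom.id k H) (Δ h)) = h
  /-- the 3-cocycle condition
  `(1 ⊗ Φ) (id ⊗ Δ ⊗ id)(Φ) (Φ ⊗ 1) = (id ⊗ id ⊗ Δ)(Φ) (Δ ⊗ id ⊗ id)(Φ)`
  in `H ⊗ (H ⊗ (H ⊗ H))` -/
  cocycle :
    (Algebra.TensorProduct.includeRight (Φ : H ⊗[k] (H ⊗[k] H)) :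
        H ⊗[k] (H ⊗[k] (H ⊗[k] H))) *
      Algebra.TensorProduct.map (AlgHom.id k H) (comulLeft Δ) (Φ : H ⊗[k] (H ⊗[k] H)) *
      Algebra.TensorProduct.map (AlgHom.id k H) (incl12 k H) (Φ : H ⊗[k] (H ⊗[k] H)) =
    Algebra.TensorProduct.map (AlgHom.id k H) (comulRight Δ) (Φ : H ⊗[k] (H ⊗[k] H)) *
      Algebra.TensorProduct.assoc k k k H H (H ⊗[k] H)
        (Algebra.TensorProduct.map Δ (AlgHom.id k (H ⊗[k] H)) (Φ : H ⊗[k] (H ⊗[k] H)))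
  /-- `(id ⊗ ε ⊗ id)(Φ) = 1 ⊗ 1` -/
  counit_reassociator :
    Algebra.TensorProduct.map (AlgHom.id k H)
      ((Algebra.TensorProduct.lid k H).toAlgHom.comp
        (Algebra.TensorProduct.map counit (AlgHom.id k H))) (Φ : H ⊗[k] (H ⊗[k] H)) = 1
  S_one : S 1 = 1
  S_mul : ∀ a b : H, S (a * b) = S b * S a
  /-- `S(h₁) α h₂ = ε(h) α` -/
  antipode_left : ∀ h : H, mulMap S (LinearMap.mulLeft k α) (Δ h) = counit h • α
  /-- `h₁ β S(h₂) = ε(h) β` -/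
  antipode_right : ∀ h : H, mulMap (LinearMap.mulRight k β) S (Δ h) = counit h • β
  /-- `X¹ β S(X²) α X³ = 1`, where `Φ = X¹ ⊗ X² ⊗ X³` -/
  reassociator_antipode :
    mulMap₃ (LinearMap.mulRight k β) S (LinearMap.mulLeft k α) (Φ : H ⊗[k] (H ⊗[k] H)) = 1
  /-- `S(x¹) α x² β S(x³) = 1`, where `Φ⁻¹ = x¹ ⊗ x² ⊗ x³` -/
  reassociator_inv_antipode :
    mulMap₃ S (LinearMap.mulLeft k α ∘ₗ LinearMap.mulRight k β) S
      ((Φ⁻¹ : (H ⊗[k] (H ⊗[k] H))ˣ) : H ⊗[k] (H ⊗[k] H)) = 1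

/-- A quasitriangular quasi-Hopf algebra `(H, R)`. -/
structure QTQuasiHopfAlgebra (k : Type u) (H : Type w) [Field k] [Ring H] [Algebra k H]
    extends QuasiHopfAlgebra k H where
  /-- the `R`-matrix -/
  R : (H ⊗[k] H)ˣ
  /-- `(Δ ⊗ id)(R) = Φ₃₁₂ R₁₃ Φ⁻¹₁₃₂ R₂₃ Φ`, where `Φ₃₁₂ = X² ⊗ X³ ⊗ X¹` -/
  comul_id_R : comulLeft Δ (R : H ⊗[k] H) =
    perm312 k H (Φ : H ⊗[k] (H ⊗[k] H)) * incl13 k H (R : H ⊗[k] H) *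
      perm132 k H ((Φ⁻¹ : (H ⊗[k] (H ⊗[k] H))ˣ) : H ⊗[k] (H ⊗[k] H)) *
      incl23 k H (R : H ⊗[k] H) * (Φ : H ⊗[k] (H ⊗[k] H))
  /-- `(id ⊗ Δ)(R) = Φ⁻¹₂₃₁ R₁₃ Φ₂₁₃ R₁₂ Φ⁻¹`, where `Φ⁻¹₂₃₁ = x³ ⊗ x¹ ⊗ x²` -/
  id_comul_R : comulRight Δ (R : H ⊗[k] H) =
    (perm312 k H).symm ((Φ⁻¹ : (H ⊗[k] (H ⊗[k] H))ˣ) : H ⊗[k] (H ⊗[k] H)) *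
      incl13 k H (R : H ⊗[k] H) * perm213 k H (Φ : H ⊗[k] (H ⊗[k] H)) *
      incl12 k H (R : H ⊗[k] H) * ((Φ⁻¹ : (H ⊗[k] (H ⊗[k] H))ˣ) : H ⊗[k] (H ⊗[k] H))
  /-- `Δᶜᵒᵖ(h) R = R Δ(h)` -/
  comul_op : ∀ h : H, flip2 k H (Δ h) * (R : H ⊗[k] H) = (R : H ⊗[k] H) * Δ h

namespace QTQuasiHopfAlgebra

variable {k : Type u} {H : Type w} [Field k] [Ring H] [Algebra k H]

/-- `R₂₁ R`, as a unit of `H ⊗ H`. -/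
def monodromy (Q : QTQuasiHopfAlgebra k H) : (H ⊗[k] H)ˣ :=
  Units.map (flip2 k H).toRingEquiv.toRingHom.toMonoidHom Q.R * Q.R

/-- The linear map `a ⊗ b ⊗ c ↦ S(b β S(c)) α a`. -/
def uMap (Q : QTQuasiHopfAlgebra k H) : H ⊗[k] (H ⊗[k] H) →ₗ[k] H :=
  LinearMap.mul' k H ∘ₗ
    TensorProduct.map (Q.S ∘ₗ mulMap (LinearMap.mulRight k Q.β) Q.S) (LinearMap.mulLeft k Q.α) ∘ₗ
      (TensorProduct.comm k H (H ⊗[k] H)).toLinearMap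

/-- The element `u = S(R² x² β S(x³)) α R¹ x¹`. -/
def u (Q : QTQuasiHopfAlgebra k H) : H :=
  Q.uMap (incl12 k H (Q.R : H ⊗[k] H) *
    ((Q.Φ⁻¹ : (H ⊗[k] (H ⊗[k] H))ˣ) : H ⊗[k] (H ⊗[k] H)))

/-- `η` is a ribbon element of `(H, R)`: central, invertible, `Δ(η) = (η ⊗ η) R₂₁ R` and
`S(η) = η`. -/
structure IsRibbonElement (Q : QTQuasiHopfAlgebra k H) (η : Hˣ) : Prop where
  central : ∀ h : H, (η : H) * h = h * η
  comul : Q.Δ η = ((η : H) ⊗ₜ[k] (η : H)) * (Q.monodromy : H ⊗[k] H)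
  antipode : Q.S η = η

end QTQuasiHopfAlgebra

end QHopf
namespace QHopf

/-! ### The algebra `H(θ)` -/

section Theta

variable {k : Type u} {H : Type w} [Field k] [Ring H] [Algebra k H]

/-- The relation `θ² = u S(u)` on `H[θ]` (polynomials over `H` in a central variable). -/
inductive ThetaRel (Q : QTQuasiHopfAlgebra k H) : H[X] → H[X] → Prop
  | theta_sq : ThetaRel Q (Polynomial.X ^ 2) (Polynomial.C (Q.u * Q.S Q.u))

/-- `H(θ) = H[θ] / ⟨θ² - u S(u)⟩`. -/
def HTheta (Q : QTQuasiHopfAlgebra k H) : Type w := RingQuot (ThetaRel Q)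

instance (Q : QTQuasiHopfAlgebra k H) : Ring (HTheta Q) :=
  inferInstanceAs (Ring (RingQuot (ThetaRel Q)))

instance (Q : QTQuasiHopfAlgebra k H) : Algebra k (HTheta Q) :=
  inferInstanceAs (Algebra k (RingQuot (ThetaRel Q)))

namespace HTheta

variable (Q : QTQuasiHopfAlgebra k H)

/-- The projection `H[θ] → H(θ)`. -/
def proj : H[X] →ₐ[k] HTheta Q := RingQuot.mkAlgHom k (ThetaRel Q)

/-- The canonical map `H → H(θ)`. -/
def ι : H →ₐ[k] HTheta Q := (proj Q).comp Polynomial.CAlgHom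

/-- The class of `θ`. -/
def θ : HTheta Q := proj Q Polynomial.X

variable {Q} in
/-- The algebra map `H(θ) → A` extending `f : H → A` and sending `θ` to `a`. -/
def lift {A : Type*} [Ring A] [Algebra k A] (f : H →ₐ[k] A) (a : A)
    (comm : ∀ h, Commute (f h) a) (sq : a * a = f (Q.u * Q.S Q.u)) : HTheta Q →ₐ[k] A :=
  RingQuot.liftAlgHom k ⟨Polynomial.eval₂AlgHom f a comm, by
    rintro _ _ ⟨⟩
    simp only [map_pow, Polynomial.eval₂AlgHom_apply, Polynomial.eval₂_X, Polynomial.eval₂_C]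
    rw [pow_two, sq]; rfl⟩

variable {Q} in
lemma lift_intertwine {V W : Type*} [AddCommGroup V] [Module k V] [AddCommGroup W] [Module k W]
    (f : H →ₐ[k] Module.End k V) (a : Module.End k V) (hc : ∀ h, Commute (f h) a)
    (hs : a * a = f (Q.u * Q.S Q.u)) (g : H →ₐ[k] Module.End k W) (b : Module.End k W)
    (hc' : ∀ h, Commute (g h) b) (hs' : b * b = g (Q.u * Q.S Q.u))
    (φ : V →ₗ[k] W) (hφ : ∀ h v, φ (f h v) = g h (φ v)) (hab : ∀ v, φ (a v) = b (φ v))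
    (t : HTheta Q) (v : V) : φ (lift f a hc hs t v) = lift g b hc' hs' t (φ v) := by
  obtain ⟨p, rfl⟩ := RingQuot.mkAlgHom_surjective k (ThetaRel Q) t
  have e₁ : lift f a hc hs (RingQuot.mkAlgHom k (ThetaRel Q) p) = Polynomial.eval₂AlgHom f a hc p :=
    RingQuot.liftAlgHom_mkAlgHom_apply _ _ _ _
  have e₂ : lift g b hc' hs' (RingQuot.mkAlgHom k (ThetaRel Q) p) =
      Polynomial.eval₂AlgHom g b hc' p :=
    RingQuot.liftAlgHom_mkAlgHom_apply _ _ _ _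
  rw [e₁, e₂]
  simp only [Polynomial.eval₂AlgHom_apply, Polynomial.eval₂_eq_sum_range]
  have hpow : ∀ (n : ℕ) (v : V), φ ((a ^ n) v) = (b ^ n) (φ v) := by
    intro n
    induction n with
    | zero => simp
    | succ n ih => intro v; simp [pow_succ, ih, hab]
  simp [LinearMap.sum_apply, hφ, hpow]

/-- `Qθ` is the quasitriangular quasi-Hopf structure on `H(θ)` which extends that of `H` and has
`Δ(θ) = (θ ⊗ θ)(R₂₁R)⁻¹`, `ε(θ) = 1`, `S(θ) = θ`, with the same reassociator, `α`, `β` and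
`R`-matrix as `H`. -/
structure IsExtension (Qθ : QTQuasiHopfAlgebra k (HTheta Q)) : Prop where
  Δ_ι : ∀ h, Qθ.Δ (ι Q h) = Algebra.TensorProduct.map (ι Q) (ι Q) (Q.Δ h)
  Δ_θ : Qθ.Δ (θ Q) = (θ Q ⊗ₜ[k] θ Q) *
    Algebra.TensorProduct.map (ι Q) (ι Q) ((Q.monodromy⁻¹ : (H ⊗[k] H)ˣ) : H ⊗[k] H)
  counit_ι : ∀ h, Qθ.counit (ι Q h) = Q.counit h
  counit_θ : Qθ.counit (θ Q) = 1
  S_ι : ∀ h, Qθ.S (ι Q h) = ι Q (Q.S h)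
  S_θ : Qθ.S (θ Q) = θ Q
  Φ_eq : (Qθ.Φ : HTheta Q ⊗[k] (HTheta Q ⊗[k] HTheta Q)) =
    Algebra.TensorProduct.map (ι Q) (Algebra.TensorProduct.map (ι Q) (ι Q))
      (Q.Φ : H ⊗[k] (H ⊗[k] H))
  α_eq : Qθ.α = ι Q Q.α
  β_eq : Qθ.β = ι Q Q.β
  R_eq : (Qθ.R : HTheta Q ⊗[k] HTheta Q) =
    Algebra.TensorProduct.map (ι Q) (ι Q) (Q.R : H ⊗[k] H)

end HTheta

end Theta

/-! ### Finite-dimensional modules -/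

section Act

variable {k : Type u} [Field k] {A B A' B' : Type*} [Ring A] [Algebra k A] [Ring B] [Algebra k B]
  [Ring A'] [Algebra k A'] [Ring B'] [Algebra k B']
  {V W X Y V' W' : Type u} [AddCommGroup V] [Module k V] [AddCommGroup W] [Module k W]
  [AddCommGroup X] [Module k X] [AddCommGroup Y] [Module k Y]
  [AddCommGroup V'] [Module k V'] [AddCommGroup W'] [Module k W']

/-- The action of `A ⊗ B` on `V ⊗ W`. -/
def act (f : A →ₐ[k] Module.End k V) (g : B →ₐ[k] Module.End k W) :
    A ⊗[k] B →ₐ[k] Module.End k (V ⊗[k] W) :=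
  Module.endTensorEndAlgHom.comp (Algebra.TensorProduct.map f g)

@[simp] lemma act_tmul (f : A →ₐ[k] Module.End k V) (g : B →ₐ[k] Module.End k W)
    (a : A) (b : B) (v : V) (w : W) : act f g (a ⊗ₜ b) (v ⊗ₜ w) = f a v ⊗ₜ g b w := rfl

lemma act_tmul_eq (f : A →ₐ[k] Module.End k V) (g : B →ₐ[k] Module.End k W)
    (a : A) (b : B) : act f g (a ⊗ₜ b) = TensorProduct.map (f a) (g b) := rfl

lemma act_map (f : A →ₐ[k] Module.End k V) (g : B →ₐ[k] Module.End k W)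
    (φ : A' →ₐ[k] A) (ψ : B' →ₐ[k] B) (t : A' ⊗[k] B') :
    act (f.comp φ) (g.comp ψ) t = act f g (Algebra.TensorProduct.map φ ψ t) := by
  induction t using TensorProduct.induction_on with
  | zero => simp
  | tmul a b => rfl
  | add a b ha hb => simp only [map_add, ha, hb]

lemma act_map_left (f : A →ₐ[k] Module.End k V) (g : B →ₐ[k] Module.End k W)
    (φ : A' →ₐ[k] A) (t : A' ⊗[k] B) :
    act (f.comp φ) g t = act f g (Algebra.TensorProduct.map φ (AlgHom.id k B) t) :=
  act_map f g φ (AlgHom.id k B) t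

lemma act_map_right (f : A →ₐ[k] Module.End k V) (g : B →ₐ[k] Module.End k W)
    (ψ : B' →ₐ[k] B) (t : A ⊗[k] B') :
    act f (g.comp ψ) t = act f g (Algebra.TensorProduct.map (AlgHom.id k A) ψ t) :=
  act_map f g (AlgHom.id k A) ψ t

lemma act_intertwine {f : A →ₐ[k] Module.End k V} {f' : A →ₐ[k] Module.End k V'}
    {g : B →ₐ[k] Module.End k W} {g' : B →ₐ[k] Module.End k W'} {φ : V →ₗ[k] V'} {ψ : W →ₗ[k] W'}
    (hφ : ∀ a v, φ (f a v) = f' a (φ v)) (hψ : ∀ a v, ψ (g a v) = g' a (ψ v))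
    (t : A ⊗[k] B) (z : V ⊗[k] W) :
    TensorProduct.map φ ψ (act f g t z) = act f' g' t (TensorProduct.map φ ψ z) := by
  induction t using TensorProduct.induction_on with
  | zero => simp
  | add a b ha hb => simp only [map_add, LinearMap.add_apply, ha, hb]
  | tmul a b =>
    induction z using TensorProduct.induction_on with
    | zero => simp
    | add a b ha hb => simp only [map_add, ha, hb]
    | tmul v w => simp [hφ, hψ]

lemma act_assoc {C : Type*} [Ring C] [Algebra k C]
    (f : A →ₐ[k] Module.End k V) (g : B →ₐ[k] Module.End k W) (h : C →ₐ[k] Module.End k X)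
    (t : (A ⊗[k] B) ⊗[k] C) (z : (V ⊗[k] W) ⊗[k] X) :
    TensorProduct.assoc k V W X (act (act f g) h t z) =
      act f (act g h) (Algebra.TensorProduct.assoc k k k A B C t)
        (TensorProduct.assoc k V W X z) := by
  induction t using TensorProduct.induction_on with
  | zero => simp
  | add a b ha hb => simp only [map_add, LinearMap.add_apply, ha, hb]
  | tmul p c =>
    induction p using TensorProduct.induction_on with
    | zero => simp
    | add a b ha hb => simp only [TensorProduct.add_tmul, map_add, LinearMap.add_apply, ha, hb]
    | tmul a b =>
      induction z using TensorProduct.induction_on with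
      | zero => simp
      | add a b ha hb => simp only [map_add, ha, hb]
      | tmul q x =>
        induction q using TensorProduct.induction_on with
        | zero => simp
        | add a b ha hb => simp only [TensorProduct.add_tmul, map_add, ha, hb]
        | tmul v w => simp

lemma act_comm (f : A →ₐ[k] Module.End k V) (g : B →ₐ[k] Module.End k W)
    (t : A ⊗[k] B) (z : V ⊗[k] W) :
    TensorProduct.comm k V W (act f g t z) =
      act g f (Algebra.TensorProduct.comm k A B t) (TensorProduct.comm k V W z) := by
  induction t using TensorProduct.induction_on with
  | zero => simp
  | add a b ha hb => simp only [map_add, LinearMap.add_apply, ha, hb]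
  | tmul a b =>
    induction z using TensorProduct.induction_on with
    | zero => simp
    | add a b ha hb => simp only [map_add, ha, hb]
    | tmul v w => simp

end Act

section Raw

variable {k : Type u} {H : Type w} [Field k] [Ring H] [Algebra k H] (Q : QTQuasiHopfAlgebra k H)
  {V W X Y : Type u} [AddCommGroup V] [Module k V] [AddCommGroup W] [Module k W]
  [AddCommGroup X] [Module k X] [AddCommGroup Y] [Module k Y]
  (e : H →ₐ[k] Module.End k V) (f : H →ₐ[k] Module.End k W)
  (g : H →ₐ[k] Module.End k X) (h : H →ₐ[k] Module.End k Y)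

/-- The action of `H` on `V ⊗ W` through `Δ`. -/
def tens : H →ₐ[k] Module.End k (V ⊗[k] W) := (act e f).comp Q.Δ

/-- The trivial action of `H` on `k`, through `ε`. -/
def triv : H →ₐ[k] Module.End k k := (Algebra.lmul k k).comp Q.counit

/-- `(v ⊗ w) ⊗ x ↦ X¹ v ⊗ (X² w ⊗ X³ x)`. -/
def assocMap : (V ⊗[k] W) ⊗[k] X →ₗ[k] V ⊗[k] (W ⊗[k] X) :=
  act e (act f g) (Q.Φ : H ⊗[k] (H ⊗[k] H)) ∘ₗ (TensorProduct.assoc k V W X).toLinearMap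

/-- `v ⊗ (w ⊗ x) ↦ (x¹ v ⊗ x² w) ⊗ x³ x`. -/
def assocInvMap : V ⊗[k] (W ⊗[k] X) →ₗ[k] (V ⊗[k] W) ⊗[k] X :=
  (TensorProduct.assoc k V W X).symm.toLinearMap ∘ₗ
    act e (act f g) ((Q.Φ⁻¹ : (H ⊗[k] (H ⊗[k] H))ˣ) : H ⊗[k] (H ⊗[k] H))

lemma act_mul_apply {A : Type*} [Ring A] [Algebra k A] (F : A →ₐ[k] Module.End k V) (a b : A)
    (v : V) : F a (F b v) = F (a * b) v := by
  rw [map_mul, Module.End.mul_apply]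

lemma act_mul_apply' {A : Type*} [Ring A] [Algebra k A] {F : A →ₐ[k] Module.End k V} {a b c : A}
    (hab : a * b = c) (v : V) : F a (F b v) = F c v := by
  rw [act_mul_apply, hab]

lemma assocMap_inv : assocInvMap Q e f g ∘ₗ assocMap Q e f g = LinearMap.id := by
  refine LinearMap.ext fun z => ?_
  simp only [assocInvMap, assocMap, LinearMap.comp_apply, LinearEquiv.coe_coe,
    LinearMap.id_apply]
  rw [act_mul_apply, Units.inv_mul, map_one, Module.End.one_apply, LinearEquiv.symm_apply_apply]

lemma assocMap_inv' : assocMap Q e f g ∘ₗ assocInvMap Q e f g = LinearMap.id := by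
  refine LinearMap.ext fun z => ?_
  simp only [assocInvMap, assocMap, LinearMap.comp_apply, LinearEquiv.coe_coe,
    LinearMap.id_apply, LinearEquiv.apply_symm_apply]
  rw [act_mul_apply, Units.mul_inv, map_one, Module.End.one_apply]

lemma assocMap_linear (a : H) (z : (V ⊗[k] W) ⊗[k] X) :
    assocMap Q e f g (tens Q (tens Q e f) g a z) =
      tens Q e (tens Q f g) a (assocMap Q e f g z) := by
  change act e (act f g) Q.Φ (TensorProduct.assoc k V W X
      (act ((act e f).comp Q.Δ) g (Q.Δ a) z)) =
      act e ((act f g).comp Q.Δ) (Q.Δ a)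
        (act e (act f g) Q.Φ (TensorProduct.assoc k V W X z))
  rw [act_map_left, act_map_right, act_assoc, act_mul_apply, act_mul_apply]
  have := Q.quasi_coassoc a
  rw [← Units.mul_inv_eq_iff_eq_mul, inv_inv] at this
  exact congrArg (fun t => act e (act f g) t _) this.symm

lemma pentagon_aux1 (t : H ⊗[k] (H ⊗[k] H)) (z : V ⊗[k] (W ⊗[k] X)) (y : Y) :
    TensorProduct.map LinearMap.id (TensorProduct.assoc k W X Y).toLinearMap
      (TensorProduct.assoc k V (W ⊗[k] X) Y ((act e (act f g) t z) ⊗ₜ y)) =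
    act e (act f (act g h)) (Algebra.TensorProduct.map (AlgHom.id k H) (incl12 k H) t)
      (TensorProduct.map LinearMap.id (TensorProduct.assoc k W X Y).toLinearMap
        (TensorProduct.assoc k V (W ⊗[k] X) Y (z ⊗ₜ y))) := by
  induction t using TensorProduct.induction_on with
  | zero => simp
  | add a b ha hb => simp only [map_add, LinearMap.add_apply, TensorProduct.add_tmul, ha, hb]
  | tmul a p =>
    induction p using TensorProduct.induction_on with
    | zero => simp
    | add a b ha hb =>
      simp only [TensorProduct.tmul_add, map_add, LinearMap.add_apply, TensorProduct.add_tmul,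
        ha, hb]
    | tmul b c =>
      induction z using TensorProduct.induction_on with
      | zero => simp
      | add a b ha hb => simp only [map_add, TensorProduct.add_tmul, ha, hb]
      | tmul v q =>
        induction q using TensorProduct.induction_on with
        | zero => simp
        | add a b ha hb =>
          simp only [TensorProduct.tmul_add, map_add, TensorProduct.add_tmul, ha, hb]
        | tmul w x => simp [incl12]

lemma pentagon_aux2 (t : H ⊗[k] (H ⊗[k] H)) (z : V ⊗[k] ((W ⊗[k] X) ⊗[k] Y)) :
    TensorProduct.map LinearMap.id (TensorProduct.assoc k W X Y).toLinearMap
      (act e (act (tens Q f g) h) t z) =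
    act e (act f (act g h)) (Algebra.TensorProduct.map (AlgHom.id k H) (comulLeft Q.Δ) t)
      (TensorProduct.map LinearMap.id (TensorProduct.assoc k W X Y).toLinearMap z) := by
  rw [← act_map_right]
  refine act_intertwine (fun _ _ => rfl) (fun s v => ?_) t z
  change TensorProduct.assoc k W X Y (act ((act f g).comp Q.Δ) h s v) = _
  rw [act_map_left, act_assoc]
  rfl

lemma pentagon_raw (z : ((V ⊗[k] W) ⊗[k] X) ⊗[k] Y) :
    TensorProduct.map LinearMap.id (assocMap Q f g h)
      (assocMap Q e (tens Q f g) h (TensorProduct.map (assocMap Q e f g) LinearMap.id z)) =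
    assocMap Q e f (tens Q g h) (assocMap Q (tens Q e f) g h z) := by
  induction z using TensorProduct.induction_on with
  | zero => simp
  | add a b ha hb => simp only [map_add, ha, hb]
  | tmul z y =>
    have h1 : (TensorProduct.map LinearMap.id (assocMap Q f g h) :
        V ⊗[k] ((W ⊗[k] X) ⊗[k] Y) →ₗ[k] _) =
        act e (act f (act g h)) (Algebra.TensorProduct.includeRight
          (Q.Φ : H ⊗[k] (H ⊗[k] H))) ∘ₗ
          TensorProduct.map LinearMap.id (TensorProduct.assoc k W X Y).toLinearMap := by
      rw [Algebra.TensorProduct.includeRight_apply, act_tmul_eq, map_one,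
        ← TensorProduct.map_comp]
      rfl
    rw [h1]
    simp only [assocMap, LinearMap.comp_apply, LinearEquiv.coe_coe, TensorProduct.map_tmul,
      LinearMap.id_apply]
    rw [pentagon_aux2, pentagon_aux1, act_mul_apply, act_mul_apply]
    have h2 : TensorProduct.assoc k V W (X ⊗[k] Y)
        (act (tens Q e f) (act g h) (Q.Φ : H ⊗[k] (H ⊗[k] H))
          (TensorProduct.assoc k (V ⊗[k] W) X Y (z ⊗ₜ y))) =
        act e (act f (act g h)) (Algebra.TensorProduct.assoc k k k H H (H ⊗[k] H)
        (Algebra.TensorProduct.map Q.Δ (AlgHom.id k (H ⊗[k] H)) (Q.Φ : H ⊗[k] (H ⊗[k] H))))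
          (TensorProduct.assoc k V W (X ⊗[k] Y)
            (TensorProduct.assoc k (V ⊗[k] W) X Y (z ⊗ₜ y))) := by
      rw [tens, act_map_left, act_assoc]
    have h3 : act e (act f (tens Q g h)) (Q.Φ : H ⊗[k] (H ⊗[k] H)) =
        act e (act f (act g h)) (Algebra.TensorProduct.map (AlgHom.id k H) (comulRight Q.Δ)
          (Q.Φ : H ⊗[k] (H ⊗[k] H))) := by
      rw [← act_map_right]
      congr 2
      exact AlgHom.ext fun s => act_map_right f (act g h) Q.Δ s
    rw [h2, h3, act_mul_apply, ← Q.cocycle]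
    congr 1
    clear h1 h2 h3
    induction z using TensorProduct.induction_on with
    | zero => simp
    | add a b ha hb => simp only [map_add, TensorProduct.add_tmul, ha, hb]
    | tmul q x =>
      induction q using TensorProduct.induction_on with
      | zero => simp
      | add a b ha hb => simp only [map_add, TensorProduct.add_tmul, ha, hb]
      | tmul v w => simp

lemma lid_act (t : H ⊗[k] H) (z : k ⊗[k] V) :
    TensorProduct.lid k V (act (triv Q) e t z) =
      e (TensorProduct.lid k H (Algebra.TensorProduct.map Q.counit (AlgHom.id k H) t))
        (TensorProduct.lid k V z) := by
  induction t using TensorProduct.induction_on with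
  | zero => simp
  | add a b ha hb => simp only [map_add, LinearMap.add_apply, ha, hb]
  | tmul a b =>
    induction z using TensorProduct.induction_on with
    | zero => simp
    | add a b ha hb => simp only [map_add, ha, hb]
    | tmul v w => simp [triv, mul_smul, smul_comm (_ : k) (_ : k)]

lemma rid_act (t : H ⊗[k] H) (z : V ⊗[k] k) :
    TensorProduct.rid k V (act e (triv Q) t z) =
      e (TensorProduct.rid k H (Algebra.TensorProduct.map (AlgHom.id k H) Q.counit t))
        (TensorProduct.rid k V z) := by
  induction t using TensorProduct.induction_on with
  | zero => simp
  | add a b ha hb => simp only [map_add, LinearMap.add_apply, ha, hb]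
  | tmul a b =>
    induction z using TensorProduct.induction_on with
    | zero => simp
    | add a b ha hb => simp only [map_add, ha, hb]
    | tmul v w => simp [triv, mul_smul, smul_comm (_ : k) (_ : k)]

lemma lid_linear (a : H) (z : k ⊗[k] V) :
    TensorProduct.lid k V (tens Q (triv Q) e a z) = e a (TensorProduct.lid k V z) := by
  change TensorProduct.lid k V (act (triv Q) e (Q.Δ a) z) = _
  rw [lid_act, Q.counit_id]

lemma rid_linear (a : H) (z : V ⊗[k] k) :
    TensorProduct.rid k V (tens Q e (triv Q) a z) = e a (TensorProduct.rid k V z) := by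
  change TensorProduct.rid k V (act e (triv Q) (Q.Δ a) z) = _
  rw [rid_act, Q.id_counit]

lemma triangle_raw (z : (V ⊗[k] k) ⊗[k] W) :
    TensorProduct.map LinearMap.id (TensorProduct.lid k W).toLinearMap
      (assocMap Q e (triv Q) f z) =
    TensorProduct.map (TensorProduct.rid k V).toLinearMap LinearMap.id z := by
  simp only [assocMap, LinearMap.comp_apply, LinearEquiv.coe_coe]
  rw [act_intertwine (f' := e) (g' := f.comp ((Algebra.TensorProduct.lid k H).toAlgHom.comp
        (Algebra.TensorProduct.map Q.counit (AlgHom.id k H)))) (fun _ _ => rfl)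
        (fun t v => lid_act Q f t v), act_map_right, Q.counit_reassociator, map_one,
        Module.End.one_apply]
  induction z using TensorProduct.induction_on with
  | zero => simp
  | add a b ha hb => simp only [map_add, ha, hb]
  | tmul q x =>
    induction q using TensorProduct.induction_on with
    | zero => simp
    | add a b ha hb => simp only [map_add, TensorProduct.add_tmul, ha, hb]
    | tmul v w => simp [TensorProduct.smul_tmul]

lemma assocMap_natural {V' W' X' : Type u} [AddCommGroup V'] [Module k V'] [AddCommGroup W']
    [Module k W'] [AddCommGroup X'] [Module k X']
    {e' : H →ₐ[k] Module.End k V'} {f' : H →ₐ[k] Module.End k W'} {g' : H →ₐ[k] Module.End k X'}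
    {φ : V →ₗ[k] V'} {ψ : W →ₗ[k] W'} {χ : X →ₗ[k] X'}
    (hφ : ∀ a v, φ (e a v) = e' a (φ v)) (hψ : ∀ a v, ψ (f a v) = f' a (ψ v))
    (hχ : ∀ a v, χ (g a v) = g' a (χ v)) (z : (V ⊗[k] W) ⊗[k] X) :
    assocMap Q e' f' g' (TensorProduct.map (TensorProduct.map φ ψ) χ z) =
      TensorProduct.map φ (TensorProduct.map ψ χ) (assocMap Q e f g z) := by
  simp only [assocMap, LinearMap.comp_apply, LinearEquiv.coe_coe]
  rw [act_intertwine hφ (act_intertwine hψ hχ), TensorProduct.map_map_assoc]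

/-- `v ⊗ w ↦ R² w ⊗ R¹ v`. -/
def braidMap : V ⊗[k] W →ₗ[k] W ⊗[k] V :=
  (TensorProduct.comm k V W).toLinearMap ∘ₗ act e f (Q.R : H ⊗[k] H)

/-- The inverse of `braidMap`. -/
def braidInvMap : W ⊗[k] V →ₗ[k] V ⊗[k] W :=
  act e f ((Q.R⁻¹ : (H ⊗[k] H)ˣ) : H ⊗[k] H) ∘ₗ (TensorProduct.comm k W V).toLinearMap

lemma braidMap_inv : braidInvMap Q e f ∘ₗ braidMap Q e f = LinearMap.id := by
  refine LinearMap.ext fun z => ?_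
  simp only [braidInvMap, braidMap, LinearMap.comp_apply, LinearEquiv.coe_coe,
    LinearMap.id_apply]
  rw [TensorProduct.comm_comm, act_mul_apply, Units.inv_mul, map_one, Module.End.one_apply]

lemma braidMap_inv' : braidMap Q e f ∘ₗ braidInvMap Q e f = LinearMap.id := by
  refine LinearMap.ext fun z => ?_
  simp only [braidInvMap, braidMap, LinearMap.comp_apply, LinearEquiv.coe_coe,
    LinearMap.id_apply]
  rw [act_mul_apply, Units.mul_inv, map_one, Module.End.one_apply, TensorProduct.comm_comm]

lemma braidMap_linear (a : H) (z : V ⊗[k] W) :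
    braidMap Q e f (tens Q e f a z) = tens Q f e a (braidMap Q e f z) := by
  change TensorProduct.comm k V W (act e f Q.R (act e f (Q.Δ a) z)) =
    act f e (Q.Δ a) (TensorProduct.comm k V W (act e f Q.R z))
  have h1 : Q.Δ a = Algebra.TensorProduct.comm k H H (flip2 k H (Q.Δ a)) := by
    change _ = Algebra.TensorProduct.comm k H H (Algebra.TensorProduct.comm k H H (Q.Δ a))
    exact ((Algebra.TensorProduct.comm k H H).symm_apply_apply (Q.Δ a)).symm
  rw [act_mul_apply, ← Q.comul_op]
  conv_rhs => rw [h1, ← act_comm, act_mul_apply]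

lemma cycle_act (t : H ⊗[k] (H ⊗[k] H)) (z : V ⊗[k] (W ⊗[k] X)) :
    TensorProduct.assoc k W X V (TensorProduct.comm k V (W ⊗[k] X) (act e (act f g) t z)) =
      act f (act g e) (perm312 k H t)
        (TensorProduct.assoc k W X V (TensorProduct.comm k V (W ⊗[k] X) z)) := by
  rw [act_comm, act_assoc]; rfl

lemma leftComm_act (t : H ⊗[k] (H ⊗[k] H)) (z : V ⊗[k] (W ⊗[k] X)) :
    TensorProduct.leftComm k V W X (act e (act f g) t z) =
      act f (act e g) (perm213 k H t) (TensorProduct.leftComm k V W X z) := by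
  induction t using TensorProduct.induction_on with
  | zero => simp
  | add a b ha hb => simp only [map_add, LinearMap.add_apply, ha, hb]
  | tmul a p =>
    induction p using TensorProduct.induction_on with
    | zero => simp
    | add a b ha hb => simp only [TensorProduct.tmul_add, map_add, LinearMap.add_apply, ha, hb]
    | tmul b c =>
      induction z using TensorProduct.induction_on with
      | zero => simp
      | add a b ha hb => simp only [map_add, ha, hb]
      | tmul v q =>
        induction q using TensorProduct.induction_on with
        | zero => simp
        | add a b ha hb => simp only [TensorProduct.tmul_add, map_add, ha, hb]
        | tmul w x => simp [perm213]

lemma hexagon_aux12 (t : H ⊗[k] H) (z : V ⊗[k] W) (x : X) :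
    TensorProduct.assoc k W V X ((TensorProduct.comm k V W (act e f t z)) ⊗ₜ x) =
      TensorProduct.leftComm k V W X (act e (act f g) (incl12 k H t)
        (TensorProduct.assoc k V W X (z ⊗ₜ x))) := by
  induction t using TensorProduct.induction_on with
  | zero => simp
  | add a b ha hb => simp only [map_add, LinearMap.add_apply, TensorProduct.add_tmul, ha, hb]
  | tmul a b =>
    induction z using TensorProduct.induction_on with
    | zero => simp
    | add a b ha hb => simp only [map_add, TensorProduct.add_tmul, ha, hb]
    | tmul v w => simp [incl12]

lemma hexagon_aux13 (t : H ⊗[k] H) (z : V ⊗[k] (W ⊗[k] X)) :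
    TensorProduct.map LinearMap.id ((TensorProduct.comm k V X).toLinearMap ∘ₗ act e g t)
      (TensorProduct.leftComm k V W X z) =
    TensorProduct.assoc k W X V (TensorProduct.comm k V (W ⊗[k] X)
      (act e (act f g) (incl13 k H t) z)) := by
  induction t using TensorProduct.induction_on with
  | zero => simp [TensorProduct.map_zero_right]
  | add a b ha hb =>
    simp only [map_add, LinearMap.add_apply, LinearMap.comp_add, TensorProduct.map_add_right,
      ha, hb]
  | tmul a b =>
    induction z using TensorProduct.induction_on with
    | zero => simp
    | add a b ha hb => simp only [map_add, ha, hb]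
    | tmul v q =>
      induction q using TensorProduct.induction_on with
      | zero => simp
      | add a b ha hb => simp only [TensorProduct.tmul_add, map_add, ha, hb]
      | tmul w x => simp [incl13]

lemma perm213_perm213 (t : H ⊗[k] (H ⊗[k] H)) : perm213 k H (perm213 k H t) = t := by
  induction t using TensorProduct.induction_on with
  | zero => simp
  | add a b ha hb => simp only [map_add, ha, hb]
  | tmul a p =>
    induction p using TensorProduct.induction_on with
    | zero => simp
    | add a b ha hb => simp only [TensorProduct.tmul_add, map_add, ha, hb]
    | tmul b c => simp [perm213]

lemma hexagon_forward_raw (z : (V ⊗[k] W) ⊗[k] X) :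
    assocMap Q f g e (braidMap Q e (tens Q f g) (assocMap Q e f g z)) =
      TensorProduct.map LinearMap.id (braidMap Q e g)
        (assocMap Q f e g (TensorProduct.map (braidMap Q e f) LinearMap.id z)) := by
  induction z using TensorProduct.induction_on with
  | zero => simp
  | add a b ha hb => simp only [map_add, ha, hb]
  | tmul z x =>
    have hR : act e (tens Q f g) (Q.R : H ⊗[k] H) =
        act e (act f g) (comulRight Q.Δ (Q.R : H ⊗[k] H)) := by
      rw [tens, act_map_right]; rfl
    simp only [assocMap, braidMap, LinearMap.comp_apply, LinearEquiv.coe_coe,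
      TensorProduct.map_tmul, LinearMap.id_apply]
    rw [hR, act_mul_apply, cycle_act, act_mul_apply, hexagon_aux12 e f g]
    rw [show act f (act e g) (Q.Φ : H ⊗[k] (H ⊗[k] H)) =
      act f (act e g) (perm213 k H (perm213 k H (Q.Φ : H ⊗[k] (H ⊗[k] H)))) by
        rw [perm213_perm213], ← leftComm_act, hexagon_aux13 e f g, act_mul_apply,
      act_mul_apply, cycle_act]
    congr 2
    rw [Q.id_comul_R]
    simp only [mul_assoc, Units.inv_mul, mul_one]
    simp only [map_mul, AlgEquiv.apply_symm_apply]
    rw [Units.mul_inv_cancel_left]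

lemma hexagon_aux23 (t : H ⊗[k] H) (v : V) (z : W ⊗[k] X) :
    (TensorProduct.assoc k V X W).symm
      (v ⊗ₜ (TensorProduct.comm k W X (act f g t z))) =
    (TensorProduct.assoc k V X W).symm (TensorProduct.map LinearMap.id
      (TensorProduct.comm k W X).toLinearMap (act e (act f g) (incl23 k H t) (v ⊗ₜ z))) := by
  simp [incl23]

lemma perm132_act (t : H ⊗[k] (H ⊗[k] H)) (z : V ⊗[k] (W ⊗[k] X)) :
    TensorProduct.map LinearMap.id (TensorProduct.comm k W X).toLinearMap
        (act e (act f g) t z) =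
      act e (act g f) (perm132 k H t) (TensorProduct.map LinearMap.id
        (TensorProduct.comm k W X).toLinearMap z) := by
  have := act_intertwine (f' := e) (g' := (act g f).comp (flip2 k H).toAlgHom)
    (φ := LinearMap.id) (ψ := (TensorProduct.comm k W X).toLinearMap)
    (fun _ _ => rfl) (fun a v => act_comm f g a v) t z
  rw [this, act_map_right]
  rfl

lemma perm132_perm132 (t : H ⊗[k] (H ⊗[k] H)) : perm132 k H (perm132 k H t) = t := by
  induction t using TensorProduct.induction_on with
  | zero => simp
  | add a b ha hb => simp only [map_add, ha, hb]
  | tmul a p =>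
    induction p using TensorProduct.induction_on with
    | zero => simp
    | add a b ha hb => simp only [TensorProduct.tmul_add, map_add, ha, hb]
    | tmul b c => simp [perm132, flip2]

lemma hexagon_aux13' (t : H ⊗[k] H) (z : V ⊗[k] (W ⊗[k] X)) :
    TensorProduct.map ((TensorProduct.comm k V X).toLinearMap ∘ₗ act e g t) LinearMap.id
      ((TensorProduct.assoc k V X W).symm (TensorProduct.map LinearMap.id
        (TensorProduct.comm k W X).toLinearMap z)) =
    (TensorProduct.assoc k X V W).symm (TensorProduct.comm k (V ⊗[k] W) X
      ((TensorProduct.assoc k V W X).symm (act e (act f g) (incl13 k H t) z))) := by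
  induction t using TensorProduct.induction_on with
  | zero => simp [TensorProduct.map_zero_left]
  | add a b ha hb =>
    simp only [map_add, LinearMap.add_apply, LinearMap.comp_add, TensorProduct.map_add_left,
      ha, hb]
  | tmul a b =>
    induction z using TensorProduct.induction_on with
    | zero => simp
    | add a b ha hb => simp only [map_add, ha, hb]
    | tmul v q =>
      induction q using TensorProduct.induction_on with
      | zero => simp
      | add a b ha hb => simp only [TensorProduct.tmul_add, map_add, ha, hb]
      | tmul w x => simp [incl13]

lemma act_assoc_symm (t : H ⊗[k] (H ⊗[k] H)) (z : V ⊗[k] (W ⊗[k] X)) :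
    (TensorProduct.assoc k V W X).symm (act e (act f g) t z) =
      act (act e f) g ((Algebra.TensorProduct.assoc k k k H H H).symm t)
        ((TensorProduct.assoc k V W X).symm z) := by
  rw [LinearEquiv.symm_apply_eq, act_assoc]
  simp

lemma cycle_act' (t : H ⊗[k] (H ⊗[k] H)) (z : V ⊗[k] (W ⊗[k] X)) :
    TensorProduct.comm k (V ⊗[k] W) X ((TensorProduct.assoc k V W X).symm
      (act e (act f g) t z)) =
      act g (act e f) ((perm312 k H).symm t)
        (TensorProduct.comm k (V ⊗[k] W) X ((TensorProduct.assoc k V W X).symm z)) := by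
  rw [act_assoc_symm, act_comm]; rfl

lemma hexagon_reverse_raw (z : V ⊗[k] (W ⊗[k] X)) :
    assocInvMap Q g e f (braidMap Q (tens Q e f) g (assocInvMap Q e f g z)) =
      TensorProduct.map (braidMap Q e g) LinearMap.id
        (assocInvMap Q e g f (TensorProduct.map LinearMap.id (braidMap Q f g) z)) := by
  induction z using TensorProduct.induction_on with
  | zero => simp
  | add a b ha hb => simp only [map_add, ha, hb]
  | tmul v z =>
    have hR : ∀ y : V ⊗[k] (W ⊗[k] X), act (tens Q e f) g (Q.R : H ⊗[k] H)
        ((TensorProduct.assoc k V W X).symm y) = (TensorProduct.assoc k V W X).symm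
        (act e (act f g) (comulLeft Q.Δ (Q.R : H ⊗[k] H)) y) := by
      intro y
      rw [tens, act_map_left, LinearEquiv.eq_symm_apply, act_assoc,
        LinearEquiv.apply_symm_apply]; rfl
    simp only [assocInvMap, braidMap, LinearMap.comp_apply, LinearEquiv.coe_coe,
      TensorProduct.map_tmul, LinearMap.id_apply]
    have h23 : v ⊗ₜ[k] (TensorProduct.comm k W X (act f g (Q.R : H ⊗[k] H) z)) =
        TensorProduct.map LinearMap.id (TensorProduct.comm k W X).toLinearMap
          (act e (act f g) (incl23 k H (Q.R : H ⊗[k] H)) (v ⊗ₜ z)) := by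
      simp [incl23]
    rw [hR, act_mul_apply, cycle_act', act_mul_apply, h23]
    rw [show act e (act g f) ((Q.Φ⁻¹ : (H ⊗[k] (H ⊗[k] H))ˣ) : H ⊗[k] (H ⊗[k] H)) =
      act e (act g f) (perm132 k H (perm132 k H
        ((Q.Φ⁻¹ : (H ⊗[k] (H ⊗[k] H))ˣ) : H ⊗[k] (H ⊗[k] H)))) by
        rw [perm132_perm132], ← perm132_act, hexagon_aux13' e f g, act_mul_apply,
      act_mul_apply, cycle_act']
    congr 2
    rw [Q.comul_id_R]
    simp only [mul_assoc, Units.mul_inv, mul_one]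
    simp only [map_mul ((perm312 k H).symm), AlgEquiv.symm_apply_apply]
    rw [Units.inv_mul_cancel_left]

lemma braidMap_natural {V' W' : Type u} [AddCommGroup V'] [Module k V'] [AddCommGroup W']
    [Module k W'] {e' : H →ₐ[k] Module.End k V'} {f' : H →ₐ[k] Module.End k W'}
    {φ : V →ₗ[k] V'} {ψ : W →ₗ[k] W'}
    (hφ : ∀ a v, φ (e a v) = e' a (φ v)) (hψ : ∀ a v, ψ (f a v) = f' a (ψ v)) (z : V ⊗[k] W) :
    braidMap Q e' f' (TensorProduct.map φ ψ z) =
      TensorProduct.map ψ φ (braidMap Q e f z) := by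
  simp only [braidMap, LinearMap.comp_apply, LinearEquiv.coe_coe]
  rw [← act_intertwine hφ hψ, TensorProduct.map_comm]

end Raw

variable {k : Type u} {H : Type w} [Field k] [Ring H] [Algebra k H]

/-- A finite-dimensional left module over the `k`-algebra `H` underlying `Q`: a
finite-dimensional vector space with an algebra map `H → End_k(V)`. -/
structure FDMod (Q : QTQuasiHopfAlgebra k H) : Type (max (u + 1) w) where
  V : Type u
  [addCommGroup : AddCommGroup V]
  [module : Module k V]
  [finite : FiniteDimensional k V]
  ρ : H →ₐ[k] Module.End k V

attribute [instance] FDMod.addCommGroup FDMod.module FDMod.finite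

namespace FDMod

variable {Q : QTQuasiHopfAlgebra k H}

/-- Morphisms: `H`-linear maps. -/
@[ext] structure Hom (X Y : FDMod Q) where
  lin : X.V →ₗ[k] Y.V
  comm : ∀ h v, lin (X.ρ h v) = Y.ρ h (lin v)

instance : Category (FDMod Q) where
  Hom := Hom
  id X := ⟨LinearMap.id, fun _ _ => rfl⟩
  comp f g := ⟨g.lin ∘ₗ f.lin, fun h v => by simp [f.comm, g.comm]⟩

@[ext] lemma hom_ext {X Y : FDMod Q} {f g : X ⟶ Y} (h : f.lin = g.lin) : f = g := Hom.ext h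

@[simp] lemma id_lin (X : FDMod Q) : Hom.lin (𝟙 X) = LinearMap.id := rfl
@[simp] lemma comp_lin {X Y Z : FDMod Q} (f : X ⟶ Y) (g : Y ⟶ Z) :
    (f ≫ g).lin = g.lin ∘ₗ f.lin := rfl

/-- `H` acts on `V ⊗ W` through `Δ`. -/
def tensor (X Y : FDMod Q) : FDMod Q where
  V := X.V ⊗[k] Y.V
  ρ := tens Q X.ρ Y.ρ

/-- `H` acts on `k` through `ε`. -/
def unit (Q : QTQuasiHopfAlgebra k H) : FDMod Q where
  V := k
  ρ := triv Q

/-- `f ⊗ g`. -/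
def tensorMap {X X' Y Y' : FDMod Q} (f : X ⟶ X') (g : Y ⟶ Y') : tensor X Y ⟶ tensor X' Y' where
  lin := TensorProduct.map f.lin g.lin
  comm _ z := act_intertwine f.comm g.comm _ z

/-- An isomorphism from a morphism and a linear inverse. -/
def mkIso {X Y : FDMod Q} (f : X ⟶ Y) (g : Y.V →ₗ[k] X.V) (h₁ : g ∘ₗ f.lin = LinearMap.id)
    (h₂ : f.lin ∘ₗ g = LinearMap.id) : X ≅ Y where
  hom := f
  inv := ⟨g, fun a v => by
    have e₁ : ∀ x, g (f.lin x) = x := fun x => LinearMap.congr_fun h₁ x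
    have e₂ : ∀ x, f.lin (g x) = x := fun x => LinearMap.congr_fun h₂ x
    rw [← e₁ (X.ρ a (g v)), f.comm, e₂]⟩
  hom_inv_id := hom_ext h₁
  inv_hom_id := hom_ext h₂

instance : MonoidalCategoryStruct (FDMod Q) where
  tensorObj := tensor
  tensorHom := tensorMap
  whiskerLeft X _ _ f := tensorMap (𝟙 X) f
  whiskerRight f Y := tensorMap f (𝟙 Y)
  tensorUnit := unit Q
  associator X Y Z := mkIso (X := tensor (tensor X Y) Z) (Y := tensor X (tensor Y Z))
    ⟨assocMap Q X.ρ Y.ρ Z.ρ, assocMap_linear Q X.ρ Y.ρ Z.ρ⟩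
    (assocInvMap Q X.ρ Y.ρ Z.ρ) (assocMap_inv Q X.ρ Y.ρ Z.ρ) (assocMap_inv' Q X.ρ Y.ρ Z.ρ)
  leftUnitor X := mkIso (X := tensor (unit Q) X) (Y := X)
    ⟨(TensorProduct.lid k X.V).toLinearMap, lid_linear Q X.ρ⟩
    (TensorProduct.lid k X.V).symm.toLinearMap
    (LinearMap.ext fun z => (TensorProduct.lid k X.V).symm_apply_apply z)
    (LinearMap.ext fun z => (TensorProduct.lid k X.V).apply_symm_apply z)
  rightUnitor X := mkIso (X := tensor X (unit Q)) (Y := X)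
    ⟨(TensorProduct.rid k X.V).toLinearMap, rid_linear Q X.ρ⟩
    (TensorProduct.rid k X.V).symm.toLinearMap
    (LinearMap.ext fun z => (TensorProduct.rid k X.V).symm_apply_apply z)
    (LinearMap.ext fun z => (TensorProduct.rid k X.V).apply_symm_apply z)

instance : MonoidalCategory (FDMod Q) :=
  MonoidalCategory.ofTensorHom
    (id_tensorHom_id := fun _ _ => hom_ext TensorProduct.map_id)
    (id_tensorHom := fun _ _ _ _ => rfl)
    (tensorHom_id := fun _ _ => rfl)
    (tensorHom_comp_tensorHom := fun _ _ _ _ => hom_ext (TensorProduct.map_comp _ _ _ _).symm)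
    (associator_naturality := fun f g h => hom_ext <| LinearMap.ext fun z =>
      assocMap_natural Q _ _ _ f.comm g.comm h.comm z)
    (leftUnitor_naturality := fun {X Y} f => hom_ext <| TensorProduct.ext' fun (a : k) x =>
      (map_smul f.lin a x).symm)
    (rightUnitor_naturality := fun {X Y} f => hom_ext <| TensorProduct.ext' fun x (a : k) =>
      (map_smul f.lin a x).symm)
    (pentagon := fun W X Y Z => hom_ext <| LinearMap.ext fun z =>
      pentagon_raw Q W.ρ X.ρ Y.ρ Z.ρ z)
    (triangle := fun X Y => hom_ext <| LinearMap.ext fun z =>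
      triangle_raw Q X.ρ Y.ρ z)

instance : BraidedCategory (FDMod Q) where
  braiding X Y := mkIso (X := tensor X Y) (Y := tensor Y X)
    ⟨braidMap Q X.ρ Y.ρ, braidMap_linear Q X.ρ Y.ρ⟩
    (braidInvMap Q X.ρ Y.ρ) (braidMap_inv Q X.ρ Y.ρ) (braidMap_inv' Q X.ρ Y.ρ)
  braiding_naturality_right X _ _ f := hom_ext <| LinearMap.ext fun z =>
    braidMap_natural Q _ _ (Hom.comm (𝟙 X)) f.comm z
  braiding_naturality_left f Z := hom_ext <| LinearMap.ext fun z =>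
    braidMap_natural Q _ _ f.comm (Hom.comm (𝟙 Z)) z
  hexagon_forward X Y Z := hom_ext <| LinearMap.ext fun z =>
    hexagon_forward_raw Q X.ρ Y.ρ Z.ρ z
  hexagon_reverse X Y Z := hom_ext <| LinearMap.ext fun z =>
    hexagon_reverse_raw Q X.ρ Y.ρ Z.ρ z

end FDMod
end QHopf

namespace QHopf
section RawDual

variable {k : Type u} {H : Type w} [Field k] [Ring H] [Algebra k H] (Q : QTQuasiHopfAlgebra k H)
  {V W : Type u} [AddCommGroup V] [Module k V] [FiniteDimensional k V] [AddCommGroup W]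
  [Module k W] [FiniteDimensional k W] (e : H →ₐ[k] Module.End k V) (f : H →ₐ[k] Module.End k W)

/-- The action `(h φ)(v) = φ(S(h) v)` of `H` on the dual space. -/
def dualRep : H →ₐ[k] Module.End k (Module.Dual k V) :=
  AlgHom.ofLinearMap (Module.Dual.transpose ∘ₗ e.toLinearMap ∘ₗ Q.S)
    (by
      refine LinearMap.ext fun φ => LinearMap.ext fun v => ?_
      simp [Q.S_one, Module.Dual.transpose_apply])
    (fun a b => by
      refine LinearMap.ext fun φ => LinearMap.ext fun v => ?_
      simp [Q.S_mul, Module.Dual.transpose_apply])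

lemma dualRep_apply (a : H) (φ : Module.Dual k V) (v : V) :
    dualRep Q e a φ v = φ (e (Q.S a) v) := rfl

/-- `φ ⊗ v ↦ φ(α v)`. -/
def evMap : Module.Dual k V ⊗[k] V →ₗ[k] k :=
  contractLeft k V ∘ₗ TensorProduct.map LinearMap.id (e Q.α)

/-- `1 ↦ ∑ᵢ β eᵢ ⊗ eⁱ`. -/
def coevMap : k →ₗ[k] V ⊗[k] Module.Dual k V :=
  TensorProduct.map (e Q.β) LinearMap.id ∘ₗ coevaluation k V

/-- `v ⊗ φ ↦ (x ↦ φ(x) v)`. -/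
def toEnd (k V : Type u) [Field k] [AddCommGroup V] [Module k V] :
    V ⊗[k] Module.Dual k V →ₗ[k] Module.End k V :=
  dualTensorHom k V V ∘ₗ (TensorProduct.comm k V (Module.Dual k V)).toLinearMap

lemma toEnd_tmul (v : V) (φ : Module.Dual k V) (x : V) : toEnd k V (v ⊗ₜ φ) x = φ x • v := by
  simp [toEnd]

lemma toEnd_injective : Function.Injective (toEnd k V) := by
  have h : Function.Injective (dualTensorHom k V V) := by
    have := (dualTensorHomEquiv k V V).injective
    intro a b hab
    exact this (by simpa using hab)
  exact h.comp (TensorProduct.comm k V (Module.Dual k V)).injective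

lemma toEnd_coev : toEnd k V (coevMap Q e 1) = e Q.β := by
  refine LinearMap.ext fun v => ?_
  simp only [coevMap, LinearMap.comp_apply, coevaluation_apply_one, map_sum,
    TensorProduct.map_tmul, LinearMap.id_apply, LinearMap.sum_apply, toEnd_tmul]
  simp only [← map_smul, ← map_sum]
  exact congrArg _ ((Module.Basis.ofVectorSpace k V).sum_repr v)

lemma evMap_act (t : H ⊗[k] H) (φ : Module.Dual k V) (v : V) :
    evMap Q e (act (dualRep Q e) e t (φ ⊗ₜ v)) =
      φ (e (mulMap Q.S (LinearMap.mulLeft k Q.α) t) v) := by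
  induction t using TensorProduct.induction_on with
  | zero => simp
  | add a b ha hb => simp only [map_add, LinearMap.add_apply, ha, hb]
  | tmul a b => simp [evMap, mulMap, dualRep_apply]

lemma evMap_linear (a : H) (z : Module.Dual k V ⊗[k] V) :
    evMap Q e (tens Q (dualRep Q e) e a z) = triv Q a (evMap Q e z) := by
  induction z using TensorProduct.induction_on with
  | zero => simp
  | add a b ha hb => simp only [map_add, ha, hb]
  | tmul φ v =>
    change evMap Q e (act (dualRep Q e) e (Q.Δ a) (φ ⊗ₜ v)) = _
    rw [evMap_act, Q.antipode_left]
    simp [triv, evMap]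

lemma toEnd_act (t : H ⊗[k] H) (z : V ⊗[k] Module.Dual k V) (v : V) :
    toEnd k V (act e (dualRep Q e) t z) v =
      LinearMap.mul' k (Module.End k V) (TensorProduct.map e.toLinearMap
        (LinearMap.mulLeft k (toEnd k V z) ∘ₗ e.toLinearMap ∘ₗ Q.S) t) v := by
  induction t using TensorProduct.induction_on with
  | zero => simp
  | add a b ha hb => simp only [map_add, LinearMap.add_apply, ha, hb]
  | tmul a b =>
    induction z using TensorProduct.induction_on with
    | zero => simp
    | add a b ha hb =>
      simp only [map_add, LinearMap.add_apply, ha, hb]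
      simp
    | tmul v φ => simp [toEnd_tmul, dualRep_apply]

lemma coevMap_linear (a : H) (c : k) :
    coevMap Q e (triv Q a c) = tens Q e (dualRep Q e) a (coevMap Q e c) := by
  have key : tens Q e (dualRep Q e) a (coevMap Q e 1) = Q.counit a • coevMap Q e 1 := by
    apply toEnd_injective
    refine LinearMap.ext fun v => ?_
    change toEnd k V (act e (dualRep Q e) (Q.Δ a) _) v = _
    rw [toEnd_act, toEnd_coev, map_smul, toEnd_coev]
    have h := congrArg e (Q.antipode_right a)
    rw [map_smul] at h
    rw [← h]
    congr 1
    generalize Q.Δ a = t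
    induction t using TensorProduct.induction_on with
    | zero => simp
    | add a b ha hb => simp only [map_add, ha, hb]
    | tmul a b => simp [mulMap, mul_assoc]
  have h1 : ∀ c : k, coevMap Q e c = c • coevMap Q e 1 := fun c => by
    rw [← map_smul, smul_eq_mul, mul_one]
  rw [h1, h1 c, map_smul, key, smul_smul]
  simp [triv, mul_comm]

lemma zigzag_aux (t : H ⊗[k] (H ⊗[k] H)) (z : V ⊗[k] Module.Dual k V) (v : V) :
    TensorProduct.rid k V (TensorProduct.map LinearMap.id (evMap Q e)
      (act e (act (dualRep Q e) e) t (TensorProduct.assoc k _ _ _ (z ⊗ₜ v)))) =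
    LinearMap.mul' k (Module.End k V) (TensorProduct.map e.toLinearMap
        (LinearMap.mulLeft k (toEnd k V z) ∘ₗ e.toLinearMap ∘ₗ
          mulMap Q.S (LinearMap.mulLeft k Q.α)) t) v := by
  induction t using TensorProduct.induction_on with
  | zero => simp
  | add a b ha hb => simp only [map_add, LinearMap.add_apply, ha, hb]
  | tmul a p =>
    induction z using TensorProduct.induction_on with
    | zero => simp
    | add a b ha hb =>
      simp only [map_add, TensorProduct.add_tmul, ha, hb]
      simp
    | tmul w φ =>
      rw [TensorProduct.assoc_tmul, act_tmul, TensorProduct.map_tmul, evMap_act]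
      simp [toEnd_tmul]

lemma zigzag_raw (c : k) (v : V) :
    TensorProduct.map LinearMap.id (evMap Q e)
      (assocMap Q e (dualRep Q e) e (TensorProduct.map (coevMap Q e) LinearMap.id (c ⊗ₜ v))) =
    (TensorProduct.rid k V).symm (TensorProduct.lid k V (c ⊗ₜ v)) := by
  rw [LinearEquiv.eq_symm_apply]
  simp only [assocMap, LinearMap.comp_apply, LinearEquiv.coe_coe, TensorProduct.map_tmul,
    LinearMap.id_apply]
  have h1 : coevMap Q e c = c • coevMap Q e 1 := by
    rw [← map_smul, smul_eq_mul, mul_one]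
  rw [zigzag_aux, h1, map_smul, toEnd_coev, TensorProduct.lid_tmul]
  have h := congrArg e Q.reassociator_antipode
  rw [map_one] at h
  have h2 : ∀ t : H ⊗[k] (H ⊗[k] H), LinearMap.mul' k (Module.End k V)
      (TensorProduct.map e.toLinearMap (LinearMap.mulLeft k (c • e Q.β) ∘ₗ e.toLinearMap ∘ₗ
          mulMap Q.S (LinearMap.mulLeft k Q.α)) t) =
      c • e (mulMap₃ (LinearMap.mulRight k Q.β) Q.S (LinearMap.mulLeft k Q.α) t) := by
    intro t
    induction t using TensorProduct.induction_on with
    | zero => simp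
    | add a b ha hb => simp only [map_add, smul_add, ha, hb]
    | tmul a b => simp [mulMap₃, mul_assoc]
  rw [h2, h]
  rfl

lemma zigzag_aux' (t : H ⊗[k] (H ⊗[k] H)) (z : V ⊗[k] Module.Dual k V) (φ : Module.Dual k V)
    (v : V) :
    TensorProduct.lid k (Module.Dual k V) (TensorProduct.map (evMap Q e) LinearMap.id
      ((TensorProduct.assoc k _ _ _).symm
        (act (dualRep Q e) (act e (dualRep Q e)) t (φ ⊗ₜ z)))) v =
    φ (LinearMap.mul' k (Module.End k V) (TensorProduct.map (e.toLinearMap ∘ₗ Q.S)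
        (LinearMap.mul' k (Module.End k V) ∘ₗ TensorProduct.map
          (e.toLinearMap ∘ₗ LinearMap.mulLeft k Q.α)
          (LinearMap.mulLeft k (toEnd k V z) ∘ₗ e.toLinearMap ∘ₗ Q.S)) t) v) := by
  induction t using TensorProduct.induction_on with
  | zero => simp
  | add a b ha hb => simp only [map_add, LinearMap.add_apply, ha, hb]
  | tmul a p =>
    induction p using TensorProduct.induction_on with
    | zero => simp
    | add a b ha hb =>
      simp only [TensorProduct.tmul_add, map_add, LinearMap.add_apply, ha, hb]
    | tmul b c =>
      induction z using TensorProduct.induction_on with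
      | zero => simp
      | add a b ha hb =>
        simp only [map_add, TensorProduct.tmul_add, LinearMap.add_apply, ha, hb]
        simp [mul_add, add_mul]
      | tmul w ψ =>
        simp [toEnd_tmul, dualRep_apply, evMap, mul_comm]

lemma zigzag_raw' (c : k) (φ : Module.Dual k V) :
    TensorProduct.map (evMap Q e) LinearMap.id
      (assocInvMap Q (dualRep Q e) e (dualRep Q e)
        (TensorProduct.map LinearMap.id (coevMap Q e) (φ ⊗ₜ c))) =
    (TensorProduct.lid k _).symm (TensorProduct.rid k _ (φ ⊗ₜ c)) := by
  rw [LinearEquiv.eq_symm_apply]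
  refine LinearMap.ext fun v => ?_
  simp only [assocInvMap, LinearMap.comp_apply, LinearEquiv.coe_coe, TensorProduct.map_tmul,
    LinearMap.id_apply]
  have h1 : coevMap Q e c = c • coevMap Q e 1 := by
    rw [← map_smul, smul_eq_mul, mul_one]
  rw [zigzag_aux', h1, map_smul, toEnd_coev, TensorProduct.rid_tmul]
  have h := congrArg e Q.reassociator_inv_antipode
  rw [map_one] at h
  have h2 : ∀ t : H ⊗[k] (H ⊗[k] H), LinearMap.mul' k (Module.End k V)
      (TensorProduct.map (e.toLinearMap ∘ₗ Q.S)
        (LinearMap.mul' k (Module.End k V) ∘ₗ TensorProduct.map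
          (e.toLinearMap ∘ₗ LinearMap.mulLeft k Q.α)
          (LinearMap.mulLeft k (c • e Q.β) ∘ₗ e.toLinearMap ∘ₗ Q.S)) t) =
      c • e (mulMap₃ Q.S (LinearMap.mulLeft k Q.α ∘ₗ LinearMap.mulRight k Q.β) Q.S t) := by
    intro t
    induction t using TensorProduct.induction_on with
    | zero => simp
    | add a b ha hb => simp only [map_add, smul_add, ha, hb]
    | tmul a p =>
      induction p using TensorProduct.induction_on with
      | zero => simp
      | add a b ha hb => simp only [map_add, TensorProduct.tmul_add, smul_add, ha, hb]
      | tmul b d => simp [mulMap₃, mulMap, mul_assoc]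
  rw [h2, h]
  simp

end RawDual

namespace FDMod

variable {k : Type u} {H : Type w} [Field k] [Ring H] [Algebra k H] {Q : QTQuasiHopfAlgebra k H}

/-- The dual module, `(h φ)(v) = φ(S(h) v)`. -/
def dual (X : FDMod Q) : FDMod Q where
  V := Module.Dual k X.V
  ρ := dualRep Q X.ρ

/-- `V` and `V^*` form an exact pairing, with evaluation `φ ⊗ v ↦ φ(α v)` and coevaluation
`1 ↦ ∑ᵢ β eᵢ ⊗ eⁱ`. -/
instance exactPairing (X : FDMod Q) : ExactPairing X (dual X) where
  coevaluation' := (⟨coevMap Q X.ρ, coevMap_linear Q X.ρ⟩ : Hom (unit Q) (tensor X (dual X)))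
  evaluation' := (⟨evMap Q X.ρ, evMap_linear Q X.ρ⟩ : Hom (tensor (dual X) X) (unit Q))
  coevaluation_evaluation' := hom_ext <| TensorProduct.ext' fun φ (c : k) =>
    zigzag_raw' Q X.ρ c φ
  evaluation_coevaluation' := hom_ext <| TensorProduct.ext' fun (c : k) v =>
    zigzag_raw Q X.ρ c v

instance : RightRigidCategory (FDMod Q) where
  rightDual X := ⟨dual X⟩

/-- The transpose of a linear map, as a morphism of modules. -/
def transpose {X Y : FDMod Q} (f : X ⟶ Y) : dual Y ⟶ dual X where
  lin := Module.Dual.transpose f.lin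
  comm h (φ : Module.Dual k Y.V) := LinearMap.ext fun v =>
    congrArg (φ : Y.V → k) (f.comm (Q.S h) v).symm

end FDMod

/-- Uniqueness of the mate of a morphism. -/
lemma rightAdjointMate_eq_of {C : Type*} [Category C] [MonoidalCategory C] {X Y : C}
    [HasRightDual X] [HasRightDual Y] (f : X ⟶ Y) (g : Yᘁ ⟶ Xᘁ)
    (h : g ▷ X ≫ ε_ X Xᘁ = Yᘁ ◁ f ≫ ε_ Y Yᘁ) : fᘁ = g := by
  have h2 : fᘁ = (ρ_ Yᘁ).inv ≫ Yᘁ ◁ η_ X Xᘁ ≫ (α_ _ _ _).inv ≫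
      (Yᘁ ◁ f ≫ ε_ Y Yᘁ) ▷ Xᘁ ≫ (λ_ _).hom := by
    simp [rightAdjointMate]
  rw [h2, ← h, comp_whiskerRight, Category.assoc]
  have h3 : (α_ Yᘁ X Xᘁ).inv ≫ g ▷ X ▷ Xᘁ = g ▷ (X ⊗ Xᘁ) ≫ (α_ _ _ _).inv := by simp
  rw [reassoc_of% h3, whisker_exchange_assoc]
  simp

namespace FDMod

variable {k : Type u} {H : Type w} [Field k] [Ring H] [Algebra k H] {Q : QTQuasiHopfAlgebra k H}

lemma rightAdjointMate_eq {X Y : FDMod Q} (f : X ⟶ Y) : fᘁ = transpose f := by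
  refine rightAdjointMate_eq_of f (transpose f) (hom_ext <| 
    TensorProduct.ext' fun (φ : Module.Dual k Y.V) v => ?_)
  exact congrArg (φ : Y.V → k) (f.comm Q.α v)

end FDMod

/-! ### Ribbon categories -/

/-- A ribbon structure on a braided category in which every object `V` has a dual `V^*`
(with `ev : V^* ⊗ V ⟶ 𝟙` and `coev : 𝟙 ⟶ V ⊗ V^*`): a natural automorphism `η` of the identity
functor with `η_{V ⊗ W} = (η_V ⊗ η_W) c_{W,V} c_{V,W}` and `η_{V^*} = (η_V)^*`. -/
class RibbonCategory (C : Type*) [Category C] [MonoidalCategory C] [BraidedCategory C]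
    [RightRigidCategory C] where
  twist : 𝟭 C ≅ 𝟭 C
  twist_tensor : ∀ X Y : C, twist.hom.app (X ⊗ Y) =
    (β_ X Y).hom ≫ (β_ Y X).hom ≫ (twist.hom.app X ⊗ₘ twist.hom.app Y)
  twist_dual : ∀ X : C, twist.hom.app Xᘁ = (show X ⟶ X from twist.hom.app X)ᘁ

/-- The twist `η_X : X ⟶ X` of a ribbon category. -/
def ribbonTwist {C : Type*} [Category C] [MonoidalCategory C] [BraidedCategory C]
    [RightRigidCategory C] [RibbonCategory C] (X : C) : X ⟶ X :=
  (RibbonCategory.twist (C := C)).hom.app X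

namespace FDMod

variable {k : Type u} {H : Type w} [Field k] [Ring H] [Algebra k H] {Q : QTQuasiHopfAlgebra k H}

/-- The action of a central invertible element as an automorphism. -/
def centralIso {η : Hˣ} (hη : Q.IsRibbonElement η) (X : FDMod Q) : X ≅ X :=
  mkIso (X := X) (Y := X)
    ⟨X.ρ η, fun h v => by rw [act_mul_apply, act_mul_apply, hη.central]⟩
    (X.ρ ((η⁻¹ : Hˣ) : H))
    (LinearMap.ext fun v => by
      rw [LinearMap.comp_apply, act_mul_apply, Units.inv_mul, map_one]; rfl)
    (LinearMap.ext fun v => by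
      rw [LinearMap.comp_apply, act_mul_apply, Units.mul_inv, map_one]; rfl)

/-- The ribbon structure `η_V(v) = η v` defined by a ribbon element `η`. -/
abbrev ribbonCategory {η : Hˣ} (hη : Q.IsRibbonElement η) : RibbonCategory (FDMod Q) where
  twist := NatIso.ofComponents (fun X => centralIso hη X)
    (fun f => hom_ext <| LinearMap.ext fun v => (f.comm η v).symm)
  twist_tensor X Y := hom_ext <| LinearMap.ext fun (z : X.V ⊗[k] Y.V) => by
    change act X.ρ Y.ρ (Q.Δ η) z = TensorProduct.map (X.ρ η) (Y.ρ η)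
      (braidMap Q Y.ρ X.ρ (braidMap Q X.ρ Y.ρ z))
    rw [hη.comul, ← act_mul_apply, act_tmul_eq]
    congr 1
    simp only [braidMap, LinearMap.comp_apply, LinearEquiv.coe_coe, QTQuasiHopfAlgebra.monodromy,
      Units.val_mul]
    rw [act_comm, TensorProduct.comm_comm, act_mul_apply]
    rfl
  twist_dual X := by
    refine Eq.trans ?_ (rightAdjointMate_eq _).symm
    refine hom_ext <| LinearMap.ext fun (φ : Module.Dual k X.V) =>
      LinearMap.ext fun v => ?_
    change φ (X.ρ (Q.S η) v) = φ (X.ρ η v)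
    rw [hη.antipode]

end FDMod
end QHopf

namespace QHopf

section General

variable {C : Type*} [Category C] [MonoidalCategory C] [BraidedCategory C]

/-- `c_{Y,X} c_{X,Y} : X ⊗ Y ⟶ X ⊗ Y`. -/
def doubleBraiding (X Y : C) : X ⊗ Y ≅ X ⊗ Y := β_ X Y ≪≫ β_ Y X

/-- `(η ⊗ ξ) c_{Y,X} c_{X,Y}`. -/
def tensorTwist {X Y : C} (η : X ≅ X) (ξ : Y ≅ Y) : X ⊗ Y ≅ X ⊗ Y :=
  doubleBraiding X Y ≪≫ (η ⊗ᵢ ξ)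

lemma doubleBraiding_assoc (V W T : C) :
    (doubleBraiding (V ⊗ W) T).hom ≫ (doubleBraiding V W).hom ▷ T ≫ (α_ V W T).hom =
      (α_ V W T).hom ≫ (doubleBraiding V (W ⊗ T)).hom ≫ V ◁ (doubleBraiding W T).hom := by
  have h1 : (β_ T (V ⊗ W)).hom ≫ (doubleBraiding V W).hom ▷ T =
      T ◁ (doubleBraiding V W).hom ≫ (β_ T (V ⊗ W)).hom :=
    (BraidedCategory.braiding_naturality_right _ _).symm
  have h2 : (β_ (W ⊗ T) V).hom ≫ V ◁ (β_ W T).hom = (β_ W T).hom ▷ V ≫ (β_ (T ⊗ W) V).hom :=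
    (BraidedCategory.braiding_naturality_left _ _).symm
  have h3 : (β_ V (W ⊗ T)).hom ≫ (β_ W T).hom ▷ V = V ◁ (β_ W T).hom ≫ (β_ V (T ⊗ W)).hom :=
    (BraidedCategory.braiding_naturality_right _ _).symm
  have hl : (doubleBraiding (V ⊗ W) T).hom ≫ (doubleBraiding V W).hom ▷ T ≫ (α_ V W T).hom =
      (β_ (V ⊗ W) T).hom ≫ T ◁ (doubleBraiding V W).hom ≫ (β_ T (V ⊗ W)).hom ≫
        (α_ V W T).hom := by
    rw [← reassoc_of% h1]; simp [doubleBraiding]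
  have hr : (doubleBraiding V (W ⊗ T)).hom ≫ V ◁ (doubleBraiding W T).hom =
      V ◁ (β_ W T).hom ≫ (β_ V (T ⊗ W)).hom ≫ (β_ (T ⊗ W) V).hom ≫ V ◁ (β_ T W).hom := by
    rw [← reassoc_of% h3, ← reassoc_of% h2]; simp [doubleBraiding]
  rw [hl, hr]
  simp [doubleBraiding, BraidedCategory.braiding_tensor_left_hom,
    BraidedCategory.braiding_tensor_right_hom]

lemma tensorTwist_assoc {V W T : C} (η : V ≅ V) (ξ : W ≅ W) (ζ : T ≅ T) :
    (tensorTwist (tensorTwist η ξ) ζ).hom ≫ (α_ V W T).hom =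
      (α_ V W T).hom ≫ (tensorTwist η (tensorTwist ξ ζ)).hom := by
  have h1 : ((tensorTwist η ξ).hom ⊗ₘ ζ.hom) =
      (doubleBraiding V W).hom ▷ T ≫ ((η.hom ⊗ₘ ξ.hom) ⊗ₘ ζ.hom) := by
    rw [← tensorHom_id, tensorHom_comp_tensorHom, Category.id_comp]; rfl
  have h2 : (η.hom ⊗ₘ (tensorTwist ξ ζ).hom) =
      V ◁ (doubleBraiding W T).hom ≫ (η.hom ⊗ₘ (ξ.hom ⊗ₘ ζ.hom)) := by
    rw [← id_tensorHom, tensorHom_comp_tensorHom, Category.id_comp]; rfl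
  have h3 := doubleBraiding_assoc V W T
  have h4 : ∀ {X Y : C} (a : X ≅ X) (b : Y ≅ Y), (tensorTwist a b).hom =
    (doubleBraiding X Y).hom ≫ (a.hom ⊗ₘ b.hom) := fun _ _ => rfl
  rw [h4 (tensorTwist η ξ) ζ, h4 η (tensorTwist ξ ζ), h1, h2]
  simp only [Category.assoc, associator_naturality]
  rw [reassoc_of% h3]

lemma tensorTwist_natural {X X' Y Y' : C} {η : X ≅ X} {η' : X' ≅ X'} {ξ : Y ≅ Y} {ξ' : Y' ≅ Y'}
    {f : X ⟶ X'} {g : Y ⟶ Y'} (hf : η.hom ≫ f = f ≫ η'.hom) (hg : ξ.hom ≫ g = g ≫ ξ'.hom) :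
    (tensorTwist η ξ).hom ≫ (f ⊗ₘ g) = (f ⊗ₘ g) ≫ (tensorTwist η' ξ').hom := by
  simp [tensorTwist, doubleBraiding, hf, hg, BraidedCategory.braiding_naturality_assoc]

lemma tensorTwist_left_unit {X : C} (ξ : X ≅ X) :
    (tensorTwist (Iso.refl (𝟙_ C)) ξ).hom ≫ (λ_ X).hom = (λ_ X).hom ≫ ξ.hom := by
  simp [tensorTwist, doubleBraiding, braiding_tensorUnit_left, braiding_tensorUnit_right]

lemma tensorTwist_right_unit {X : C} (ξ : X ≅ X) :
    (tensorTwist ξ (Iso.refl (𝟙_ C))).hom ≫ (ρ_ X).hom = (ρ_ X).hom ≫ ξ.hom := by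
  simp [tensorTwist, doubleBraiding, braiding_tensorUnit_left, braiding_tensorUnit_right]

lemma tensorTwist_braiding {X Y : C} (η : X ≅ X) (ξ : Y ≅ Y) :
    (tensorTwist η ξ).hom ≫ (β_ X Y).hom = (β_ X Y).hom ≫ (tensorTwist ξ η).hom := by
  simp [tensorTwist, doubleBraiding]

end General

/-! ### The category `R(C, c)` -/

section R

variable (C : Type*) [Category C] [MonoidalCategory C] [BraidedCategory C]
  [RightRigidCategory C]

variable {C} in
/-- The endomorphism
`V = 𝟙 ⊗ V → (V ⊗ V^*) ⊗ V → (V ⊗ V^*) ⊗ V = V ⊗ (V^* ⊗ V) → V ⊗ 𝟙 = V`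
given by `coev_V`, the double braiding `c_{V^*,V} c_{V,V^*}` and `ev_V`. -/
def twistLoop (V : C) : V ⟶ V :=
  (λ_ V).inv ≫ η_ V Vᘁ ▷ V ≫ (doubleBraiding V Vᘁ).hom ▷ V ≫ (α_ V Vᘁ V).hom ≫
    V ◁ ε_ V Vᘁ ≫ (ρ_ V).hom

/-- Objects of `R(C, c)`: pairs `(V, η_V)` with `η_V` an automorphism of `V` such that
`η_V⁻² = (id_V ⊗ ev_V)(c_{V^*,V} c_{V,V^*} coev_V ⊗ id_V)`. -/
structure RCat where
  obj : C
  η : obj ≅ obj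
  η_sq : η.inv ≫ η.inv = twistLoop obj

namespace RCat

variable {C}

/-- Morphisms of `R(C, c)`. -/
@[ext] structure Hom (X Y : RCat C) where
  f : X.obj ⟶ Y.obj
  comm : X.η.hom ≫ f = f ≫ Y.η.hom

instance : Category (RCat C) where
  Hom := Hom
  id X := ⟨𝟙 X.obj, by simp⟩
  comp f g := ⟨f.f ≫ g.f, by rw [reassoc_of% f.comm, g.comm, Category.assoc]⟩

@[ext] lemma hom_ext {X Y : RCat C} {f g : X ⟶ Y} (h : f.f = g.f) : f = g := Hom.ext h

@[simp] lemma id_f (X : RCat C) : Hom.f (𝟙 X) = 𝟙 X.obj := rfl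
@[simp] lemma comp_f {X Y Z : RCat C} (f : X ⟶ Y) (g : Y ⟶ Z) : (f ≫ g).f = f.f ≫ g.f := rfl

/-- An isomorphism of `C` that commutes with the twists, as an isomorphism of `R(C, c)`. -/
def mkIso {X Y : RCat C} (i : X.obj ≅ Y.obj) (h : X.η.hom ≫ i.hom = i.hom ≫ Y.η.hom) :
    X ≅ Y where
  hom := ⟨i.hom, h⟩
  inv := ⟨i.inv, by rw [Iso.eq_inv_comp, ← reassoc_of% h]; simp⟩
  hom_inv_id := hom_ext i.hom_inv_id
  inv_hom_id := hom_ext i.inv_hom_id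

/-- The transpose of an automorphism. -/
def dualIso {V : C} (η : V ≅ V) : Vᘁ ≅ Vᘁ where
  hom := η.homᘁ
  inv := η.invᘁ
  hom_inv_id := by rw [← comp_rightAdjointMate, η.inv_hom_id, rightAdjointMate_id]
  inv_hom_id := by rw [← comp_rightAdjointMate, η.hom_inv_id, rightAdjointMate_id]

variable (C) in
/-- The statement that `R(C, c)` is closed under the ribbon structure of `C`: tensor products
`(V ⊗ W, (η_V ⊗ η_W) c_{W,V} c_{V,W})`, the unit `(𝟙, id)` and duals `(V^*, (η_V)^*)` of objects
of `R(C, c)` lie in `R(C, c)`, and `ev_V`, `coev_V` are morphisms of `R(C, c)`. -/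
class IsRibbonClosed : Prop where
  tensor : ∀ X Y : RCat C, (tensorTwist X.η Y.η).inv ≫ (tensorTwist X.η Y.η).inv =
    twistLoop (X.obj ⊗ Y.obj)
  unit : 𝟙 (𝟙_ C) = twistLoop (𝟙_ C)
  dual : ∀ X : RCat C, (dualIso X.η).inv ≫ (dualIso X.η).inv = twistLoop X.objᘁ
  ev : ∀ X : RCat C, (tensorTwist (dualIso X.η) X.η).hom ≫ ε_ X.obj X.objᘁ = ε_ X.obj X.objᘁ
  coev : ∀ X : RCat C, η_ X.obj X.objᘁ = η_ X.obj X.objᘁ ≫ (tensorTwist X.η (dualIso X.η)).hom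

variable [IsRibbonClosed C]

instance : MonoidalCategoryStruct (RCat C) where
  tensorObj X Y := ⟨X.obj ⊗ Y.obj, tensorTwist X.η Y.η, IsRibbonClosed.tensor X Y⟩
  tensorHom f g := ⟨f.f ⊗ₘ g.f, tensorTwist_natural f.comm g.comm⟩
  whiskerLeft X _ _ f := ⟨X.obj ◁ f.f, by
    rw [← id_tensorHom]; exact tensorTwist_natural (by simp) f.comm⟩
  whiskerRight f Y := ⟨f.f ▷ Y.obj, by
    rw [← tensorHom_id]; exact tensorTwist_natural f.comm (by simp)⟩
  tensorUnit := ⟨𝟙_ C, Iso.refl _, by simpa using IsRibbonClosed.unit⟩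
  associator X Y Z := mkIso (α_ X.obj Y.obj Z.obj) (tensorTwist_assoc X.η Y.η Z.η)
  leftUnitor X := mkIso (λ_ X.obj) (tensorTwist_left_unit X.η)
  rightUnitor X := mkIso (ρ_ X.obj) (tensorTwist_right_unit X.η)

instance : MonoidalCategory (RCat C) :=
  MonoidalCategory.ofTensorHom
    (id_tensorHom_id := fun X Y => hom_ext (id_tensorHom_id X.obj Y.obj))
    (id_tensorHom := fun X _ _ f => hom_ext (id_tensorHom X.obj f.f))
    (tensorHom_id := fun f Y => hom_ext (tensorHom_id f.f Y.obj))
    (tensorHom_comp_tensorHom := fun f g h i =>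
      hom_ext (tensorHom_comp_tensorHom f.f g.f h.f i.f))
    (associator_naturality := fun f g h => hom_ext (associator_naturality f.f g.f h.f))
    (leftUnitor_naturality := fun f => hom_ext <| by
      have := leftUnitor_naturality f.f
      rw [← id_tensorHom] at this
      exact this)
    (rightUnitor_naturality := fun f => hom_ext <| by
      have := rightUnitor_naturality f.f
      rw [← tensorHom_id] at this
      exact this)
    (pentagon := fun W X Y Z => hom_ext <| by
      have := pentagon W.obj X.obj Y.obj Z.obj
      rw [← id_tensorHom, ← tensorHom_id] at this
      exact this)
    (triangle := fun X Y => hom_ext <| by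
      have := triangle X.obj Y.obj
      rw [← id_tensorHom, ← tensorHom_id] at this
      exact this)

instance : BraidedCategory (RCat C) where
  braiding X Y := mkIso (β_ X.obj Y.obj) (tensorTwist_braiding X.η Y.η)
  braiding_naturality_right X _ _ f :=
    hom_ext (BraidedCategory.braiding_naturality_right X.obj f.f)
  braiding_naturality_left f Z := hom_ext (BraidedCategory.braiding_naturality_left f.f Z.obj)
  hexagon_forward X Y Z := hom_ext (BraidedCategory.hexagon_forward X.obj Y.obj Z.obj)
  hexagon_reverse X Y Z := hom_ext (BraidedCategory.hexagon_reverse X.obj Y.obj Z.obj)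

/-- The dual object `(V^*, (η_V)^*)`. -/
def dual (X : RCat C) : RCat C := ⟨X.objᘁ, dualIso X.η, IsRibbonClosed.dual X⟩

instance exactPairing (X : RCat C) : ExactPairing X (dual X) where
  coevaluation' := (⟨η_ X.obj X.objᘁ, (Category.id_comp _).trans (IsRibbonClosed.coev X)⟩ :
    Hom (𝟙_ (RCat C)) (X ⊗ dual X))
  evaluation' := (⟨ε_ X.obj X.objᘁ, (IsRibbonClosed.ev X).trans (Category.comp_id _).symm⟩ :
    Hom (dual X ⊗ X) (𝟙_ (RCat C)))
  coevaluation_evaluation' := hom_ext (ExactPairing.coevaluation_evaluation X.obj X.objᘁ)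
  evaluation_coevaluation' := hom_ext (ExactPairing.evaluation_coevaluation X.obj X.objᘁ)

instance : RightRigidCategory (RCat C) where
  rightDual X := ⟨dual X⟩

/-- `R(C, c)` is a ribbon category, with twist `η_V : (V, η_V) ⟶ (V, η_V)`. -/
instance : RibbonCategory (RCat C) where
  twist := NatIso.ofComponents (fun X => mkIso X.η rfl) (fun f => hom_ext f.comm.symm)
  twist_tensor X Y := hom_ext (by
    change (tensorTwist X.η Y.η).hom = (β_ X.obj Y.obj).hom ≫ (β_ Y.obj X.obj).hom ≫
      (X.η.hom ⊗ₘ Y.η.hom)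
    simp [tensorTwist, doubleBraiding])
  twist_dual _ := hom_ext rfl

end RCat

end R

/-! ### Isomorphisms of ribbon categories -/

/-- `F` is an isomorphism of ribbon categories: it is an isomorphism of categories and a strict
monoidal braided functor (its structure morphisms are identities), and it maps twists to twists
and chosen duals, with their evaluation and coevaluation, to chosen duals. -/
def IsRibbonIsomorphism {C D : Type*} [Category C] [MonoidalCategory C] [BraidedCategory C]
    [RightRigidCategory C] [RibbonCategory C] [Category D] [MonoidalCategory D]
    [BraidedCategory D] [RightRigidCategory D] [RibbonCategory D] (F : C ⥤ D) : Prop :=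
  (∃ G : D ⥤ C, F ⋙ G = 𝟭 C ∧ G ⋙ F = 𝟭 D) ∧
  ∃ _ : F.Braided,
    (∃ e : 𝟙_ D = F.obj (𝟙_ C), Functor.LaxMonoidal.ε F = eqToHom e) ∧
    (∀ X Y : C, ∃ e : F.obj X ⊗ F.obj Y = F.obj (X ⊗ Y),
      Functor.LaxMonoidal.μ F X Y = eqToHom e) ∧
    (∀ X : C, F.map (ribbonTwist X) = ribbonTwist (F.obj X)) ∧
    ∀ X : C, ∃ e : F.obj Xᘁ = (F.obj X)ᘁ,
      Functor.LaxMonoidal.μ F Xᘁ X ≫ F.map (ε_ X Xᘁ) =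
        eqToHom e ▷ F.obj X ≫ ε_ (F.obj X) (F.obj X)ᘁ ≫ Functor.LaxMonoidal.ε F ∧
      Functor.LaxMonoidal.ε F ≫ F.map (η_ X Xᘁ) =
        η_ (F.obj X) (F.obj X)ᘁ ≫ F.obj X ◁ eqToHom e.symm ≫ Functor.LaxMonoidal.μ F X Xᘁ

/-! ### The functor `R(_H M^fd, c) ⥤ _{H(θ)} M^fd` -/

section ThetaFunctor

variable {k : Type u} {H : Type w} [Field k] [Ring H] [Algebra k H] (Q : QTQuasiHopfAlgebra k H)

/-- The statement that `η_V⁻²` is the action of `u S(u)`, for all `(V, η_V)` in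
`R(_H M^fd, c)`. -/
def TwistSquare : Prop := ∀ X : RCat (FDMod.{u, w} Q),
  X.η.inv.lin ∘ₗ X.η.inv.lin = X.obj.ρ (Q.u * Q.S Q.u)

variable {Q}

/-- `V`, with the `H(θ)`-module structure that extends its `H`-module structure and has
`θ v = η_V⁻¹(v)`. -/
def thetaModule (hQ : TwistSquare Q) (Qθ : QTQuasiHopfAlgebra k (HTheta Q))
    (X : RCat (FDMod.{u, w} Q)) : FDMod.{u, w} Qθ where
  V := X.obj.V
  ρ := HTheta.lift X.obj.ρ X.η.inv.lin
    (fun h => LinearMap.ext fun v => (X.η.inv.comm h v).symm) (hQ X)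

/-- The functor `(V, η_V) ↦ V` with `θ` acting by `η_V⁻¹`, and `f ↦ f` on morphisms. -/
def thetaFunctor (hQ : TwistSquare Q) (Qθ : QTQuasiHopfAlgebra k (HTheta Q)) :
    RCat (FDMod.{u, w} Q) ⥤ FDMod.{u, w} Qθ where
  obj X := thetaModule hQ Qθ X
  map {X Y} f := (⟨f.f.lin, HTheta.lift_intertwine X.obj.ρ X.η.inv.lin _ (hQ X) Y.obj.ρ
    Y.η.inv.lin _ (hQ Y) f.f.lin f.f.comm (fun v => by
      have h : f.f ≫ Y.η.inv = X.η.inv ≫ f.f := by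
        rw [Iso.eq_inv_comp, ← Category.assoc, f.comm, Category.assoc, Iso.hom_inv_id,
          Category.comp_id]
      exact (LinearMap.congr_fun (congrArg FDMod.Hom.lin h) v).symm)⟩ :
    FDMod.Hom (thetaModule hQ Qθ X) (thetaModule hQ Qθ Y))
  map_id _ := rfl
  map_comp _ _ := rfl

end ThetaFunctor

end QHopf

end

open CategoryTheory MonoidalCategory
open scoped TensorProduct Polynomial
set_option maxSynthPendingDepth 3
namespace QHopf

noncomputable section

/-! ### Induction on tensor powers -/

section Induction

variable {k : Type*} [CommSemiring k] {A B C D : Type*} [AddCommMonoid A] [Module k A]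
  [AddCommMonoid B] [Module k B] [AddCommMonoid C] [Module k C] [AddCommMonoid D] [Module k D]

/-! Everything is governed by a = u S(u) and by the monodromy m = R₂₁R. The loop in the definition
of R(C, c) acts on a module as a: the double braiding replaces β in the coevaluation by m¹βS(m²) =
aβ (`cup_monodromy`), and the zigzag identity leaves a. So η_V⁻² is the action of a, and an object
of R(C, c) is an H-module with an H-linear square root of a, that is, a module over H(θ). The
remaining claims rest on these identities: a is central and invertible, ε(a) = 1, S(a) = a, S(m¹)αm²
= aα, m¹βS(m²) = aβ and Δ(a) = (a ⊗ a)m⁻². They make Δ, ε and S respect the relation θ² = a, and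
they make R(C, c) closed under unit, duals and tensor products.

The element u comes from uniqueness of antipodes. `AntipodeAlong` relativizes the antipode axioms to
an algebra map ρ : H → A, and `comparison` is Drinfeld's element relating two solutions over the
same ρ. Over S : H → Hᵐᵒᵖ there are two solutions: the image of (S, α, β) under S, whose antipode is
S², and one built from R whose antipode is the identity. Their comparison element is u. This gives
`S_S_mul_u`, `S_α_mul_u`, `u_mul_βR` and `isUnit_u` without bijectivity of S. The same facts for the
reversed R-matrix R₂₁⁻¹ show that S(u) is inverse to the reversed u (`S_u_mul_u_reverse`);
centrality of a and the two formulas with α and β follow.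

The hard identity is `comul_uSu`. Evaluation on V ⊗ W can be nested out of the evaluations on V and
on W, and the nested one is represented by γ = `nestedα`. It satisfies the left antipode axiom along
Δ for h ↦ S(h₂) ⊗ S(h₁), so comparison makes γ a left multiple of Δ(α), and inserting m yields γΔ(a)
(`nestedCap_nestAssoc_mul`). Splitting the inserted monodromy with `monodromy_assoc`, and moving m⁻¹
through S ⊗ S with `map_S_R_mul_nestedα`, yields γ(a ⊗ a)m⁻² instead. Finally γ is cancelled by
`eq_one_of_nestedα_mul`, so no inverse of γ is needed.

The structure of H(θ) is then checked on the generators H and θ. The functor is strict because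
corresponding constructions have the same vector spaces and linear maps; only the actions of H(θ)
have to be compared (`ext_tensor`, `ext_unit`, `ext_dual`). -/

theorem tmul_induction {p : A ⊗[k] B → Prop} (t : A ⊗[k] B) (tmul : ∀ a b, p (a ⊗ₜ b))
    (add : ∀ x y, p x → p y → p (x + y)) : p t := by
  induction t using TensorProduct.induction_on with
  | zero => simpa using tmul 0 0
  | tmul a b => exact tmul a b
  | add x y hx hy => exact add x y hx hy

theorem tmul₃_induction {p : A ⊗[k] (B ⊗[k] C) → Prop} (t : A ⊗[k] (B ⊗[k] C))
    (tmul : ∀ a b c, p (a ⊗ₜ (b ⊗ₜ c))) (add : ∀ x y, p x → p y → p (x + y)) : p t := by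
  induction t using tmul_induction with
  | tmul a s =>
    induction s using tmul_induction with
    | tmul b c => exact tmul a b c
    | add x y hx hy => rw [TensorProduct.tmul_add]; exact add _ _ hx hy
  | add x y hx hy => exact add x y hx hy

theorem tmul₄_induction {p : A ⊗[k] (B ⊗[k] (C ⊗[k] D)) → Prop} (t : A ⊗[k] (B ⊗[k] (C ⊗[k] D)))
    (tmul : ∀ a b c d, p (a ⊗ₜ (b ⊗ₜ (c ⊗ₜ d)))) (add : ∀ x y, p x → p y → p (x + y)) : p t := by
  induction t using tmul_induction with
  | tmul a s =>
    induction s using tmul₃_induction with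
    | tmul b c d => exact tmul a b c d
    | add x y hx hy => rw [TensorProduct.tmul_add]; exact add _ _ hx hy
  | add x y hx hy => exact add x y hx hy

end Induction

/-! ### Counits of the reassociator -/

namespace QuasiHopfAlgebra

variable {k : Type u} {H : Type w} [Field k] [Ring H] [Algebra k H] (Q : QuasiHopfAlgebra k H)

/-- `a ⊗ t ↦ ε(a) t`. -/
def counitLeft (A : Type*) [Ring A] [Algebra k A] : H ⊗[k] A →ₐ[k] A :=
  (Algebra.TensorProduct.lid k A).toAlgHom.comp
    (Algebra.TensorProduct.map Q.counit (AlgHom.id k A))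

/-- `t ⊗ a ↦ ε(a) t`. -/
def counitRight (A : Type*) [Ring A] [Algebra k A] : A ⊗[k] H →ₐ[k] A :=
  (Algebra.TensorProduct.rid k k A).toAlgHom.comp
    (Algebra.TensorProduct.map (AlgHom.id k A) Q.counit)

@[simp] lemma counitLeft_tmul {A : Type*} [Ring A] [Algebra k A] (a : H) (t : A) :
    Q.counitLeft A (a ⊗ₜ t) = Q.counit a • t := by
  simp [counitLeft]

@[simp] lemma counitRight_tmul {A : Type*} [Ring A] [Algebra k A] (a : H) (t : A) :
    Q.counitRight A (t ⊗ₜ a) = Q.counit a • t := by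
  simp [counitRight]

@[simp] lemma counitLeft_comul (h : H) : Q.counitLeft H (Q.Δ h) = h := Q.counit_id h

@[simp] lemma counitRight_comul (h : H) : Q.counitRight H (Q.Δ h) = h := Q.id_counit h

/-- `a ⊗ b ⊗ c ↦ a ⊗ ε(b) c`. -/
def counitMiddle : H ⊗[k] (H ⊗[k] H) →ₐ[k] H ⊗[k] H :=
  Algebra.TensorProduct.map (AlgHom.id k H) (Q.counitLeft H)

/-- `a ⊗ b ⊗ c ↦ a ⊗ ε(c) b`. -/
def counitLast : H ⊗[k] (H ⊗[k] H) →ₐ[k] H ⊗[k] H :=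
  Algebra.TensorProduct.map (AlgHom.id k H) (Q.counitRight H)

@[simp] lemma counitMiddle_tmul (a : H) (t : H ⊗[k] H) :
    Q.counitMiddle (a ⊗ₜ t) = a ⊗ₜ Q.counitLeft H t := rfl

@[simp] lemma counitLast_tmul (a : H) (t : H ⊗[k] H) :
    Q.counitLast (a ⊗ₜ t) = a ⊗ₜ Q.counitRight H t := rfl

lemma counitMiddle_reassociator : Q.counitMiddle (Q.Φ : H ⊗[k] (H ⊗[k] H)) = 1 :=
  Q.counit_reassociator

/-- The last two legs may be counited in either order; the middle one first gives access to the
axiom on Φ, the last one first to the counit law of `Δ`. -/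
lemma counitRight_counitMiddle (t : H ⊗[k] (H ⊗[k] H)) :
    Q.counitRight H (Q.counitMiddle t) = Q.counitRight H (Q.counitLast t) := by
  induction t using tmul₃_induction with
  | tmul a b c => simp [smul_smul, mul_comm]
  | add x y hx hy => simp only [map_add, hx, hy]

lemma comulLeft_tmul (Δ : H →ₐ[k] H ⊗[k] H) (a b : H) :
    comulLeft Δ (a ⊗ₜ b) = TensorProduct.assoc k H H H (Δ a ⊗ₜ b) := rfl

lemma comulRight_tmul (Δ : H →ₐ[k] H ⊗[k] H) (a b : H) :
    comulRight Δ (a ⊗ₜ b) = a ⊗ₜ Δ b := rfl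

lemma counitLeft_comulLeft (t : H ⊗[k] H) :
    Q.counitLeft (H ⊗[k] H) (comulLeft Q.Δ t) = t := by
  induction t using tmul_induction with
  | tmul a b =>
    have h : ∀ s : H ⊗[k] H, Q.counitLeft (H ⊗[k] H)
        (TensorProduct.assoc k H H H (s ⊗ₜ b)) = Q.counitLeft H s ⊗ₜ b := by
      intro s
      induction s using tmul_induction with
      | tmul a c => simp [TensorProduct.smul_tmul']
      | add x y hx hy => simp only [TensorProduct.add_tmul, map_add, hx, hy]
    exact (h _).trans (congrArg (· ⊗ₜ[k] b) (Q.counitLeft_comul a))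
  | add x y hx hy => simp only [map_add, hx, hy]

lemma counitLast_comulRight (t : H ⊗[k] H) : Q.counitLast (comulRight Q.Δ t) = t := by
  induction t using tmul_induction with
  | tmul a b => exact congrArg (a ⊗ₜ[k] ·) (Q.counitRight_comul b)
  | add x y hx hy => simp only [map_add, hx, hy]

lemma counitLast_comulLeft (t : H ⊗[k] H) :
    Q.counitLast (comulLeft Q.Δ t) = Q.Δ (Q.counitRight H t) := by
  induction t using tmul_induction with
  | tmul a b =>
    have h : ∀ s : H ⊗[k] H, Q.counitLast
        (TensorProduct.assoc k H H H (s ⊗ₜ b)) = Q.counit b • s := by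
      intro s
      induction s using tmul_induction with
      | tmul a c => simp
      | add x y hx hy => simp only [TensorProduct.add_tmul, map_add, hx, hy, smul_add]
    exact (h _).trans (by simp)
  | add x y hx hy => simp only [map_add, hx, hy]

lemma counitLeft_comulRight (t : H ⊗[k] H) :
    Q.counitLeft (H ⊗[k] H) (comulRight Q.Δ t) = Q.Δ (Q.counitLeft H t) := by
  induction t using tmul_induction with
  | tmul a b =>
    change Q.counitLeft (H ⊗[k] H) (a ⊗ₜ Q.Δ b) = _
    simp
  | add x y hx hy => simp only [map_add, hx, hy]

/-- Applying counits to the cocycle condition gives only an idempotent; invertibility of Φ does the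
rest. -/
lemma eq_one_of_mul_self {M : Type*} [Monoid M] (P : Mˣ) (h : (P : M) * P = P) : (P : M) = 1 := by
  have := congrArg (fun x => x * ((P⁻¹ : Mˣ) : M)) h
  simpa [mul_assoc] using this

/-- `(ε ⊗ id ⊗ id)(Φ) = 1`. -/
lemma counitLeft_reassociator : Q.counitLeft (H ⊗[k] H) (Q.Φ : H ⊗[k] (H ⊗[k] H)) = 1 := by
  set P : (H ⊗[k] H)ˣ := Units.map (Q.counitLeft (H ⊗[k] H)).toMonoidHom Q.Φ with hP
  refine eq_one_of_mul_self P ?_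
  -- `ψ` counits the first two legs. The factors `Φ ⊗ 1` and `(id ⊗ id ⊗ Δ)(Φ)` then involve the
  -- middle counit of Φ and become 1; the other three factors of the cocycle condition all become
  -- `P`.
  set ψ : H ⊗[k] (H ⊗[k] (H ⊗[k] H)) →ₐ[k] H ⊗[k] H :=
    (Q.counitLeft (H ⊗[k] H)).comp (Q.counitLeft (H ⊗[k] (H ⊗[k] H)))
  have h := congrArg ψ Q.cocycle
  have h1 : ∀ t, ψ (Algebra.TensorProduct.includeRight t) = Q.counitLeft (H ⊗[k] H) t := by
    intro t; simp [ψ]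
  have h2 : ∀ t, ψ (Algebra.TensorProduct.map (AlgHom.id k H) (comulLeft Q.Δ) t) =
      Q.counitLeft (H ⊗[k] H) t := by
    intro t
    induction t using tmul_induction with
    | tmul a s => simp [ψ, counitLeft_comulLeft]
    | add x y hx hy => simp only [map_add, hx, hy]
  have h3 : ∀ t, ψ (Algebra.TensorProduct.map (AlgHom.id k H) (incl12 k H) t) =
      Q.counitLeft H (Q.counitMiddle t) ⊗ₜ[k] (1 : H) := by
    intro t
    induction t using tmul₃_induction with
    | tmul a b c => simp [ψ, incl12, mul_comm, TensorProduct.smul_tmul']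
    | add x y hx hy => simp only [map_add, hx, hy, TensorProduct.add_tmul]
  have h4 : ∀ t, ψ (Algebra.TensorProduct.map (AlgHom.id k H) (comulRight Q.Δ) t) =
      Q.Δ (Q.counitLeft H (Q.counitMiddle t)) := by
    intro t
    induction t using tmul_induction with
    | tmul a s => simp [ψ, counitLeft_comulRight]
    | add x y hx hy => simp only [map_add, hx, hy]
  have h5 : ∀ t, ψ (Algebra.TensorProduct.assoc k k k H H (H ⊗[k] H)
      (Algebra.TensorProduct.map Q.Δ (AlgHom.id k (H ⊗[k] H)) t)) =
      Q.counitLeft (H ⊗[k] H) t := by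
    intro t
    induction t using tmul_induction with
    | tmul a s =>
      have h : ∀ z : H ⊗[k] H, ψ (TensorProduct.assoc k H H (H ⊗[k] H) (z ⊗ₜ s)) =
          Q.counit (Q.counitLeft H z) • s := by
        intro z
        induction z using tmul_induction with
        | tmul a c => simp [ψ, mul_smul]
        | add x y hx hy => simp only [TensorProduct.add_tmul, map_add, hx, hy, add_smul]
      exact (h _).trans (by simp)
    | add x y hx hy => simp only [map_add, hx, hy]
  rw [map_mul, map_mul, map_mul, h1, h2, h3, h4, h5, counitMiddle_reassociator] at h
  simpa [P, ← Algebra.TensorProduct.one_def] using h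

/-- `(id ⊗ id ⊗ ε)(Φ) = 1`. -/
lemma counitLast_reassociator : Q.counitLast (Q.Φ : H ⊗[k] (H ⊗[k] H)) = 1 := by
  set P : (H ⊗[k] H)ˣ := Units.map Q.counitLast.toMonoidHom Q.Φ with hP
  refine eq_one_of_mul_self P ?_
  -- Here the last two legs are counited, and the factors that become 1 are `1 ⊗ Φ` and `(Δ ⊗ id ⊗
  -- id)(Φ)`.
  set ψ : H ⊗[k] (H ⊗[k] (H ⊗[k] H)) →ₐ[k] H ⊗[k] H :=
    Algebra.TensorProduct.map (AlgHom.id k H) ((Q.counitRight H).comp Q.counitMiddle)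
  have hψ : ∀ a s, ψ (a ⊗ₜ s) = a ⊗ₜ Q.counitRight H (Q.counitMiddle s) := fun _ _ => rfl
  have h := congrArg ψ Q.cocycle
  have h1 : ψ (Algebra.TensorProduct.includeRight (Q.Φ : H ⊗[k] (H ⊗[k] H))) = 1 := by
    simp [hψ, counitMiddle_reassociator, Algebra.TensorProduct.one_def]
  have h2 : ∀ t, ψ (Algebra.TensorProduct.map (AlgHom.id k H) (comulLeft Q.Δ) t) =
      Q.counitLast t := by
    intro t
    induction t using tmul_induction with
    | tmul a s => simp [hψ, counitRight_counitMiddle, counitLast_comulLeft]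
    | add x y hx hy => simp only [map_add, hx, hy]
  have h3 : ∀ t, ψ (Algebra.TensorProduct.map (AlgHom.id k H) (incl12 k H) t) =
      Q.counitLast t := by
    intro t
    induction t using tmul₃_induction with
    | tmul a b c => simp [hψ, incl12]
    | add x y hx hy => simp only [map_add, hx, hy]
  have h4 : ∀ t, ψ (Algebra.TensorProduct.map (AlgHom.id k H) (comulRight Q.Δ) t) =
      Q.counitLast t := by
    intro t
    induction t using tmul_induction with
    | tmul a s => simp [hψ, counitRight_counitMiddle, counitLast_comulRight]
    | add x y hx hy => simp only [map_add, hx, hy]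
  have h5 : ∀ t, ψ (Algebra.TensorProduct.assoc k k k H H (H ⊗[k] H)
      (Algebra.TensorProduct.map Q.Δ (AlgHom.id k (H ⊗[k] H)) t)) =
      Q.Δ (Q.counitRight H (Q.counitMiddle t)) := by
    intro t
    induction t using tmul₃_induction with
    | tmul a b c =>
      have h : ∀ z : H ⊗[k] H, ψ (TensorProduct.assoc k H H (H ⊗[k] H) (z ⊗ₜ (b ⊗ₜ c))) =
          (Q.counit b * Q.counit c) • z := by
        intro z
        induction z using tmul_induction with
        | tmul a c => simp [hψ, mul_smul]
        | add x y hx hy => simp only [TensorProduct.add_tmul, map_add, hx, hy, smul_add]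
      exact (h _).trans (by simp [smul_smul])
    | add x y hx hy => simp only [map_add, hx, hy]
  rw [map_mul, map_mul, map_mul, h1, h2, h3, h4, h5, counitMiddle_reassociator] at h
  simpa [P] using h

end QuasiHopfAlgebra

end

end QHopf

namespace QHopf

noncomputable section

section Permutations

variable {k : Type u} {H : Type w} [Field k] [Ring H] [Algebra k H]

/-! ### Permutations of tensor factors -/

lemma flip2_tmul (a b : H) : flip2 k H (a ⊗ₜ b) = b ⊗ₜ a := rfl

lemma perm312_tmul (a b c : H) : perm312 k H (a ⊗ₜ (b ⊗ₜ c)) = b ⊗ₜ (c ⊗ₜ a) := rfl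

lemma perm132_tmul (a b c : H) : perm132 k H (a ⊗ₜ (b ⊗ₜ c)) = a ⊗ₜ (c ⊗ₜ b) := rfl

lemma perm213_tmul (a b c : H) : perm213 k H (a ⊗ₜ (b ⊗ₜ c)) = b ⊗ₜ (a ⊗ₜ c) := rfl

lemma perm312_symm_tmul (a b c : H) :
    (perm312 k H).symm (a ⊗ₜ (b ⊗ₜ c)) = c ⊗ₜ (a ⊗ₜ b) := rfl

lemma incl12_tmul (a b : H) : incl12 k H (a ⊗ₜ b) = a ⊗ₜ (b ⊗ₜ 1) := rfl

lemma incl13_tmul (a b : H) : incl13 k H (a ⊗ₜ b) = a ⊗ₜ (1 ⊗ₜ b) := rfl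

lemma incl23_tmul (a b : H) : incl23 k H (a ⊗ₜ b) = 1 ⊗ₜ (a ⊗ₜ b) := rfl

@[simp] lemma flip2_flip2 (t : H ⊗[k] H) : flip2 k H (flip2 k H t) = t :=
  (flip2 k H).symm_apply_apply t

/-- `a ⊗ b ⊗ c ↦ c ⊗ b ⊗ a`. -/
def perm321 (k : Type*) (H : Type*) [Field k] [Ring H] [Algebra k H] :
    H ⊗[k] (H ⊗[k] H) ≃ₐ[k] H ⊗[k] (H ⊗[k] H) :=
  (perm312 k H).trans (perm213 k H)

lemma perm321_tmul (a b c : H) : perm321 k H (a ⊗ₜ (b ⊗ₜ c)) = c ⊗ₜ (b ⊗ₜ a) := rfl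

lemma assoc_tmul_eq_incl12 (s : H ⊗[k] H) (b : H) :
    TensorProduct.assoc k H H H (s ⊗ₜ b) = incl12 k H s * (1 ⊗ₜ (1 ⊗ₜ b)) := by
  induction s using tmul_induction with
  | tmul a c => simp [incl12_tmul]
  | add x y hx hy => simp only [TensorProduct.add_tmul, map_add, hx, hy, add_mul]

lemma comulLeft_tmul_eq (Δ : H →ₐ[k] H ⊗[k] H) (a b : H) :
    comulLeft Δ (a ⊗ₜ b) = incl12 k H (Δ a) * (1 ⊗ₜ (1 ⊗ₜ b)) :=
  assoc_tmul_eq_incl12 _ _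

lemma comulLeft_flip2 (Δ : H →ₐ[k] H ⊗[k] H) (t : H ⊗[k] H) :
    comulLeft Δ (flip2 k H t) = perm312 k H (comulRight Δ t) := by
  induction t using tmul_induction with
  | tmul a b => rfl
  | add x y hx hy => simp only [map_add, hx, hy]

lemma comulRight_flip2 (Δ : H →ₐ[k] H ⊗[k] H) (t : H ⊗[k] H) :
    comulRight Δ (flip2 k H t) = (perm312 k H).symm (comulLeft Δ t) := by
  rw [AlgEquiv.eq_symm_apply, ← comulLeft_flip2, flip2_flip2]

lemma perm312_incl12 (t : H ⊗[k] H) :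
    perm312 k H (incl12 k H t) = incl13 k H (flip2 k H t) := by
  induction t using tmul_induction with
  | tmul a b => rfl
  | add x y hx hy => simp only [map_add, hx, hy]

lemma perm312_incl13 (t : H ⊗[k] H) :
    perm312 k H (incl13 k H t) = incl23 k H (flip2 k H t) := by
  induction t using tmul_induction with
  | tmul a b => rfl
  | add x y hx hy => simp only [map_add, hx, hy]

lemma perm312_perm213 (t : H ⊗[k] (H ⊗[k] H)) :
    perm312 k H (perm213 k H t) = perm132 k H t := by
  induction t using tmul₃_induction with
  | tmul a b c => rfl
  | add x y hx hy => simp only [map_add, hx, hy]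

lemma perm312_symm_incl23 (t : H ⊗[k] H) :
    (perm312 k H).symm (incl23 k H t) = incl13 k H (flip2 k H t) := by
  rw [AlgEquiv.symm_apply_eq, perm312_incl13, flip2_flip2]

lemma perm312_symm_incl13 (t : H ⊗[k] H) :
    (perm312 k H).symm (incl13 k H t) = incl12 k H (flip2 k H t) := by
  rw [AlgEquiv.symm_apply_eq, perm312_incl12, flip2_flip2]

lemma perm312_symm_perm132 (t : H ⊗[k] (H ⊗[k] H)) :
    (perm312 k H).symm (perm132 k H t) = perm213 k H t := by
  rw [AlgEquiv.symm_apply_eq, perm312_perm213]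

end Permutations

namespace QTQuasiHopfAlgebra

variable {k : Type u} {H : Type w} [Field k] [Ring H] [Algebra k H] (Q : QTQuasiHopfAlgebra k H)

/-! ### The reversed quasitriangular structure -/

/-- The inverse hexagons are needed because passing to R₂₁⁻¹ turns each hexagon into the inverse of
the other. -/
lemma comul_id_R_inv : comulLeft Q.Δ ((Q.R⁻¹ : (H ⊗[k] H)ˣ) : H ⊗[k] H) =
    ((Q.Φ⁻¹ : (H ⊗[k] (H ⊗[k] H))ˣ) : H ⊗[k] (H ⊗[k] H)) *
      incl23 k H ((Q.R⁻¹ : (H ⊗[k] H)ˣ) : H ⊗[k] H) *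
      perm132 k H (Q.Φ : H ⊗[k] (H ⊗[k] H)) *
      incl13 k H ((Q.R⁻¹ : (H ⊗[k] H)ˣ) : H ⊗[k] H) *
      perm312 k H ((Q.Φ⁻¹ : (H ⊗[k] (H ⊗[k] H))ˣ) : H ⊗[k] (H ⊗[k] H)) := by
  have h : Units.map (comulLeft Q.Δ : _ →* _) Q.R =
      Units.map (perm312 k H : _ →* _) Q.Φ * Units.map (incl13 k H : _ →* _) Q.R *
        Units.map (perm132 k H : _ →* _) Q.Φ⁻¹ * Units.map (incl23 k H : _ →* _) Q.R * Q.Φ :=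
    Units.ext Q.comul_id_R
  have h' := congrArg (fun U : (H ⊗[k] (H ⊗[k] H))ˣ => ((U⁻¹ : (H ⊗[k] (H ⊗[k] H))ˣ) : H ⊗[k] (H ⊗[k] H))) h
  simp only [mul_inv_rev, ← map_inv, inv_inv, Units.val_mul, Units.coe_map, mul_assoc] at h' ⊢
  exact h'

lemma id_comul_R_inv : comulRight Q.Δ ((Q.R⁻¹ : (H ⊗[k] H)ˣ) : H ⊗[k] H) =
    (Q.Φ : H ⊗[k] (H ⊗[k] H)) * incl12 k H ((Q.R⁻¹ : (H ⊗[k] H)ˣ) : H ⊗[k] H) *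
      perm213 k H ((Q.Φ⁻¹ : (H ⊗[k] (H ⊗[k] H))ˣ) : H ⊗[k] (H ⊗[k] H)) *
      incl13 k H ((Q.R⁻¹ : (H ⊗[k] H)ˣ) : H ⊗[k] H) *
      (perm312 k H).symm (Q.Φ : H ⊗[k] (H ⊗[k] H)) := by
  have h : Units.map (comulRight Q.Δ : _ →* _) Q.R =
      Units.map ((perm312 k H).symm : _ →* _) Q.Φ⁻¹ * Units.map (incl13 k H : _ →* _) Q.R *
        Units.map (perm213 k H : _ →* _) Q.Φ * Units.map (incl12 k H : _ →* _) Q.R * Q.Φ⁻¹ :=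
    Units.ext Q.id_comul_R
  have h' := congrArg (fun U : (H ⊗[k] (H ⊗[k] H))ˣ => ((U⁻¹ : (H ⊗[k] (H ⊗[k] H))ˣ) : H ⊗[k] (H ⊗[k] H))) h
  simp only [mul_inv_rev, ← map_inv, inv_inv, Units.val_mul, Units.coe_map, mul_assoc] at h' ⊢
  exact h'

/-- The quasitriangular structure with `R`-matrix `R₂₁⁻¹`. -/
def reverse : QTQuasiHopfAlgebra k H where
  toQuasiHopfAlgebra := Q.toQuasiHopfAlgebra
  R := Units.map (flip2 k H : _ →* _) Q.R⁻¹
  comul_id_R := by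
    change comulLeft Q.Δ (flip2 k H ((Q.R⁻¹ : (H ⊗[k] H)ˣ) : H ⊗[k] H)) = perm312 k H Q.Φ *
      incl13 k H (flip2 k H ((Q.R⁻¹ : (H ⊗[k] H)ˣ) : H ⊗[k] H)) * _ *
      incl23 k H (flip2 k H ((Q.R⁻¹ : (H ⊗[k] H)ˣ) : H ⊗[k] H)) * _
    -- The cyclic permutation carries the inverse of the second hexagon for R to the first hexagon
    -- for R₂₁⁻¹.
    rw [comulLeft_flip2, id_comul_R_inv]
    simp only [map_mul, perm312_incl12, perm312_incl13, perm312_perm213,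
      AlgEquiv.apply_symm_apply]
  id_comul_R := by
    change comulRight Q.Δ (flip2 k H ((Q.R⁻¹ : (H ⊗[k] H)ˣ) : H ⊗[k] H)) = _ *
      incl13 k H (flip2 k H ((Q.R⁻¹ : (H ⊗[k] H)ˣ) : H ⊗[k] H)) * _ *
      incl12 k H (flip2 k H ((Q.R⁻¹ : (H ⊗[k] H)ˣ) : H ⊗[k] H)) * _
    rw [comulRight_flip2, comul_id_R_inv]
    simp only [map_mul, perm312_symm_incl13, perm312_symm_incl23, perm312_symm_perm132,
      AlgEquiv.symm_apply_apply]
  comul_op h := by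
    change flip2 k H (Q.Δ h) * flip2 k H ((Q.R⁻¹ : (H ⊗[k] H)ˣ) : H ⊗[k] H) =
      flip2 k H ((Q.R⁻¹ : (H ⊗[k] H)ˣ) : H ⊗[k] H) * Q.Δ h
    have h1 : ((Q.R⁻¹ : (H ⊗[k] H)ˣ) : H ⊗[k] H) * flip2 k H (Q.Δ h) =
        Q.Δ h * ((Q.R⁻¹ : (H ⊗[k] H)ˣ) : H ⊗[k] H) := by
      rw [Units.inv_mul_eq_iff_eq_mul, ← mul_assoc, ← Q.comul_op, mul_assoc, Units.mul_inv,
        mul_one]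
    rw [← map_mul, ← h1, map_mul, flip2_flip2]

lemma reverse_R : (Q.reverse.R : H ⊗[k] H) =
    flip2 k H ((Q.R⁻¹ : (H ⊗[k] H)ˣ) : H ⊗[k] H) := rfl

lemma reverse_R_inv : ((Q.reverse.R⁻¹ : (H ⊗[k] H)ˣ) : H ⊗[k] H) =
    flip2 k H (Q.R : H ⊗[k] H) := rfl

/-! ### The counit and the Yang-Baxter relation -/

/-- `(ε ⊗ id)(R) = 1`. -/
lemma counitLeft_R : Q.counitLeft H (Q.R : H ⊗[k] H) = 1 := by
  -- With the first leg counited, each reassociator becomes 1 and the hexagon reads R = (1 ⊗ (ε ⊗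
  -- id)(R)) R; it remains to cancel R.
  have h := congrArg (Q.counitLeft (H ⊗[k] H)) Q.comul_id_R
  have h1 : ∀ t, Q.counitLeft (H ⊗[k] H) (perm312 k H t) = flip2 k H (Q.counitMiddle t) := by
    intro t
    induction t using tmul₃_induction with
    | tmul a b c => simp [perm312_tmul, flip2_tmul, TensorProduct.smul_tmul']
    | add x y hx hy => simp only [map_add, hx, hy]
  have h2 : ∀ t, Q.counitLeft (H ⊗[k] H) (incl13 k H t) = 1 ⊗ₜ Q.counitLeft H t := by
    intro t
    induction t using tmul_induction with
    | tmul a b => simp [incl13_tmul]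
    | add x y hx hy => simp only [map_add, hx, hy, TensorProduct.tmul_add]
  have h3 : ∀ t, Q.counitLeft (H ⊗[k] H) (perm132 k H t) =
      flip2 k H (Q.counitLeft (H ⊗[k] H) t) := by
    intro t
    induction t using tmul₃_induction with
    | tmul a b c => simp [perm132_tmul, flip2_tmul, TensorProduct.smul_tmul']
    | add x y hx hy => simp only [map_add, hx, hy]
  have h4 : ∀ t, Q.counitLeft (H ⊗[k] H) (incl23 k H t) = t := by
    intro t; simp [incl23]
  have h5 : Q.counitLeft (H ⊗[k] H) ((Q.Φ⁻¹ : (H ⊗[k] (H ⊗[k] H))ˣ) : H ⊗[k] (H ⊗[k] H)) = 1 := by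
    rw [← mul_one (Q.counitLeft (H ⊗[k] H) _), ← Q.counitLeft_reassociator, ← map_mul,
      Units.inv_mul, map_one, Q.counitLeft_reassociator]
  simp only [map_mul, Q.counitLeft_comulLeft, h1, h2, h3, h4, h5, Q.counitMiddle_reassociator,
    Q.counitLeft_reassociator, map_one, one_mul, mul_one] at h
  have h6 : (1 : H) ⊗ₜ[k] Q.counitLeft H (Q.R : H ⊗[k] H) = 1 := by
    have := congrArg (fun x => x * ((Q.R⁻¹ : (H ⊗[k] H)ˣ) : H ⊗[k] H)) h
    simpa [mul_assoc] using this.symm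
  simpa [Algebra.TensorProduct.one_def] using congrArg (Q.counitLeft H) h6

lemma counitLeft_R_inv : Q.counitLeft H ((Q.R⁻¹ : (H ⊗[k] H)ˣ) : H ⊗[k] H) = 1 := by
  rw [← mul_one (Q.counitLeft H _), ← Q.counitLeft_R, ← map_mul, Units.inv_mul, map_one,
    Q.counitLeft_R]

lemma counitLeft_flip2 (t : H ⊗[k] H) :
    Q.counitLeft H (flip2 k H t) = Q.counitRight H t := by
  induction t using tmul_induction with
  | tmul a b => simp [flip2_tmul]
  | add x y hx hy => simp only [map_add, hx, hy]

/-- `(id ⊗ ε)(R) = 1`. -/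
lemma counitRight_R : Q.counitRight H (Q.R : H ⊗[k] H) = 1 := by
  rw [← counitLeft_flip2]
  -- The inverse of the reversed R-matrix is R₂₁, so the reversed structure supplies the counit of
  -- the other leg.
  exact Q.reverse.counitLeft_R_inv

lemma counitRight_R_inv : Q.counitRight H ((Q.R⁻¹ : (H ⊗[k] H)ˣ) : H ⊗[k] H) = 1 := by
  rw [← counitLeft_flip2]
  exact Q.reverse.counitLeft_R

lemma incl12_mul_comulLeft (t : H ⊗[k] H) :
    incl12 k H (Q.R : H ⊗[k] H) * comulLeft Q.Δ t =
      perm213 k H (comulLeft Q.Δ t) * incl12 k H (Q.R : H ⊗[k] H) := by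
  induction t using tmul_induction with
  | tmul a b =>
    have h1 : ∀ s : H ⊗[k] H, perm213 k H (incl12 k H s) = incl12 k H (flip2 k H s) := by
      intro s
      induction s using tmul_induction with
      | tmul a b => rfl
      | add x y hx hy => simp only [map_add, hx, hy]
    have h2 : ∀ s : H ⊗[k] H, incl12 k H s * (1 ⊗ₜ (1 ⊗ₜ b)) = (1 ⊗ₜ (1 ⊗ₜ b)) * incl12 k H s := by
      intro s
      induction s using tmul_induction with
      | tmul a b => simp [incl12_tmul]
      | add x y hx hy => simp only [map_add, hx, hy, add_mul, mul_add]
    rw [comulLeft_tmul_eq, map_mul, h1, perm213_tmul, ← mul_assoc, ← map_mul, ← Q.comul_op,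
      map_mul, mul_assoc, h2, mul_assoc]
  | add x y hx hy => simp only [map_add, mul_add, add_mul, hx, hy]

/-- The quasi-Yang-Baxter equation, in the form
`(1 ⊗ R) (id ⊗ Δ)(R) Φ = Φ⁻¹₃₂₁ (R ⊗ 1) (Δ ⊗ id)(R)`. -/
lemma yangBaxter :
    incl23 k H (Q.R : H ⊗[k] H) * comulRight Q.Δ (Q.R : H ⊗[k] H) *
        (Q.Φ : H ⊗[k] (H ⊗[k] H)) =
      perm321 k H ((Q.Φ⁻¹ : (H ⊗[k] (H ⊗[k] H))ˣ) : H ⊗[k] (H ⊗[k] H)) *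
        incl12 k H (Q.R : H ⊗[k] H) * comulLeft Q.Δ (Q.R : H ⊗[k] H) := by
  have h1 : ∀ t, perm213 k H (perm312 k H t) = perm321 k H t := fun _ => rfl
  have h2 : ∀ t : H ⊗[k] (H ⊗[k] H), perm213 k H (perm132 k H t) = (perm312 k H).symm t := by
    intro t
    rw [← perm312_symm_perm132]
    exact congrArg _ (perm132_perm132 t)
  have h3 : ∀ t : H ⊗[k] H, perm213 k H (incl13 k H t) = incl23 k H t := by
    intro t
    induction t using tmul_induction with
    | tmul a b => rfl
    | add x y hx hy => simp only [map_add, hx, hy]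
  have h4 : ∀ t : H ⊗[k] H, perm213 k H (incl23 k H t) = incl13 k H t := by
    intro t
    induction t using tmul_induction with
    | tmul a b => rfl
    | add x y hx hy => simp only [map_add, hx, hy]
  have h5 : perm321 k H ((Q.Φ⁻¹ : (H ⊗[k] (H ⊗[k] H))ˣ) : H ⊗[k] (H ⊗[k] H)) *
      perm321 k H (Q.Φ : H ⊗[k] (H ⊗[k] H)) = 1 := by
    rw [← map_mul, Units.inv_mul, map_one]
  -- Carrying R₁₂ past `(Δ ⊗ id)(R)` swaps the first two legs of the latter. Once both hexagons are
  -- expanded, the two sides agree up to Φ⁻¹₃₂₁Φ₃₂₁ = 1.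
  rw [mul_assoc _ (incl12 k H _), incl12_mul_comulLeft, Q.comul_id_R, Q.id_comul_R]
  simp only [map_mul, h1, h2, h3, h4, mul_assoc, Units.inv_mul, mul_one]
  rw [← mul_assoc (perm321 k H _), h5, one_mul]

end QTQuasiHopfAlgebra

end

end QHopf

namespace QHopf

noncomputable section

/-! ### Sandwich maps -/

section Sandwich

variable {k : Type*} {H A : Type*} [Field k] [Ring H] [Algebra k H] [Ring A] [Algebra k A]

/-- `a ⊗ b ↦ f(a) x g(b)`. -/
def sw₂ (f : H →ₗ[k] A) (x : A) (g : H →ₗ[k] A) : H ⊗[k] H →ₗ[k] A :=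
  LinearMap.mul' k A ∘ₗ TensorProduct.map (LinearMap.mulRight k x ∘ₗ f) g

/-- `a ⊗ b ⊗ c ↦ f(a) x g(b) y h(c)`. -/
def sw₃ (f : H →ₗ[k] A) (x : A) (g : H →ₗ[k] A) (y : A) (h : H →ₗ[k] A) :
    H ⊗[k] (H ⊗[k] H) →ₗ[k] A :=
  LinearMap.mul' k A ∘ₗ TensorProduct.map (LinearMap.mulRight k x ∘ₗ f) (sw₂ g y h)

/-- `a ⊗ b ⊗ c ⊗ d ↦ f(a) x g(b) y h(c) z l(d)`. -/
def sw₄ (f : H →ₗ[k] A) (x : A) (g : H →ₗ[k] A) (y : A) (h : H →ₗ[k] A) (z : A)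
    (l : H →ₗ[k] A) : H ⊗[k] (H ⊗[k] (H ⊗[k] H)) →ₗ[k] A :=
  LinearMap.mul' k A ∘ₗ TensorProduct.map (LinearMap.mulRight k x ∘ₗ f) (sw₃ g y h z l)

@[simp] lemma sw₂_tmul (f : H →ₗ[k] A) (x : A) (g : H →ₗ[k] A) (a b : H) :
    sw₂ f x g (a ⊗ₜ b) = f a * x * g b := rfl

@[simp] lemma sw₃_tmul (f : H →ₗ[k] A) (x : A) (g : H →ₗ[k] A) (y : A) (h : H →ₗ[k] A)
    (a : H) (t : H ⊗[k] H) : sw₃ f x g y h (a ⊗ₜ t) = f a * x * sw₂ g y h t := rfl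

@[simp] lemma sw₄_tmul (f : H →ₗ[k] A) (x : A) (g : H →ₗ[k] A) (y : A) (h : H →ₗ[k] A) (z : A)
    (l : H →ₗ[k] A) (a : H) (t : H ⊗[k] (H ⊗[k] H)) :
    sw₄ f x g y h z l (a ⊗ₜ t) = f a * x * sw₃ g y h z l t := rfl

lemma sw₂_smul (f : H →ₗ[k] A) (c : k) (x : A) (g : H →ₗ[k] A) (t : H ⊗[k] H) :
    sw₂ f (c • x) g t = c • sw₂ f x g t := by
  induction t using tmul_induction with
  | tmul a b => simp
  | add x y hx hy => simp only [map_add, hx, hy, smul_add]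

lemma sw₃_smul_left (f : H →ₗ[k] A) (c : k) (x : A) (g : H →ₗ[k] A) (y : A) (h : H →ₗ[k] A)
    (t : H ⊗[k] (H ⊗[k] H)) : sw₃ f (c • x) g y h t = c • sw₃ f x g y h t := by
  induction t using tmul_induction with
  | tmul a b => simp
  | add x y hx hy => simp only [map_add, hx, hy, smul_add]

lemma sw₃_smul_right (f : H →ₗ[k] A) (c : k) (x : A) (g : H →ₗ[k] A) (y : A) (h : H →ₗ[k] A)
    (t : H ⊗[k] (H ⊗[k] H)) : sw₃ f x g (c • y) h t = c • sw₃ f x g y h t := by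
  induction t using tmul_induction with
  | tmul a b => simp [sw₂_smul]
  | add x y hx hy => simp only [map_add, hx, hy, smul_add]

lemma sw₄_smul₁ (f : H →ₗ[k] A) (c : k) (x : A) (g : H →ₗ[k] A) (y : A) (h : H →ₗ[k] A) (z : A)
    (l : H →ₗ[k] A) (t : H ⊗[k] (H ⊗[k] (H ⊗[k] H))) :
    sw₄ f (c • x) g y h z l t = c • sw₄ f x g y h z l t := by
  induction t using tmul_induction with
  | tmul a b => simp
  | add x y hx hy => simp only [map_add, hx, hy, smul_add]

lemma sw₄_smul₂ (f : H →ₗ[k] A) (c : k) (x : A) (g : H →ₗ[k] A) (y : A) (h : H →ₗ[k] A) (z : A)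
    (l : H →ₗ[k] A) (t : H ⊗[k] (H ⊗[k] (H ⊗[k] H))) :
    sw₄ f x g (c • y) h z l t = c • sw₄ f x g y h z l t := by
  induction t using tmul_induction with
  | tmul a b => simp [sw₃_smul_left]
  | add x y hx hy => simp only [map_add, hx, hy, smul_add]

lemma sw₄_smul₃ (f : H →ₗ[k] A) (c : k) (x : A) (g : H →ₗ[k] A) (y : A) (h : H →ₗ[k] A) (z : A)
    (l : H →ₗ[k] A) (t : H ⊗[k] (H ⊗[k] (H ⊗[k] H))) :
    sw₄ f x g y h (c • z) l t = c • sw₄ f x g y h z l t := by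
  induction t using tmul_induction with
  | tmul a b => simp [sw₃_smul_right]
  | add x y hx hy => simp only [map_add, hx, hy, smul_add]

variable {ρ : H →ₐ[k] A} {σ : H →ₗ[k] A}

/-- Since σ reverses products and ρ preserves them, the left factor of a product ends up next to x
in a cap, and the right factor does so in a cup. -/
lemma sw₂_mul_cap (hσ : ∀ a b, σ (a * b) = σ b * σ a) (x : A) (s t : H ⊗[k] H) :
    sw₂ σ x ρ.toLinearMap (s * t) = sw₂ σ (sw₂ σ x ρ.toLinearMap s) ρ.toLinearMap t := by
  induction t using tmul_induction with
  | tmul a b =>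
    induction s using tmul_induction with
    | tmul c d => simp [hσ, mul_assoc]
    | add x y hx hy => simp_all [add_mul, mul_add]
  | add x y hx hy => simp only [map_add, hx, hy, mul_add]

lemma sw₂_mul_cup (hσ : ∀ a b, σ (a * b) = σ b * σ a) (x : A) (s t : H ⊗[k] H) :
    sw₂ ρ.toLinearMap x σ (s * t) = sw₂ ρ.toLinearMap (sw₂ ρ.toLinearMap x σ t) σ s := by
  induction s using tmul_induction with
  | tmul a b =>
    induction t using tmul_induction with
    | tmul c d => simp [hσ, mul_assoc]
    | add x y hx hy => simp_all [add_mul, mul_add]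
  | add x y hx hy => simp only [map_add, hx, hy, add_mul]

/-! ### Sliding along a cap or a cup -/

/-- In this and the following lemmas a two-leg factor collapses into the cap or cup standing over
its legs: caps take factors multiplied on the left, cups take factors multiplied on the right. -/
lemma sw₄_cap₁₂ (hσ : ∀ a b, σ (a * b) = σ b * σ a) (x y : A) (h : H →ₗ[k] A) (z : A)
    (l : H →ₗ[k] A) (c p : H ⊗[k] H) (t : H ⊗[k] (H ⊗[k] (H ⊗[k] H))) :
    sw₄ σ x ρ.toLinearMap y h z l (TensorProduct.assoc k H H (H ⊗[k] H) (c ⊗ₜ p) * t) =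
      sw₄ σ (sw₂ σ x ρ.toLinearMap c) ρ.toLinearMap y h z l ((1 ⊗ₜ (1 ⊗ₜ p)) * t) := by
  induction t using tmul₃_induction with
  | tmul a b t =>
    induction c using tmul_induction with
    | tmul c d => simp [hσ, mul_assoc]
    | add x y hx hy => simp_all [add_mul, mul_add, TensorProduct.add_tmul]
  | add x y hx hy => simp only [map_add, hx, hy, mul_add]

lemma sw₄_cap₂₃ (hσ : ∀ a b, σ (a * b) = σ b * σ a) (f : H →ₗ[k] A) (x y z : A)
    (l : H →ₗ[k] A) (a d : H) (c : H ⊗[k] H) (t : H ⊗[k] (H ⊗[k] (H ⊗[k] H))) :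
    sw₄ f x σ y ρ.toLinearMap z l ((a ⊗ₜ TensorProduct.assoc k H H H (c ⊗ₜ d)) * t) =
      sw₄ f x σ (sw₂ σ y ρ.toLinearMap c) ρ.toLinearMap z l ((a ⊗ₜ (1 ⊗ₜ (1 ⊗ₜ d))) * t) := by
  induction t using tmul₄_induction with
  | tmul a b e g =>
    induction c using tmul_induction with
    | tmul c d => simp [hσ, mul_assoc]
    | add x y hx hy =>
      simp_all [add_mul, mul_add, TensorProduct.add_tmul, TensorProduct.tmul_add]
  | add x y hx hy => simp only [map_add, hx, hy, mul_add]

lemma sw₄_cap₃₄ (hσ : ∀ a b, σ (a * b) = σ b * σ a) (f : H →ₗ[k] A) (x : A) (g : H →ₗ[k] A)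
    (y z : A) (a b : H) (c : H ⊗[k] H) (t : H ⊗[k] (H ⊗[k] (H ⊗[k] H))) :
    sw₄ f x g y σ z ρ.toLinearMap ((a ⊗ₜ (b ⊗ₜ c)) * t) =
      sw₄ f x g y σ (sw₂ σ z ρ.toLinearMap c) ρ.toLinearMap ((a ⊗ₜ (b ⊗ₜ 1)) * t) := by
  induction t using tmul₃_induction with
  | tmul a b t => simp [sw₂_mul_cap hσ]
  | add x y hx hy => simp only [map_add, hx, hy, mul_add]

lemma sw₄_cup₁₂ (hσ : ∀ a b, σ (a * b) = σ b * σ a) (x y : A) (h : H →ₗ[k] A) (z : A)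
    (l : H →ₗ[k] A) (c p : H ⊗[k] H) (t : H ⊗[k] (H ⊗[k] (H ⊗[k] H))) :
    sw₄ ρ.toLinearMap x σ y h z l (t * TensorProduct.assoc k H H (H ⊗[k] H) (c ⊗ₜ p)) =
      sw₄ ρ.toLinearMap (sw₂ ρ.toLinearMap x σ c) σ y h z l (t * (1 ⊗ₜ (1 ⊗ₜ p))) := by
  induction t using tmul₃_induction with
  | tmul a b t =>
    induction c using tmul_induction with
    | tmul c d => simp [hσ, mul_assoc]
    | add x y hx hy => simp_all [add_mul, mul_add, TensorProduct.add_tmul]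
  | add x y hx hy => simp only [map_add, hx, hy, add_mul]

lemma sw₄_cup₂₃ (hσ : ∀ a b, σ (a * b) = σ b * σ a) (f : H →ₗ[k] A) (x y z : A)
    (l : H →ₗ[k] A) (a d : H) (c : H ⊗[k] H) (t : H ⊗[k] (H ⊗[k] (H ⊗[k] H))) :
    sw₄ f x ρ.toLinearMap y σ z l (t * (a ⊗ₜ TensorProduct.assoc k H H H (c ⊗ₜ d))) =
      sw₄ f x ρ.toLinearMap (sw₂ ρ.toLinearMap y σ c) σ z l (t * (a ⊗ₜ (1 ⊗ₜ (1 ⊗ₜ d)))) := by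
  induction t using tmul₄_induction with
  | tmul a b e g =>
    induction c using tmul_induction with
    | tmul c d => simp [hσ, mul_assoc]
    | add x y hx hy =>
      simp_all [add_mul, mul_add, TensorProduct.add_tmul, TensorProduct.tmul_add]
  | add x y hx hy => simp only [map_add, hx, hy, add_mul]

lemma sw₄_cup₃₄ (hσ : ∀ a b, σ (a * b) = σ b * σ a) (f : H →ₗ[k] A) (x : A) (g : H →ₗ[k] A)
    (y z : A) (a b : H) (c : H ⊗[k] H) (t : H ⊗[k] (H ⊗[k] (H ⊗[k] H))) :
    sw₄ f x g y ρ.toLinearMap z σ (t * (a ⊗ₜ (b ⊗ₜ c))) =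
      sw₄ f x g y ρ.toLinearMap (sw₂ ρ.toLinearMap z σ c) σ (t * (a ⊗ₜ (b ⊗ₜ 1))) := by
  induction t using tmul₃_induction with
  | tmul a b t => simp [sw₂_mul_cup hσ]
  | add x y hx hy => simp only [map_add, hx, hy, add_mul]

lemma sw₃_cap₁₂ (hσ : ∀ a b, σ (a * b) = σ b * σ a) (x y : A) (h : H →ₗ[k] A)
    (c : H ⊗[k] H) (d : H) (t : H ⊗[k] (H ⊗[k] H)) :
    sw₃ σ x ρ.toLinearMap y h (TensorProduct.assoc k H H H (c ⊗ₜ d) * t) =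
      sw₃ σ (sw₂ σ x ρ.toLinearMap c) ρ.toLinearMap y h ((1 ⊗ₜ (1 ⊗ₜ d)) * t) := by
  induction t using tmul₃_induction with
  | tmul a b t =>
    induction c using tmul_induction with
    | tmul c d => simp [hσ, mul_assoc]
    | add x y hx hy => simp_all [add_mul, mul_add, TensorProduct.add_tmul]
  | add x y hx hy => simp only [map_add, hx, hy, mul_add]

lemma sw₃_cap₂₃ (hσ : ∀ a b, σ (a * b) = σ b * σ a) (f : H →ₗ[k] A) (x y : A)
    (a : H) (c : H ⊗[k] H) (t : H ⊗[k] (H ⊗[k] H)) :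
    sw₃ f x σ y ρ.toLinearMap ((a ⊗ₜ c) * t) =
      sw₃ f x σ (sw₂ σ y ρ.toLinearMap c) ρ.toLinearMap ((a ⊗ₜ 1) * t) := by
  induction t using tmul_induction with
  | tmul a t => simp [sw₂_mul_cap hσ]
  | add x y hx hy => simp only [map_add, hx, hy, mul_add]

lemma sw₃_cup₁₂ (hσ : ∀ a b, σ (a * b) = σ b * σ a) (x y : A) (h : H →ₗ[k] A)
    (c : H ⊗[k] H) (d : H) (t : H ⊗[k] (H ⊗[k] H)) :
    sw₃ ρ.toLinearMap x σ y h (t * TensorProduct.assoc k H H H (c ⊗ₜ d)) =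
      sw₃ ρ.toLinearMap (sw₂ ρ.toLinearMap x σ c) σ y h (t * (1 ⊗ₜ (1 ⊗ₜ d))) := by
  induction t using tmul₃_induction with
  | tmul a b t =>
    induction c using tmul_induction with
    | tmul c d => simp [hσ, mul_assoc]
    | add x y hx hy => simp_all [add_mul, mul_add, TensorProduct.add_tmul]
  | add x y hx hy => simp only [map_add, hx, hy, add_mul]

lemma sw₃_cup₂₃ (hσ : ∀ a b, σ (a * b) = σ b * σ a) (f : H →ₗ[k] A) (x y : A)
    (a : H) (c : H ⊗[k] H) (t : H ⊗[k] (H ⊗[k] H)) :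
    sw₃ f x ρ.toLinearMap y σ (t * (a ⊗ₜ c)) =
      sw₃ f x ρ.toLinearMap (sw₂ ρ.toLinearMap y σ c) σ (t * (a ⊗ₜ 1)) := by
  induction t using tmul_induction with
  | tmul a t => simp [sw₂_mul_cup hσ]
  | add x y hx hy => simp only [map_add, hx, hy, add_mul]

end Sandwich

end

end QHopf

namespace QHopf

noncomputable section

/-! ### Antipodes along an algebra map and their uniqueness -/

section AntipodeAlong

variable {k : Type u} {H : Type w} [Field k] [Ring H] [Algebra k H] {A : Type*} [Ring A]
  [Algebra k A] (Q : QuasiHopfAlgebra k H)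

/-- `(σ, α, β)` satisfies the axioms of an antipode relative to the algebra map `ρ : H → A`. -/
structure AntipodeAlong (ρ : H →ₐ[k] A) (σ : H →ₗ[k] A) (α β : A) : Prop where
  map_mul : ∀ a b, σ (a * b) = σ b * σ a
  left : ∀ h, sw₂ σ α ρ.toLinearMap (Q.Δ h) = Q.counit h • α
  right : ∀ h, sw₂ ρ.toLinearMap β σ (Q.Δ h) = Q.counit h • β
  zigzag : sw₃ ρ.toLinearMap β σ α ρ.toLinearMap (Q.Φ : H ⊗[k] (H ⊗[k] H)) = 1
  zigzag_inv : sw₃ σ α ρ.toLinearMap β σ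
    ((Q.Φ⁻¹ : (H ⊗[k] (H ⊗[k] H))ˣ) : H ⊗[k] (H ⊗[k] H)) = 1

lemma QuasiHopfAlgebra.antipodeAlong_id :
    AntipodeAlong Q (AlgHom.id k H) Q.S Q.α Q.β where
  map_mul := Q.S_mul
  left h := by
    rw [← Q.antipode_left]
    generalize Q.Δ h = t
    induction t using tmul_induction with
    | tmul a b => simp [mulMap, mul_assoc]
    | add x y hx hy => simp only [_root_.map_add, hx, hy]
  right h := by
    rw [← Q.antipode_right]
    generalize Q.Δ h = t
    induction t using tmul_induction with
    | tmul a b => simp [mulMap]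
    | add x y hx hy => simp only [_root_.map_add, hx, hy]
  zigzag := by
    rw [← Q.reassociator_antipode]
    generalize (Q.Φ : H ⊗[k] (H ⊗[k] H)) = t
    induction t using tmul₃_induction with
    | tmul a b c => simp [mulMap₃, mulMap, mul_assoc]
    | add x y hx hy => simp only [_root_.map_add, hx, hy]
  zigzag_inv := by
    rw [← Q.reassociator_inv_antipode]
    generalize ((Q.Φ⁻¹ : (H ⊗[k] (H ⊗[k] H))ˣ) : H ⊗[k] (H ⊗[k] H)) = t
    induction t using tmul₃_induction with
    | tmul a b c => simp [mulMap₃, mulMap, mul_assoc]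
    | add x y hx hy => simp only [_root_.map_add, hx, hy]

variable {Q} {ρ : H →ₐ[k] A} {σ σ' : H →ₗ[k] A} {α β α' β' : A}

/-! ### Absorption of coproducts by caps and cups -/

section Absorb

variable (hσ : ∀ a b, σ (a * b) = σ b * σ a)
include hσ

/-- After sliding, the cap meets Δ of a single leg of s and one antipode axiom turns it into a
counit. Anti-multiplicativity and that one axiom suffice, so the absorption lemmas also serve for
data that are not known to form a full antipode. -/
lemma sw₄_absorb_cap₁₂ (left : ∀ h, sw₂ σ α ρ.toLinearMap (Q.Δ h) = Q.counit h • α)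
    (y : A) (f : H →ₗ[k] A) (z : A) (g : H →ₗ[k] A) (s : H ⊗[k] (H ⊗[k] H))
    (t : H ⊗[k] (H ⊗[k] (H ⊗[k] H))) :
    sw₄ σ α ρ.toLinearMap y f z g (Algebra.TensorProduct.assoc k k k H H (H ⊗[k] H)
        (Algebra.TensorProduct.map Q.Δ (AlgHom.id k (H ⊗[k] H)) s) * t) =
      sw₄ σ α ρ.toLinearMap y f z g
        ((1 ⊗ₜ (1 ⊗ₜ Q.counitLeft (H ⊗[k] H) s)) * t) := by
  induction s using tmul_induction with
  | tmul a p =>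
    refine (sw₄_cap₁₂ hσ α y f z g (Q.Δ a) p t).trans ?_
    rw [left, sw₄_smul₁, ← map_smul, Q.counitLeft_tmul, ← smul_mul_assoc]
    simp only [TensorProduct.tmul_smul]
  | add x y hx hy => simp only [map_add, add_mul, TensorProduct.tmul_add, hx, hy]

lemma sw₄_absorb_cap₂₃ (left : ∀ h, sw₂ σ α ρ.toLinearMap (Q.Δ h) = Q.counit h • α)
    (f : H →ₗ[k] A) (x z : A) (g : H →ₗ[k] A) (s : H ⊗[k] (H ⊗[k] H))
    (t : H ⊗[k] (H ⊗[k] (H ⊗[k] H))) :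
    sw₄ f x σ α ρ.toLinearMap z g
        (Algebra.TensorProduct.map (AlgHom.id k H) (comulLeft Q.Δ) s * t) =
      sw₄ f x σ α ρ.toLinearMap z g (Algebra.TensorProduct.map (AlgHom.id k H)
        (Algebra.TensorProduct.includeRight.comp Algebra.TensorProduct.includeRight)
        (Q.counitMiddle s) * t) := by
  induction s using tmul₃_induction with
  | tmul a b c =>
    refine (sw₄_cap₂₃ hσ f x α z g a c (Q.Δ b) t).trans ?_
    rw [left, sw₄_smul₂, ← map_smul, Q.counitMiddle_tmul, Q.counitLeft_tmul, ← smul_mul_assoc]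
    simp
  | add x y hx hy => simp only [map_add, add_mul, hx, hy]

lemma sw₄_absorb_cap₃₄ (left : ∀ h, sw₂ σ α ρ.toLinearMap (Q.Δ h) = Q.counit h • α)
    (f : H →ₗ[k] A) (x : A) (g : H →ₗ[k] A) (y : A) (s : H ⊗[k] (H ⊗[k] H))
    (t : H ⊗[k] (H ⊗[k] (H ⊗[k] H))) :
    sw₄ f x g y σ α ρ.toLinearMap
        (Algebra.TensorProduct.map (AlgHom.id k H) (comulRight Q.Δ) s * t) =
      sw₄ f x g y σ α ρ.toLinearMap (Algebra.TensorProduct.map (AlgHom.id k H)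
        Algebra.TensorProduct.includeLeft (Q.counitLast s) * t) := by
  induction s using tmul₃_induction with
  | tmul a b c =>
    refine (sw₄_cap₃₄ hσ f x g y α a b (Q.Δ c) t).trans ?_
    rw [left, sw₄_smul₃, ← map_smul, Q.counitLast_tmul, Q.counitRight_tmul, ← smul_mul_assoc]
    simp [TensorProduct.smul_tmul']
  | add x y hx hy => simp only [map_add, add_mul, hx, hy]

lemma sw₄_absorb_cup₁₂ (right : ∀ h, sw₂ ρ.toLinearMap β σ (Q.Δ h) = Q.counit h • β)
    (y : A) (f : H →ₗ[k] A) (z : A) (g : H →ₗ[k] A) (s : H ⊗[k] (H ⊗[k] H))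
    (t : H ⊗[k] (H ⊗[k] (H ⊗[k] H))) :
    sw₄ ρ.toLinearMap β σ y f z g (t * Algebra.TensorProduct.assoc k k k H H (H ⊗[k] H)
        (Algebra.TensorProduct.map Q.Δ (AlgHom.id k (H ⊗[k] H)) s)) =
      sw₄ ρ.toLinearMap β σ y f z g
        (t * (1 ⊗ₜ (1 ⊗ₜ Q.counitLeft (H ⊗[k] H) s))) := by
  induction s using tmul_induction with
  | tmul a p =>
    refine (sw₄_cup₁₂ hσ β y f z g (Q.Δ a) p t).trans ?_
    rw [right, sw₄_smul₁, ← map_smul, Q.counitLeft_tmul, ← mul_smul_comm]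
    simp only [TensorProduct.tmul_smul]
  | add x y hx hy => simp only [map_add, mul_add, TensorProduct.tmul_add, hx, hy]

lemma sw₄_absorb_cup₂₃ (right : ∀ h, sw₂ ρ.toLinearMap β σ (Q.Δ h) = Q.counit h • β)
    (f : H →ₗ[k] A) (x z : A) (g : H →ₗ[k] A) (s : H ⊗[k] (H ⊗[k] H))
    (t : H ⊗[k] (H ⊗[k] (H ⊗[k] H))) :
    sw₄ f x ρ.toLinearMap β σ z g
        (t * Algebra.TensorProduct.map (AlgHom.id k H) (comulLeft Q.Δ) s) =
      sw₄ f x ρ.toLinearMap β σ z g (t * Algebra.TensorProduct.map (AlgHom.id k H)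
        (Algebra.TensorProduct.includeRight.comp Algebra.TensorProduct.includeRight)
        (Q.counitMiddle s)) := by
  induction s using tmul₃_induction with
  | tmul a b c =>
    refine (sw₄_cup₂₃ hσ f x β z g a c (Q.Δ b) t).trans ?_
    rw [right, sw₄_smul₂, ← map_smul, Q.counitMiddle_tmul, Q.counitLeft_tmul, ← mul_smul_comm]
    simp
  | add x y hx hy => simp only [map_add, mul_add, hx, hy]

lemma sw₄_absorb_cup₃₄ (right : ∀ h, sw₂ ρ.toLinearMap β σ (Q.Δ h) = Q.counit h • β)
    (f : H →ₗ[k] A) (x : A) (g : H →ₗ[k] A) (y : A) (s : H ⊗[k] (H ⊗[k] H))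
    (t : H ⊗[k] (H ⊗[k] (H ⊗[k] H))) :
    sw₄ f x g y ρ.toLinearMap β σ
        (t * Algebra.TensorProduct.map (AlgHom.id k H) (comulRight Q.Δ) s) =
      sw₄ f x g y ρ.toLinearMap β σ (t * Algebra.TensorProduct.map (AlgHom.id k H)
        Algebra.TensorProduct.includeLeft (Q.counitLast s)) := by
  induction s using tmul₃_induction with
  | tmul a b c =>
    refine (sw₄_cup₃₄ hσ f x g y β a b (Q.Δ c) t).trans ?_
    rw [right, sw₄_smul₃, ← map_smul, Q.counitLast_tmul, Q.counitRight_tmul, ← mul_smul_comm]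
    simp [TensorProduct.smul_tmul']
  | add x y hx hy => simp only [map_add, mul_add, hx, hy]

lemma sw₃_absorb_cap₁₂ (left : ∀ h, sw₂ σ α ρ.toLinearMap (Q.Δ h) = Q.counit h • α)
    (y : A) (f : H →ₗ[k] A) (s : H ⊗[k] H) (t : H ⊗[k] (H ⊗[k] H)) :
    sw₃ σ α ρ.toLinearMap y f (comulLeft Q.Δ s * t) =
      sw₃ σ α ρ.toLinearMap y f ((1 ⊗ₜ (1 ⊗ₜ Q.counitLeft H s)) * t) := by
  induction s using tmul_induction with
  | tmul a b =>
    refine (sw₃_cap₁₂ hσ α y f (Q.Δ a) b t).trans ?_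
    rw [left, sw₃_smul_left, ← map_smul, Q.counitLeft_tmul, ← smul_mul_assoc]
    simp only [TensorProduct.tmul_smul]
  | add x y hx hy => simp only [map_add, add_mul, TensorProduct.tmul_add, hx, hy]

lemma sw₃_absorb_cap₂₃ (left : ∀ h, sw₂ σ α ρ.toLinearMap (Q.Δ h) = Q.counit h • α)
    (f : H →ₗ[k] A) (x : A) (s : H ⊗[k] H) (t : H ⊗[k] (H ⊗[k] H)) :
    sw₃ f x σ α ρ.toLinearMap (comulRight Q.Δ s * t) =
      sw₃ f x σ α ρ.toLinearMap ((Q.counitRight H s ⊗ₜ 1) * t) := by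
  induction s using tmul_induction with
  | tmul a b =>
    refine (sw₃_cap₂₃ hσ f x α a (Q.Δ b) t).trans ?_
    rw [left, sw₃_smul_right, ← map_smul, Q.counitRight_tmul, ← smul_mul_assoc]
    simp only [TensorProduct.smul_tmul']
  | add x y hx hy => simp only [map_add, add_mul, TensorProduct.add_tmul, hx, hy]

lemma sw₃_absorb_cup₁₂ (right : ∀ h, sw₂ ρ.toLinearMap β σ (Q.Δ h) = Q.counit h • β)
    (y : A) (f : H →ₗ[k] A) (s : H ⊗[k] H) (t : H ⊗[k] (H ⊗[k] H)) :
    sw₃ ρ.toLinearMap β σ y f (t * comulLeft Q.Δ s) =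
      sw₃ ρ.toLinearMap β σ y f (t * (1 ⊗ₜ (1 ⊗ₜ Q.counitLeft H s))) := by
  induction s using tmul_induction with
  | tmul a b =>
    refine (sw₃_cup₁₂ hσ β y f (Q.Δ a) b t).trans ?_
    rw [right, sw₃_smul_left, ← map_smul, Q.counitLeft_tmul, ← mul_smul_comm]
    simp only [TensorProduct.tmul_smul]
  | add x y hx hy => simp only [map_add, mul_add, TensorProduct.tmul_add, hx, hy]

lemma sw₃_absorb_cup₂₃ (right : ∀ h, sw₂ ρ.toLinearMap β σ (Q.Δ h) = Q.counit h • β)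
    (f : H →ₗ[k] A) (x : A) (s : H ⊗[k] H) (t : H ⊗[k] (H ⊗[k] H)) :
    sw₃ f x ρ.toLinearMap β σ (t * comulRight Q.Δ s) =
      sw₃ f x ρ.toLinearMap β σ (t * (Q.counitRight H s ⊗ₜ 1)) := by
  induction s using tmul_induction with
  | tmul a b =>
    refine (sw₃_cup₂₃ hσ f x β a (Q.Δ b) t).trans ?_
    rw [right, sw₃_smul_right, ← map_smul, Q.counitRight_tmul, ← mul_smul_comm]
    simp only [TensorProduct.smul_tmul']
  | add x y hx hy => simp only [map_add, mul_add, TensorProduct.add_tmul, hx, hy]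

end Absorb

lemma QuasiHopfAlgebra.counitLeft_reassociator_inv : Q.counitLeft (H ⊗[k] H)
    ((Q.Φ⁻¹ : (H ⊗[k] (H ⊗[k] H))ˣ) : H ⊗[k] (H ⊗[k] H)) = 1 := by
  rw [← mul_one (Q.counitLeft (H ⊗[k] H) _), ← Q.counitLeft_reassociator, ← map_mul,
    Units.inv_mul, map_one, Q.counitLeft_reassociator]

lemma QuasiHopfAlgebra.counitLast_reassociator_inv : Q.counitLast
    ((Q.Φ⁻¹ : (H ⊗[k] (H ⊗[k] H))ˣ) : H ⊗[k] (H ⊗[k] H)) = 1 := by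
  rw [← mul_one (Q.counitLast _), ← Q.counitLast_reassociator, ← map_mul,
    Units.inv_mul, map_one, Q.counitLast_reassociator]

/-! ### Comparison of two antipodes over the same algebra map -/

variable (Q) in
/-- The element `σ'(x¹) α' ρ(x²) β σ(x³)` comparing two antipodes along `ρ`. -/
def comparison (ρ : H →ₐ[k] A) (σ : H →ₗ[k] A) (β : A) (σ' : H →ₗ[k] A) (α' : A) : A :=
  sw₃ σ' α' ρ.toLinearMap β σ ((Q.Φ⁻¹ : (H ⊗[k] (H ⊗[k] H))ˣ) : H ⊗[k] (H ⊗[k] H))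

/-- Φ⁻¹ intertwines the two iterated coproducts of h. The cup absorbs one and leaves h in the first
leg; the cap absorbs the other and leaves h in the last leg. Only the right axiom of σ and the left
axiom of σ' enter. -/
lemma comparison_comm (hσ : ∀ a b, σ (a * b) = σ b * σ a)
    (right : ∀ h, sw₂ ρ.toLinearMap β σ (Q.Δ h) = Q.counit h • β)
    (hσ' : ∀ a b, σ' (a * b) = σ' b * σ' a)
    (left' : ∀ h, sw₂ σ' α' ρ.toLinearMap (Q.Δ h) = Q.counit h • α') (h : H) :
    σ' h * comparison Q ρ σ β σ' α' = comparison Q ρ σ β σ' α' * σ h := by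
  have e : ((Q.Φ⁻¹ : (H ⊗[k] (H ⊗[k] H))ˣ) : H ⊗[k] (H ⊗[k] H)) * comulRight Q.Δ (Q.Δ h) =
      comulLeft Q.Δ (Q.Δ h) * ((Q.Φ⁻¹ : (H ⊗[k] (H ⊗[k] H))ˣ) : H ⊗[k] (H ⊗[k] H)) := by
    rw [Q.quasi_coassoc, mul_assoc, Units.inv_mul_cancel_left]
  have e' := congrArg (sw₃ σ' α' ρ.toLinearMap β σ) e
  rw [sw₃_absorb_cup₂₃ hσ right, sw₃_absorb_cap₁₂ hσ' left', Q.counitRight_comul,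
    Q.counitLeft_comul] at e'
  have e₁ : ∀ t, sw₃ σ' α' ρ.toLinearMap β σ (t * (h ⊗ₜ 1)) =
      σ' h * sw₃ σ' α' ρ.toLinearMap β σ t := by
    intro t
    induction t using tmul_induction with
    | tmul a s => simp [hσ', mul_assoc]
    | add x y hx hy => simp only [map_add, add_mul, mul_add, hx, hy]
  have e₂ : ∀ t, sw₃ σ' α' ρ.toLinearMap β σ ((1 ⊗ₜ (1 ⊗ₜ h)) * t) =
      sw₃ σ' α' ρ.toLinearMap β σ t * σ h := by
    intro t
    induction t using tmul₃_induction with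
    | tmul a b c => simp [hσ, mul_assoc]
    | add x y hx hy => simp only [map_add, add_mul, mul_add, hx, hy]
  rw [e₁, e₂] at e'
  exact e'

/-- The cocycle condition, rearranged as (Δ ⊗ id ⊗ id)(Φ)(Φ⁻¹ ⊗ 1) = (id ⊗ id ⊗ Δ)(Φ⁻¹)(1 ⊗ Φ)(id ⊗
Δ ⊗ id)(Φ), is evaluated in the pattern σ'α'ρβσαρ. Caps and the cup absorb every coproduct; what is
left is the comparison element times α on one side, and α' times the zigzag of σ on the other. -/
lemma comparison_mul (hA : AntipodeAlong Q ρ σ α β)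
    (hσ' : ∀ a b, σ' (a * b) = σ' b * σ' a)
    (left' : ∀ h, sw₂ σ' α' ρ.toLinearMap (Q.Δ h) = Q.counit h • α') :
    comparison Q ρ σ β σ' α' * α = α' := by
  -- Unitality of σ' is not assumed; the left axiom at h = 1 gives the part of it that is needed.
  have one' : σ' 1 * α' = α' := by
    simpa [Algebra.TensorProduct.one_def] using left' 1
  have hI : (1 : H) ⊗ₜ[k] ((1 : H) ⊗ₜ[k] (1 : H ⊗[k] H)) = 1 := rfl
  set K := sw₄ σ' α' ρ.toLinearMap β σ α ρ.toLinearMap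
  set J := Algebra.TensorProduct.map (AlgHom.id k H) (incl12 k H)
  set C := Algebra.TensorProduct.map (AlgHom.id k H) (comulRight Q.Δ)
  have e : Algebra.TensorProduct.assoc k k k H H (H ⊗[k] H)
        (Algebra.TensorProduct.map Q.Δ (AlgHom.id k (H ⊗[k] H))
          (Q.Φ : H ⊗[k] (H ⊗[k] H))) *
        J ((Q.Φ⁻¹ : (H ⊗[k] (H ⊗[k] H))ˣ) : H ⊗[k] (H ⊗[k] H)) =
      C ((Q.Φ⁻¹ : (H ⊗[k] (H ⊗[k] H))ˣ) : H ⊗[k] (H ⊗[k] H)) *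
        (Algebra.TensorProduct.includeRight (Q.Φ : H ⊗[k] (H ⊗[k] H)) *
          Algebra.TensorProduct.map (AlgHom.id k H) (comulLeft Q.Δ)
            (Q.Φ : H ⊗[k] (H ⊗[k] H))) := by
    have h1 : C ((Q.Φ⁻¹ : (H ⊗[k] (H ⊗[k] H))ˣ) : H ⊗[k] (H ⊗[k] H)) *
        C (Q.Φ : H ⊗[k] (H ⊗[k] H)) = 1 := by rw [← map_mul, Units.inv_mul, map_one]
    have h2 : J (Q.Φ : H ⊗[k] (H ⊗[k] H)) *
        J ((Q.Φ⁻¹ : (H ⊗[k] (H ⊗[k] H))ˣ) : H ⊗[k] (H ⊗[k] H)) = 1 := by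
      rw [← map_mul, Units.mul_inv, map_one]
    have h3 := congrArg (fun z => C ((Q.Φ⁻¹ : (H ⊗[k] (H ⊗[k] H))ˣ) : H ⊗[k] (H ⊗[k] H)) * z *
      J ((Q.Φ⁻¹ : (H ⊗[k] (H ⊗[k] H))ˣ) : H ⊗[k] (H ⊗[k] H))) Q.cocycle
    simp only [mul_assoc, J, C] at h1 h2 h3 ⊢
    rw [h2, mul_one] at h3
    rw [h3, ← mul_assoc, h1, one_mul]
  have e' := congrArg K e
  have hJ : ∀ t, K (J t) = sw₃ σ' α' ρ.toLinearMap β σ t * α := by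
    intro t
    induction t using tmul₃_induction with
    | tmul a b c => simp [K, J, incl12_tmul, mul_assoc]
    | add x y hx hy => simp only [map_add, add_mul, hx, hy]
  have hR : ∀ t, K (Algebra.TensorProduct.includeRight t) =
      σ' 1 * α' * sw₃ ρ.toLinearMap β σ α ρ.toLinearMap t := fun t => rfl
  simp only [K, C] at e'
  rw [sw₄_absorb_cap₁₂ hσ' left', sw₄_absorb_cap₃₄ hA.map_mul hA.left,
    Q.counitLeft_reassociator, Q.counitLast_reassociator_inv, _root_.map_one, one_mul,
    sw₄_absorb_cup₂₃ hA.map_mul hA.right, Q.counitMiddle_reassociator, _root_.map_one, mul_one,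
    hI, one_mul] at e'
  have e'' := (hJ _).symm.trans (e'.trans (hR _))
  rw [hA.zigzag, mul_one, one'] at e''
  exact e''

/-- The mirror argument, in the pattern ρβσαρβ'σ' and with the cocycle condition solved for (1 ⊗
Φ⁻¹)(id ⊗ id ⊗ Δ)(Φ). Now σ' contributes its cup, so its right axiom is the one required. -/
lemma mul_comparison (hA : AntipodeAlong Q ρ σ α β)
    (hσ' : ∀ a b, σ' (a * b) = σ' b * σ' a)
    (right' : ∀ h, sw₂ ρ.toLinearMap β' σ' (Q.Δ h) = Q.counit h • β') :
    β * comparison Q ρ σ' β' σ α = β' := by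
  have one' : β' * σ' 1 = β' := by
    simpa [Algebra.TensorProduct.one_def] using right' 1
  have hI : (1 : H) ⊗ₜ[k] ((1 : H) ⊗ₜ[k] (1 : H ⊗[k] H)) = 1 := rfl
  set K := sw₄ ρ.toLinearMap β σ α ρ.toLinearMap β' σ'
  set J := Algebra.TensorProduct.map (AlgHom.id k H) (incl12 k H)
  set D := (Algebra.TensorProduct.assoc k k k H H (H ⊗[k] H)).toAlgHom.comp
        (Algebra.TensorProduct.map Q.Δ (AlgHom.id k (H ⊗[k] H))) with hD
  set I : H ⊗[k] (H ⊗[k] H) →ₐ[k] H ⊗[k] (H ⊗[k] (H ⊗[k] H)) :=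
    Algebra.TensorProduct.includeRight
  have e : I ((Q.Φ⁻¹ : (H ⊗[k] (H ⊗[k] H))ˣ) : H ⊗[k] (H ⊗[k] H)) *
        Algebra.TensorProduct.map (AlgHom.id k H) (comulRight Q.Δ) (Q.Φ : H ⊗[k] (H ⊗[k] H)) =
      Algebra.TensorProduct.map (AlgHom.id k H) (comulLeft Q.Δ) (Q.Φ : H ⊗[k] (H ⊗[k] H)) *
        J (Q.Φ : H ⊗[k] (H ⊗[k] H)) *
        D ((Q.Φ⁻¹ : (H ⊗[k] (H ⊗[k] H))ˣ) : H ⊗[k] (H ⊗[k] H)) := by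
    have h1 : I ((Q.Φ⁻¹ : (H ⊗[k] (H ⊗[k] H))ˣ) : H ⊗[k] (H ⊗[k] H)) *
        I (Q.Φ : H ⊗[k] (H ⊗[k] H)) = 1 := by rw [← map_mul, Units.inv_mul, map_one]
    have h2 : D (Q.Φ : H ⊗[k] (H ⊗[k] H)) *
        D ((Q.Φ⁻¹ : (H ⊗[k] (H ⊗[k] H))ˣ) : H ⊗[k] (H ⊗[k] H)) = 1 := by
      rw [← map_mul, Units.mul_inv, map_one]
    have h3 : _ * D (Q.Φ : H ⊗[k] (H ⊗[k] H)) = _ := Q.cocycle.symm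
    have h4 := congrArg (fun z => I ((Q.Φ⁻¹ : (H ⊗[k] (H ⊗[k] H))ˣ) : H ⊗[k] (H ⊗[k] H)) * z *
      D ((Q.Φ⁻¹ : (H ⊗[k] (H ⊗[k] H))ˣ) : H ⊗[k] (H ⊗[k] H))) h3
    simp only [mul_assoc] at h4
    rw [h2, mul_one, ← mul_assoc (I _) (Algebra.TensorProduct.includeRight _), h1, one_mul] at h4
    rw [h4, mul_assoc]
  have e' := congrArg K e
  have hJ : ∀ t, K (J t) = sw₃ ρ.toLinearMap β σ α ρ.toLinearMap t * (β' * σ' 1) := by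
    intro t
    induction t using tmul₃_induction with
    | tmul a b c => simp [K, J, incl12_tmul, mul_assoc]
    | add x y hx hy => simp only [map_add, add_mul, hx, hy]
  have hR : ∀ t, K (I t) = β * sw₃ σ α ρ.toLinearMap β' σ' t := by
    intro t
    simp [K, I]
  simp only [K, hD, AlgHom.comp_apply, AlgEquiv.toAlgHom_apply] at e'
  rw [sw₄_absorb_cup₃₄ hσ' right', sw₄_absorb_cup₁₂ hA.map_mul hA.right,
    Q.counitLeft_reassociator_inv, Q.counitLast_reassociator, _root_.map_one, mul_one,
    hI, mul_one, sw₄_absorb_cap₂₃ hA.map_mul hA.left, Q.counitMiddle_reassociator,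
    _root_.map_one, one_mul] at e'
  have e'' := (hR _).symm.trans (e'.trans (hJ _))
  rw [hA.zigzag, one_mul, one'] at e''
  exact e''

namespace AntipodeAlong

lemma comparison_self (hA : AntipodeAlong Q ρ σ α β) : comparison Q ρ σ β σ α = 1 :=
  hA.zigzag_inv

lemma mul_sw₃ (c : A) (hc : ∀ h, σ' h * c = c * σ h) (x y : A) (f : H →ₗ[k] A)
    (g : H →ₗ[k] A) (t : H ⊗[k] (H ⊗[k] H)) :
    sw₃ σ' (c * x) f y g t = c * sw₃ σ x f y g t := by
  induction t using tmul_induction with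
  | tmul a s => simp only [sw₃_tmul, ← mul_assoc, hc]
  | add x y hx hy => simp only [_root_.map_add, mul_add, hx, hy]

/-- With g the first comparison element, α' = gα. In the self-comparison of σ', which is 1 by its
zigzag, g can therefore be pulled to the front, and the second comparison element remains. -/
lemma comparison_mul_comparison (hA : AntipodeAlong Q ρ σ α β)
    (hA' : AntipodeAlong Q ρ σ' α' β') :
    comparison Q ρ σ β σ' α' * comparison Q ρ σ' β' σ α = 1 := by
  rw [← hA'.comparison_self]
  nth_rw 3 [comparison]
  rw [← comparison_mul hA hA'.map_mul hA'.left]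
  rw [mul_sw₃ _ (comparison_comm hA.map_mul hA.right hA'.map_mul hA'.left), comparison,
    comparison_mul hA hA'.map_mul hA'.left]
  rfl

end AntipodeAlong

end AntipodeAlong

end

end QHopf

namespace QHopf

noncomputable section

/-! ### The Drinfeld element -/

namespace QTQuasiHopfAlgebra

open MulOpposite

variable {k : Type u} {H : Type w} [Field k] [Ring H] [Algebra k H] (Q : QTQuasiHopfAlgebra k H)

/-- The antipode as an algebra map `H → Hᵐᵒᵖ`. -/
def SOp : H →ₐ[k] Hᵐᵒᵖ :=
  AlgHom.ofLinearMap ((opLinearEquiv k).toLinearMap ∘ₗ Q.S) (by simp [Q.S_one])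
    (fun a b => by simp [Q.S_mul])

@[simp] lemma SOp_apply (h : H) : Q.SOp h = op (Q.S h) := rfl

/-- `a ⊗ b ↦ S(a) x b`. -/
abbrev cap (x : H) : H ⊗[k] H →ₗ[k] H := sw₂ Q.S x (AlgHom.id k H).toLinearMap

/-- `a ⊗ b ↦ a x S(b)`. -/
abbrev cup (x : H) : H ⊗[k] H →ₗ[k] H := sw₂ (AlgHom.id k H).toLinearMap x Q.S

lemma cap_mul (x : H) (s t : H ⊗[k] H) : Q.cap x (s * t) = Q.cap (Q.cap x s) t :=
  sw₂_mul_cap Q.S_mul x s t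

lemma cup_mul (x : H) (s t : H ⊗[k] H) : Q.cup x (s * t) = Q.cup (Q.cup x t) s :=
  sw₂_mul_cup Q.S_mul x s t

lemma cap_comul (h : H) : Q.cap Q.α (Q.Δ h) = Q.counit h • Q.α :=
  Q.antipodeAlong_id.left h

lemma cup_comul (h : H) : Q.cup Q.β (Q.Δ h) = Q.counit h • Q.β :=
  Q.antipodeAlong_id.right h

lemma cap_one (x : H) : Q.cap x 1 = x := by
  simp [cap, Algebra.TensorProduct.one_def, Q.S_one]

lemma cup_one (x : H) : Q.cup x 1 = x := by
  simp [cup, Algebra.TensorProduct.one_def, Q.S_one]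

/-- Apply S to each antipode axiom of H; the order reversal caused by S disappears in `Hᵐᵒᵖ`. -/
lemma antipodeAlong_SOp : AntipodeAlong Q.toQuasiHopfAlgebra Q.SOp
    ((opLinearEquiv k).toLinearMap ∘ₗ Q.S ∘ₗ Q.S) (op (Q.S Q.α)) (op (Q.S Q.β)) where
  map_mul a b := by simp [Q.S_mul]
  left h := by
    have e : ∀ t, sw₂ ((opLinearEquiv k).toLinearMap ∘ₗ Q.S ∘ₗ Q.S) (op (Q.S Q.α))
        Q.SOp.toLinearMap t = op (Q.S (Q.cap Q.α t)) := by
      intro t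
      induction t using tmul_induction with
      | tmul a b => simp [Q.S_mul, ← op_mul, mul_assoc]
      | add x y hx hy => simp only [_root_.map_add, hx, hy, MulOpposite.op_add]
    rw [e, cap_comul, map_smul, op_smul]
  right h := by
    have e : ∀ t, sw₂ Q.SOp.toLinearMap (op (Q.S Q.β))
        ((opLinearEquiv k).toLinearMap ∘ₗ Q.S ∘ₗ Q.S) t = op (Q.S (Q.cup Q.β t)) := by
      intro t
      induction t using tmul_induction with
      | tmul a b => simp [Q.S_mul, ← op_mul, mul_assoc]
      | add x y hx hy => simp only [_root_.map_add, hx, hy, MulOpposite.op_add]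
    rw [e, cup_comul, map_smul, op_smul]
  zigzag := by
    rw [← op_one, ← Q.S_one, ← Q.antipodeAlong_id.zigzag]
    generalize (Q.Φ : H ⊗[k] (H ⊗[k] H)) = t
    induction t using tmul₃_induction with
    | tmul a b c => simp [Q.S_mul, ← op_mul, mul_assoc]
    | add x y hx hy => simp only [_root_.map_add, hx, hy, MulOpposite.op_add]
  zigzag_inv := by
    rw [← op_one, ← Q.S_one, ← Q.antipodeAlong_id.zigzag_inv]
    generalize ((Q.Φ⁻¹ : (H ⊗[k] (H ⊗[k] H))ˣ) : H ⊗[k] (H ⊗[k] H)) = t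
    induction t using tmul₃_induction with
    | tmul a b c => simp [Q.S_mul, ← op_mul, mul_assoc]
    | add x y hx hy => simp only [_root_.map_add, hx, hy, MulOpposite.op_add]

/-- `S(R²) α R¹`. -/
def αR : H := Q.cap Q.α (flip2 k H (Q.R : H ⊗[k] H))

/-- `r² β S(r¹)`, where `R⁻¹ = r¹ ⊗ r²`. -/
def βR : H := Q.cup Q.β (flip2 k H ((Q.R⁻¹ : (H ⊗[k] H)ˣ) : H ⊗[k] H))

lemma comul_op_inv (h : H) : ((Q.R⁻¹ : (H ⊗[k] H)ˣ) : H ⊗[k] H) * flip2 k H (Q.Δ h) =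
    Q.Δ h * ((Q.R⁻¹ : (H ⊗[k] H)ˣ) : H ⊗[k] H) := by
  rw [Units.inv_mul_eq_iff_eq_mul, ← mul_assoc, ← Q.comul_op, mul_assoc, Units.mul_inv, mul_one]

/-- R exchanges Δ and Δᶜᵒᵖ, so a cap that has already taken up R₂₁ satisfies the antipode axiom for
the opposite coproduct. -/
lemma cap_αR_comul (h : H) : Q.cap Q.αR (flip2 k H (Q.Δ h)) = Q.counit h • Q.αR := by
  rw [αR, ← cap_mul, ← map_mul, ← Q.comul_op, map_mul, flip2_flip2, cap_mul, cap_comul]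
  exact sw₂_smul _ _ _ _ _

lemma cup_βR_comul (h : H) : Q.cup Q.βR (flip2 k H (Q.Δ h)) = Q.counit h • Q.βR := by
  rw [βR, ← cup_mul, ← map_mul, ← Q.comul_op_inv, map_mul, flip2_flip2, cup_mul, cup_comul]
  exact sw₂_smul _ _ _ _ _

lemma sw₃_cap_cup (x y : H) (r s : H ⊗[k] H) (t : H ⊗[k] (H ⊗[k] H)) :
    sw₃ Q.S (Q.cap x r) (AlgHom.id k H).toLinearMap (Q.cup y s) Q.S t =
      sw₃ Q.S x (AlgHom.id k H).toLinearMap y Q.S (incl12 k H r * t * incl23 k H s) := by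
  induction t using tmul₃_induction with
  | tmul a b c =>
    induction r using tmul_induction with
    | tmul d e =>
      induction s using tmul_induction with
      | tmul f g => simp [incl12_tmul, incl23_tmul, Q.S_mul, mul_assoc]
      | add x y hx hy =>
        simp only [map_add, mul_add, ← hx, ← hy]
        simp [mul_add, add_mul]
    | add x y hx hy =>
      simp only [map_add, add_mul, ← hx, ← hy]
      simp [mul_add, add_mul]
  | add x y hx hy => simp only [map_add, add_mul, mul_add, hx, hy]

lemma sw₃_cup_cap (x y : H) (r s : H ⊗[k] H) (t : H ⊗[k] (H ⊗[k] H)) :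
    sw₃ (AlgHom.id k H).toLinearMap (Q.cup y s) Q.S (Q.cap x r) (AlgHom.id k H).toLinearMap t =
      sw₃ (AlgHom.id k H).toLinearMap y Q.S x (AlgHom.id k H).toLinearMap
        (incl23 k H r * t * incl12 k H s) := by
  induction t using tmul₃_induction with
  | tmul a b c =>
    induction r using tmul_induction with
    | tmul d e =>
      induction s using tmul_induction with
      | tmul f g => simp [incl12_tmul, incl23_tmul, Q.S_mul, mul_assoc]
      | add x y hx hy =>
        simp only [map_add, mul_add, ← hx, ← hy]
        simp [mul_add, add_mul]
    | add x y hx hy =>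
      simp only [map_add, add_mul, ← hx, ← hy]
      simp [mul_add, add_mul]
  | add x y hx hy => simp only [map_add, add_mul, mul_add, hx, hy]

/-- The Yang-Baxter relation solved for the product that appears when an R-matrix sits in the cap
and its inverse in the cup of a zigzag. The other side contains coproducts on exactly the legs where
the cap and the cup can absorb them. -/
lemma yangBaxter_zigzag : incl12 k H ((Q.R⁻¹ : (H ⊗[k] H)ˣ) : H ⊗[k] H) *
    perm321 k H (Q.Φ : H ⊗[k] (H ⊗[k] H)) * incl23 k H (Q.R : H ⊗[k] H) =
    comulLeft Q.Δ (Q.R : H ⊗[k] H) *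
      (((Q.Φ⁻¹ : (H ⊗[k] (H ⊗[k] H))ˣ) : H ⊗[k] (H ⊗[k] H)) *
      comulRight Q.Δ ((Q.R⁻¹ : (H ⊗[k] H)ˣ) : H ⊗[k] H)) := by
  have h : Units.map (incl23 k H : _ →* _) Q.R * Units.map (comulRight Q.Δ : _ →* _) Q.R * Q.Φ =
      Units.map (perm321 k H : _ →* _) Q.Φ⁻¹ * Units.map (incl12 k H : _ →* _) Q.R *
        Units.map (comulLeft Q.Δ : _ →* _) Q.R := Units.ext Q.yangBaxter
  have h' : Units.map (incl12 k H : _ →* _) Q.R⁻¹ * Units.map (perm321 k H : _ →* _) Q.Φ *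
        Units.map (incl23 k H : _ →* _) Q.R =
      Units.map (comulLeft Q.Δ : _ →* _) Q.R *
        (Q.Φ⁻¹ * Units.map (comulRight Q.Δ : _ →* _) Q.R⁻¹) := by
    rw [map_inv, map_inv, ← mul_inv_rev, eq_mul_inv_iff_mul_eq, mul_assoc, ← mul_assoc _ _ Q.Φ, h]
    simp only [map_inv, mul_assoc, mul_inv_cancel_left, inv_mul_cancel_left]
  exact congrArg Units.val h'

lemma yangBaxter_zigzag_inv : incl23 k H ((Q.R⁻¹ : (H ⊗[k] H)ˣ) : H ⊗[k] H) *
    perm321 k H ((Q.Φ⁻¹ : (H ⊗[k] (H ⊗[k] H))ˣ) : H ⊗[k] (H ⊗[k] H)) *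
      incl12 k H (Q.R : H ⊗[k] H) =
    comulRight Q.Δ (Q.R : H ⊗[k] H) * ((Q.Φ : H ⊗[k] (H ⊗[k] H)) *
      comulLeft Q.Δ ((Q.R⁻¹ : (H ⊗[k] H)ˣ) : H ⊗[k] H)) := by
  have h : Units.map (incl23 k H : _ →* _) Q.R * Units.map (comulRight Q.Δ : _ →* _) Q.R * Q.Φ =
      Units.map (perm321 k H : _ →* _) Q.Φ⁻¹ * Units.map (incl12 k H : _ →* _) Q.R *
        Units.map (comulLeft Q.Δ : _ →* _) Q.R := Units.ext Q.yangBaxter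
  have h' : Units.map (incl23 k H : _ →* _) Q.R⁻¹ * Units.map (perm321 k H : _ →* _) Q.Φ⁻¹ *
        Units.map (incl12 k H : _ →* _) Q.R =
      Units.map (comulRight Q.Δ : _ →* _) Q.R *
        (Q.Φ * Units.map (comulLeft Q.Δ : _ →* _) Q.R⁻¹) := by
    rw [map_inv _ Q.R, map_inv _ Q.R, mul_assoc, inv_mul_eq_iff_eq_mul, ← mul_assoc, ← mul_assoc,
      eq_mul_inv_iff_mul_eq, h]
  exact congrArg Units.val h'

/-- The identity of H is an antipode over S : H → Hᵐᵒᵖ, with R providing its α and β. The zigzag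
axioms use the Yang-Baxter relation of the reversed structure, because R₂₁ is what enters `αR`. -/
lemma antipodeAlong_SOp_R : AntipodeAlong Q.toQuasiHopfAlgebra Q.SOp
    (opLinearEquiv k).toLinearMap (op Q.αR) (op Q.βR) where
  map_mul a b := by simp
  left h := by
    have e : ∀ t, sw₂ (opLinearEquiv k).toLinearMap (op Q.αR)
        Q.SOp.toLinearMap t = op (Q.cap Q.αR (flip2 k H t)) := by
      intro t
      induction t using tmul_induction with
      | tmul a b => simp [flip2_tmul, ← op_mul, mul_assoc]
      | add x y hx hy => simp only [_root_.map_add, hx, hy, MulOpposite.op_add]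
    rw [e, cap_αR_comul, op_smul]
  right h := by
    have e : ∀ t, sw₂ Q.SOp.toLinearMap (op Q.βR)
        (opLinearEquiv k).toLinearMap t = op (Q.cup Q.βR (flip2 k H t)) := by
      intro t
      induction t using tmul_induction with
      | tmul a b => simp [flip2_tmul, ← op_mul, mul_assoc]
      | add x y hx hy => simp only [_root_.map_add, hx, hy, MulOpposite.op_add]
    rw [e, cup_βR_comul, op_smul]
  zigzag := by
    have e : ∀ t, sw₃ Q.SOp.toLinearMap (op Q.βR) (opLinearEquiv k).toLinearMap (op Q.αR)
        Q.SOp.toLinearMap t = op (sw₃ Q.S Q.αR (AlgHom.id k H).toLinearMap Q.βR Q.S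
          (perm321 k H t)) := by
      intro t
      induction t using tmul₃_induction with
      | tmul a b c => simp [perm321_tmul, ← op_mul, mul_assoc]
      | add x y hx hy => simp only [_root_.map_add, hx, hy, MulOpposite.op_add]
    rw [e, αR, βR, sw₃_cap_cup]
    have h := Q.reverse.yangBaxter_zigzag
    rw [reverse_R_inv, reverse_R] at h
    change incl12 k H _ * perm321 k H (Q.Φ : H ⊗[k] (H ⊗[k] H)) * _ = comulLeft Q.Δ _ *
      (((Q.Φ⁻¹ : (H ⊗[k] (H ⊗[k] H))ˣ) : H ⊗[k] (H ⊗[k] H)) * comulRight Q.Δ _) at h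
    have hI : (1 : H) ⊗ₜ[k] ((1 : H) ⊗ₜ[k] (1 : H)) = 1 := rfl
    have hI' : (1 : H) ⊗ₜ[k] (1 : H ⊗[k] H) = 1 := rfl
    -- Both coproducts are absorbed and their counits are 1, so only the original zigzag on Φ⁻¹
    -- survives.
    rw [h, sw₃_absorb_cap₁₂ Q.S_mul Q.antipodeAlong_id.left, counitLeft_flip2, counitRight_R_inv,
      hI, one_mul, sw₃_absorb_cup₂₃ Q.S_mul Q.antipodeAlong_id.right, ← counitLeft_flip2,
      flip2_flip2, counitLeft_R, hI', mul_one, Q.antipodeAlong_id.zigzag_inv, op_one]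
  zigzag_inv := by
    have e : ∀ t, sw₃ (opLinearEquiv k).toLinearMap (op Q.αR) Q.SOp.toLinearMap (op Q.βR)
        (opLinearEquiv k).toLinearMap t = op (sw₃ (AlgHom.id k H).toLinearMap Q.βR Q.S Q.αR
          (AlgHom.id k H).toLinearMap (perm321 k H t)) := by
      intro t
      induction t using tmul₃_induction with
      | tmul a b c => simp [perm321_tmul, ← op_mul, mul_assoc]
      | add x y hx hy => simp only [_root_.map_add, hx, hy, MulOpposite.op_add]
    rw [e, αR, βR, sw₃_cup_cap]
    have h := Q.reverse.yangBaxter_zigzag_inv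
    rw [reverse_R_inv, reverse_R] at h
    change incl23 k H _ * perm321 k H ((Q.Φ⁻¹ : (H ⊗[k] (H ⊗[k] H))ˣ) : H ⊗[k] (H ⊗[k] H)) * _ =
      comulRight Q.Δ _ * ((Q.Φ : H ⊗[k] (H ⊗[k] H)) * comulLeft Q.Δ _) at h
    have hI : (1 : H) ⊗ₜ[k] ((1 : H) ⊗ₜ[k] (1 : H)) = 1 := rfl
    have hI' : (1 : H) ⊗ₜ[k] (1 : H ⊗[k] H) = 1 := rfl
    rw [h, sw₃_absorb_cap₂₃ Q.S_mul Q.antipodeAlong_id.left, ← counitLeft_flip2,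
      flip2_flip2, counitLeft_R_inv, hI', one_mul,
      sw₃_absorb_cup₁₂ Q.S_mul Q.antipodeAlong_id.right, counitLeft_flip2, counitRight_R, hI,
      mul_one, Q.antipodeAlong_id.zigzag, op_one]

/-- Taking R out of the cap and placing it on the first two legs of Φ⁻¹ turns this comparison
element into the defining expression of u. -/
lemma comparison_eq_op_u : comparison Q.toQuasiHopfAlgebra Q.SOp
    ((opLinearEquiv k).toLinearMap ∘ₗ Q.S ∘ₗ Q.S) (op (Q.S Q.β)) (opLinearEquiv k).toLinearMap
      (op Q.αR) = op Q.u := by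
  have e : ∀ (r : H ⊗[k] H) (t : H ⊗[k] (H ⊗[k] H)),
      sw₃ (opLinearEquiv k).toLinearMap (op (Q.cap Q.α (flip2 k H r))) Q.SOp.toLinearMap
        (op (Q.S Q.β)) ((opLinearEquiv k).toLinearMap ∘ₗ Q.S ∘ₗ Q.S) t =
      op (Q.uMap (incl12 k H r * t)) := by
    intro r t
    induction t using tmul₃_induction with
    | tmul a b c =>
      induction r using tmul_induction with
      | tmul d e =>
        simp [uMap, flip2_tmul, incl12_tmul, mulMap, ← op_mul, Q.S_mul, mul_assoc]
      | add x y hx hy =>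
        simp only [map_add, add_mul, MulOpposite.op_add, ← hx, ← hy]
        simp [mul_add, add_mul]
    | add x y hx hy => simp only [map_add, mul_add, hx, hy, MulOpposite.op_add]
  exact e _ _

/-- This and the next three facts are the general comparison statements for the two antipodes over
S, read in `Hᵐᵒᵖ`. -/
lemma S_S_mul_u (h : H) : Q.S (Q.S h) * Q.u = Q.u * h := by
  have := comparison_comm Q.antipodeAlong_SOp.map_mul Q.antipodeAlong_SOp.right
    Q.antipodeAlong_SOp_R.map_mul Q.antipodeAlong_SOp_R.left h
  rw [comparison_eq_op_u] at this
  exact (op_injective this).symm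

lemma S_α_mul_u : Q.S Q.α * Q.u = Q.αR := by
  have := comparison_mul Q.antipodeAlong_SOp
    Q.antipodeAlong_SOp_R.map_mul Q.antipodeAlong_SOp_R.left
  rw [comparison_eq_op_u] at this
  exact op_injective this

lemma u_mul_βR : Q.u * Q.βR = Q.S Q.β := by
  -- The comparison element that occurs here runs in the opposite direction, so it is the inverse of
  -- `op u` and has to be moved to the other side.
  have h1 := mul_comparison Q.antipodeAlong_SOp
    Q.antipodeAlong_SOp_R.map_mul Q.antipodeAlong_SOp_R.right
  have h2 := Q.antipodeAlong_SOp_R.comparison_mul_comparison Q.antipodeAlong_SOp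
  rw [comparison_eq_op_u] at h2
  have h3 : op Q.βR * op Q.u = op (Q.S Q.β) := by
    rw [← h1, mul_assoc, h2, mul_one]
  exact op_injective h3

lemma isUnit_u : IsUnit Q.u := by
  have h1 := Q.antipodeAlong_SOp.comparison_mul_comparison Q.antipodeAlong_SOp_R
  have h2 := Q.antipodeAlong_SOp_R.comparison_mul_comparison Q.antipodeAlong_SOp
  rw [comparison_eq_op_u] at h1 h2
  have h : IsUnit (op Q.u) := ⟨⟨_, _, h1, h2⟩, rfl⟩
  exact (isUnit_op).1 h

/-! ### The central element `u S(u)` -/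

/-- Stated for any v that implements S², because it is applied both to u and to the Drinfeld element
of the reversed structure. -/
lemma S_cap_flip2 {v : H} (hv : ∀ h, Q.S (Q.S h) * v = v * h) (t : H ⊗[k] H) :
    Q.cap (Q.S Q.α * v) t = Q.S (Q.cap Q.α (flip2 k H t)) * v := by
  induction t using tmul_induction with
  | tmul a b => simp [flip2_tmul, Q.S_mul, mul_assoc, hv]
  | add x y hx hy => simp only [map_add, add_mul, hx, hy]

/-- `S(u)` is inverse to the Drinfeld element of the reversed structure. -/
lemma S_u_mul_u_reverse : Q.S Q.u * Q.reverse.u = 1 := by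
  have hv : ∀ h, Q.S (Q.S h) * Q.reverse.u = Q.reverse.u * h := Q.reverse.S_S_mul_u
  have hα : Q.S Q.α * Q.reverse.u = Q.cap Q.α ((Q.R⁻¹ : (H ⊗[k] H)ˣ) : H ⊗[k] H) := by
    refine Q.reverse.S_α_mul_u.trans ?_
    rw [αR, reverse_R, flip2_flip2]
    rfl
  -- This is the cap of R⁻¹R = 1: capping with R⁻¹ gives S(α) times the reversed u, and capping that
  -- with R produces the factor S(u).
  have hw : Q.S Q.u * Q.reverse.u * Q.α = Q.α := by
    have h1 : Q.cap Q.α (((Q.R⁻¹ : (H ⊗[k] H)ˣ) : H ⊗[k] H) * (Q.R : H ⊗[k] H)) = Q.α := by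
      rw [Units.inv_mul, cap_one]
    rw [cap_mul, ← hα, Q.S_cap_flip2 hv, ← αR, ← S_α_mul_u, Q.S_mul, mul_assoc, hv,
      ← mul_assoc] at h1
    exact h1
  have hc : ∀ h, Q.S h * (Q.S Q.u * Q.reverse.u) = Q.S Q.u * Q.reverse.u * Q.S h := by
    intro h
    rw [← mul_assoc, ← Q.S_mul, ← S_S_mul_u, Q.S_mul, mul_assoc, hv, mul_assoc]
  -- An element that fixes α and commutes with S(H) can be carried into the zigzag S(x¹)αx²βS(x³) =
  -- 1, which forces it to be 1; α itself need not be cancellable.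
  have h := AntipodeAlong.mul_sw₃ _ hc Q.α Q.β (AlgHom.id k H).toLinearMap Q.S
    ((Q.Φ⁻¹ : (H ⊗[k] (H ⊗[k] H))ˣ) : H ⊗[k] (H ⊗[k] H))
  rw [hw, Q.antipodeAlong_id.zigzag_inv, mul_one] at h
  exact h.symm

lemma u_reverse_mul_S_u : Q.reverse.u * Q.S Q.u = 1 := by
  obtain ⟨v, hv⟩ := Q.reverse.isUnit_u
  have h := Q.S_u_mul_u_reverse
  rw [← hv] at h ⊢
  have h' : Q.S Q.u = ((v⁻¹ : Hˣ) : H) := Units.eq_inv_of_mul_eq_one_right h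
  rw [h', Units.mul_inv]

lemma S_u_mul_S_S (h : H) : Q.S Q.u * Q.S (Q.S h) = h * Q.S Q.u := by
  have hv : Q.S (Q.S h) * Q.reverse.u = Q.reverse.u * h := Q.reverse.S_S_mul_u h
  have h1 := congrArg (fun z => Q.S Q.u * z * Q.S Q.u) hv
  simpa only [mul_assoc, u_reverse_mul_S_u, mul_one, ← mul_assoc (Q.S Q.u) Q.reverse.u,
    S_u_mul_u_reverse, one_mul] using h1

lemma S_S_u : Q.S (Q.S Q.u) = Q.u :=
  Q.isUnit_u.mul_right_cancel (Q.S_S_mul_u Q.u)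

lemma u_mul_S_u : Q.u * Q.S Q.u = Q.S Q.u * Q.u := by
  rw [← S_S_mul_u, S_S_u]

/-- `u S(u)` is central. -/
lemma uSu_central (h : H) : Q.u * Q.S Q.u * h = h * (Q.u * Q.S Q.u) := by
  rw [u_mul_S_u, mul_assoc, ← S_S_mul_u, ← mul_assoc, S_u_mul_S_S, mul_assoc]

lemma S_uSu : Q.S (Q.u * Q.S Q.u) = Q.u * Q.S Q.u := by
  rw [Q.S_mul, S_S_u]

lemma isUnit_uSu : IsUnit (Q.u * Q.S Q.u) :=
  Q.isUnit_u.mul ⟨⟨_, _, Q.S_u_mul_u_reverse, Q.u_reverse_mul_S_u⟩, rfl⟩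

lemma monodromy_val : (Q.monodromy : H ⊗[k] H) =
    flip2 k H (Q.R : H ⊗[k] H) * (Q.R : H ⊗[k] H) := rfl

/-- `S(m¹) α m² = u S(u) α`, where `m = R₂₁ R`. -/
lemma cap_monodromy : Q.cap Q.α (Q.monodromy : H ⊗[k] H) = Q.u * Q.S Q.u * Q.α := by
  rw [monodromy_val, cap_mul, ← αR, ← S_α_mul_u, Q.S_cap_flip2 Q.S_S_mul_u, ← αR, ← S_α_mul_u,
    Q.S_mul, mul_assoc, S_S_mul_u, ← mul_assoc, u_mul_S_u]

/-- `m¹ β S(m²) = u S(u) β`, where `m = R₂₁ R`. -/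
lemma cup_monodromy : Q.cup Q.β (Q.monodromy : H ⊗[k] H) = Q.u * Q.S Q.u * Q.β := by
  -- `u_mul_βR` for the reversed structure, whose `βR` is the cup of R; S(u) inverts the reversed u.
  have hβ : Q.cup Q.β (Q.R : H ⊗[k] H) = Q.S Q.u * Q.S Q.β := by
    have h : Q.reverse.u * Q.cup Q.β (Q.R : H ⊗[k] H) = Q.S Q.β := by
      have := Q.reverse.u_mul_βR
      rw [βR, reverse_R_inv, flip2_flip2] at this
      exact this
    rw [← h, ← mul_assoc, S_u_mul_u_reverse, one_mul]
  have e : ∀ t, Q.cup (Q.S Q.u * Q.S Q.β) (flip2 k H t) = Q.S Q.u * Q.S (Q.cup Q.β t) := by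
    intro t
    induction t using tmul_induction with
    | tmul a b =>
      simp only [flip2_tmul, sw₂_tmul, Q.S_mul, AlgHom.toLinearMap_apply, AlgHom.id_apply,
        ← mul_assoc, S_u_mul_S_S]
    | add x y hx hy => simp only [map_add, mul_add, hx, hy]
  rw [monodromy_val, cup_mul, hβ, e, hβ, Q.S_mul, ← mul_assoc, S_u_mul_S_S, S_S_u, mul_assoc,
    ← u_mul_S_u, ← uSu_central]

lemma cap_mul_left_of_central {c : H} (hc : ∀ h, c * h = h * c) (x : H) (t : H ⊗[k] H) :
    Q.cap (c * x) t = c * Q.cap x t := by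
  induction t using tmul_induction with
  | tmul a b => simp only [sw₂_tmul]; rw [← mul_assoc _ c x, ← hc, mul_assoc c, mul_assoc c]
  | add x y hx hy => simp only [map_add, mul_add, hx, hy]

lemma cup_mul_left_of_central {c : H} (hc : ∀ h, c * h = h * c) (x : H) (t : H ⊗[k] H) :
    Q.cup (c * x) t = c * Q.cup x t := by
  induction t using tmul_induction with
  | tmul a b => simp only [sw₂_tmul]; rw [← mul_assoc _ c x, ← hc, mul_assoc c, mul_assoc c]
  | add x y hx hy => simp only [map_add, mul_add, hx, hy]

/-- These inverse forms are what the antipode axioms of H(θ) demand at θ, where θ² stands for u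
S(u). -/
lemma uSu_mul_cap_monodromy_inv : Q.u * Q.S Q.u *
    Q.cap Q.α ((Q.monodromy⁻¹ : (H ⊗[k] H)ˣ) : H ⊗[k] H) = Q.α := by
  rw [← Q.cap_mul_left_of_central Q.uSu_central, ← cap_monodromy, ← cap_mul, Units.mul_inv,
    cap_one]

lemma uSu_mul_cup_monodromy_inv : Q.u * Q.S Q.u *
    Q.cup Q.β ((Q.monodromy⁻¹ : (H ⊗[k] H)ˣ) : H ⊗[k] H) = Q.β := by
  rw [← Q.cup_mul_left_of_central Q.uSu_central, ← cup_monodromy, ← cup_mul, Units.inv_mul,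
    cup_one]

/-! ### Counits of the monodromy and of `u S(u)` -/

lemma counitLeft_monodromy : Q.counitLeft H (Q.monodromy : H ⊗[k] H) = 1 := by
  rw [monodromy_val, map_mul, counitLeft_flip2, counitRight_R, counitLeft_R, one_mul]

lemma counitRight_monodromy : Q.counitRight H (Q.monodromy : H ⊗[k] H) = 1 := by
  rw [monodromy_val, map_mul, ← counitLeft_flip2, flip2_flip2, counitRight_R, counitLeft_R,
    one_mul]

lemma counitLeft_monodromy_inv :
    Q.counitLeft H ((Q.monodromy⁻¹ : (H ⊗[k] H)ˣ) : H ⊗[k] H) = 1 := by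
  rw [← mul_one (Q.counitLeft H _), ← Q.counitLeft_monodromy, ← map_mul, Units.inv_mul, map_one,
    counitLeft_monodromy]

lemma counitRight_monodromy_inv :
    Q.counitRight H ((Q.monodromy⁻¹ : (H ⊗[k] H)ˣ) : H ⊗[k] H) = 1 := by
  rw [← mul_one (Q.counitRight H _), ← Q.counitRight_monodromy, ← map_mul, Units.inv_mul, map_one,
    counitRight_monodromy]

lemma counit_cap (x : H) (t : H ⊗[k] H) : Q.counit (Q.cap x t) =
    Q.counit (Q.S (Q.counitRight H t)) * Q.counit x := by
  induction t using tmul_induction with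
  | tmul a b => simp; ring
  | add x y hx hy => simp only [map_add, hx, hy, add_mul]

/-- The counit of the left antipode axiom gives ε ∘ S = ε only up to the factor ε(α); the zigzag
then shows that this scalar is invertible. -/
lemma counit_S_mul_counit_α (h : H) :
    Q.counit (Q.S h) * Q.counit Q.α = Q.counit h * Q.counit Q.α := by
  have h1 := Q.counit_cap Q.α (Q.Δ h)
  rw [cap_comul, Q.counitRight_comul, map_smul, smul_eq_mul] at h1
  exact h1.symm

lemma counit_β_mul_counit_α : Q.counit Q.β * Q.counit Q.α = 1 := by
  have hS := Q.counit_S_mul_counit_α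
  have h := congrArg Q.counit Q.antipodeAlong_id.zigzag
  have e : ∀ t, Q.counit (sw₃ (AlgHom.id k H).toLinearMap Q.β Q.S Q.α
      (AlgHom.id k H).toLinearMap t) = Q.counit Q.β * Q.counit Q.α *
        Q.counit (Q.counitLeft H (Q.counitMiddle t)) := by
    intro t
    induction t using tmul₃_induction with
    | tmul a b c =>
      have h1 : Q.counit (Q.S b * Q.α) = Q.counit (b * Q.α) := by
        rw [map_mul, hS, map_mul]
      simp [mul_assoc]
      linear_combination Q.counit a * Q.counit Q.β * Q.counit c * hS b
    | add x y hx hy => simp only [map_add, hx, hy, mul_add]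
  rw [e, Q.counitMiddle_reassociator] at h
  simpa using h

/-- Apply ε to S(m¹)αm² = u S(u)α, where countiting the second leg of m gives 1, and cancel the
nonzero scalar ε(α). -/
lemma counit_uSu : Q.counit (Q.u * Q.S Q.u) = 1 := by
  have h0 : Q.counit Q.α ≠ 0 := right_ne_zero_of_mul_eq_one Q.counit_β_mul_counit_α
  have h := Q.counit_cap Q.α (Q.monodromy : H ⊗[k] H)
  rw [cap_monodromy, counitRight_monodromy, Q.S_one, map_one, map_mul] at h
  exact mul_right_cancel₀ h0 h

end QTQuasiHopfAlgebra

end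

end QHopf

namespace QHopf

noncomputable section

/-! ### The monodromy -/

namespace QTQuasiHopfAlgebra

variable {k : Type u} {H : Type w} [Field k] [Ring H] [Algebra k H] (Q : QTQuasiHopfAlgebra k H)

lemma flip2_R_mul_flip2_comul (h : H) : flip2 k H (Q.R : H ⊗[k] H) * flip2 k H (Q.Δ h) =
    Q.Δ h * flip2 k H (Q.R : H ⊗[k] H) := by
  rw [← map_mul, ← Q.comul_op, map_mul, flip2_flip2]

lemma monodromy_mul_comul (h : H) : (Q.monodromy : H ⊗[k] H) * Q.Δ h =
    Q.Δ h * (Q.monodromy : H ⊗[k] H) := by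
  rw [monodromy_val, mul_assoc, ← Q.comul_op, ← mul_assoc, flip2_R_mul_flip2_comul, mul_assoc]

lemma monodromy_inv_mul_comul (h : H) :
    ((Q.monodromy⁻¹ : (H ⊗[k] H)ˣ) : H ⊗[k] H) * Q.Δ h =
      Q.Δ h * ((Q.monodromy⁻¹ : (H ⊗[k] H)ˣ) : H ⊗[k] H) := by
  rw [Units.inv_mul_eq_iff_eq_mul, ← mul_assoc, monodromy_mul_comul, mul_assoc, Units.mul_inv,
    mul_one]

lemma incl23_mul_comulRight (t : H ⊗[k] H) :
    incl23 k H (Q.R : H ⊗[k] H) * comulRight Q.Δ t =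
      perm132 k H (comulRight Q.Δ t) * incl23 k H (Q.R : H ⊗[k] H) := by
  induction t using tmul_induction with
  | tmul a b =>
    change ((1 : H) ⊗ₜ[k] (Q.R : H ⊗[k] H)) * (a ⊗ₜ[k] Q.Δ b) =
      (a ⊗ₜ[k] flip2 k H (Q.Δ b)) * ((1 : H) ⊗ₜ[k] (Q.R : H ⊗[k] H))
    rw [Algebra.TensorProduct.tmul_mul_tmul, Algebra.TensorProduct.tmul_mul_tmul, Q.comul_op,
      one_mul, mul_one]
  | add x y hx hy => simp only [map_add, mul_add, add_mul, hx, hy]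

/-- An element that commutes with all `Δ(h)` commutes, placed in the last two factors, with
`(id ⊗ Δ)(t)`. -/
lemma incl23_mul_comulRight_of_comm {c : H ⊗[k] H} (hc : ∀ h, c * Q.Δ h = Q.Δ h * c)
    (t : H ⊗[k] H) :
    incl23 k H c * comulRight Q.Δ t = comulRight Q.Δ t * incl23 k H c := by
  induction t using tmul_induction with
  | tmul a b =>
    change ((1 : H) ⊗ₜ[k] c) * (a ⊗ₜ[k] Q.Δ b) = (a ⊗ₜ[k] Q.Δ b) * ((1 : H) ⊗ₜ[k] c)
    rw [Algebra.TensorProduct.tmul_mul_tmul, Algebra.TensorProduct.tmul_mul_tmul, hc,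
      one_mul, mul_one]
  | add x y hx hy => simp only [map_add, mul_add, add_mul, hx, hy]

lemma incl12_mul_comulLeft_of_comm {c : H ⊗[k] H} (hc : ∀ h, c * Q.Δ h = Q.Δ h * c)
    (t : H ⊗[k] H) :
    incl12 k H c * comulLeft Q.Δ t = comulLeft Q.Δ t * incl12 k H c := by
  induction t using tmul_induction with
  | tmul a b =>
    have h1 : incl12 k H c = Algebra.TensorProduct.assoc k k k H H H (c ⊗ₜ 1) := by
      refine Eq.trans ?_ (assoc_tmul_eq_incl12 c (1 : H)).symm
      exact (mul_one _).symm
    have h2 : comulLeft Q.Δ (a ⊗ₜ b) = Algebra.TensorProduct.assoc k k k H H H (Q.Δ a ⊗ₜ b) := rfl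
    rw [h1, h2, ← map_mul, ← map_mul, Algebra.TensorProduct.tmul_mul_tmul,
      Algebra.TensorProduct.tmul_mul_tmul, hc, one_mul, mul_one]
  | add x y hx hy => simp only [map_add, mul_add, add_mul, hx, hy]

/-- The Yang-Baxter relation with its outer legs exchanged is a relation for R₂₁. Together with the
original it treats both halves of m = R₂₁R. -/
lemma perm321_yangBaxter : incl12 k H (flip2 k H (Q.R : H ⊗[k] H)) *
      perm213 k H (comulLeft Q.Δ (flip2 k H (Q.R : H ⊗[k] H))) *
        perm321 k H (Q.Φ : H ⊗[k] (H ⊗[k] H)) =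
    ((Q.Φ⁻¹ : (H ⊗[k] (H ⊗[k] H))ˣ) : H ⊗[k] (H ⊗[k] H)) *
      incl23 k H (flip2 k H (Q.R : H ⊗[k] H)) *
        perm132 k H (comulRight Q.Δ (flip2 k H (Q.R : H ⊗[k] H))) := by
  have h := congrArg (perm321 k H) Q.yangBaxter
  have h1 : ∀ t : H ⊗[k] H, perm321 k H (incl23 k H t) = incl12 k H (flip2 k H t) := by
    intro t
    induction t using tmul_induction with
    | tmul a b => rfl
    | add x y hx hy => simp only [map_add, hx, hy]
  have h2 : ∀ t : H ⊗[k] H, perm321 k H (incl12 k H t) = incl23 k H (flip2 k H t) := by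
    intro t
    induction t using tmul_induction with
    | tmul a b => rfl
    | add x y hx hy => simp only [map_add, hx, hy]
  have h3 : ∀ t, perm321 k H (perm321 k H t) = t := by
    intro t
    induction t using tmul₃_induction with
    | tmul a b c => rfl
    | add x y hx hy => simp only [map_add, hx, hy]
  have h4 : ∀ t, perm321 k H (comulRight Q.Δ t) =
      perm213 k H (comulLeft Q.Δ (flip2 k H t)) := by
    intro t
    rw [comulLeft_flip2]
    rfl
  have h5 : ∀ t, perm321 k H (comulLeft Q.Δ t) =
      perm132 k H (comulRight Q.Δ (flip2 k H t)) := by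
    intro t
    rw [comulRight_flip2, ← perm312_perm213]
    induction t using tmul_induction with
    | tmul a b =>
      rw [QuasiHopfAlgebra.comulLeft_tmul]
      generalize Q.Δ a = s
      induction s using tmul_induction with
      | tmul c d => rfl
      | add x y hx hy => simp only [map_add, TensorProduct.add_tmul, hx, hy]
    | add x y hx hy => simp only [map_add, hx, hy]
  rwa [map_mul, map_mul, map_mul, map_mul, h1, h2, h3, h4, h5] at h

/-- `Φ m₁₂ (Δ ⊗ id)(m) = m₂₃ (id ⊗ Δ)(m) Φ`, where `m = R₂₁ R`. -/
lemma monodromy_assoc : (Q.Φ : H ⊗[k] (H ⊗[k] H)) * incl12 k H (Q.monodromy : H ⊗[k] H) *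
      comulLeft Q.Δ (Q.monodromy : H ⊗[k] H) =
    incl23 k H (Q.monodromy : H ⊗[k] H) * comulRight Q.Δ (Q.monodromy : H ⊗[k] H) *
      (Q.Φ : H ⊗[k] (H ⊗[k] H)) := by
  have hy : incl12 k H (Q.R : H ⊗[k] H) * comulLeft Q.Δ (Q.R : H ⊗[k] H) =
      perm321 k H (Q.Φ : H ⊗[k] (H ⊗[k] H)) * (incl23 k H (Q.R : H ⊗[k] H) *
        comulRight Q.Δ (Q.R : H ⊗[k] H) * (Q.Φ : H ⊗[k] (H ⊗[k] H))) := by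
    rw [yangBaxter, mul_assoc _ (incl12 k H _), ← mul_assoc (perm321 k H _), ← map_mul,
      Units.mul_inv, map_one, one_mul]
  -- R₁₂ slides past `(Δ ⊗ id)(R₂₁)`, the Yang-Baxter relation is used once for R and once for R₂₁,
  -- and R₂₃ slides back past `(id ⊗ Δ)(R₂₁)`.
  calc _ = (Q.Φ : H ⊗[k] (H ⊗[k] H)) * (incl12 k H (flip2 k H (Q.R : H ⊗[k] H)) *
        (incl12 k H (Q.R : H ⊗[k] H) * comulLeft Q.Δ (flip2 k H (Q.R : H ⊗[k] H))) *
          comulLeft Q.Δ (Q.R : H ⊗[k] H)) := by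
        rw [monodromy_val, map_mul, map_mul]; simp only [mul_assoc]
    _ = (Q.Φ : H ⊗[k] (H ⊗[k] H)) * ((incl12 k H (flip2 k H (Q.R : H ⊗[k] H)) *
          perm213 k H (comulLeft Q.Δ (flip2 k H (Q.R : H ⊗[k] H))) *
        perm321 k H (Q.Φ : H ⊗[k] (H ⊗[k] H))) * (incl23 k H (Q.R : H ⊗[k] H) *
        comulRight Q.Δ (Q.R : H ⊗[k] H) * (Q.Φ : H ⊗[k] (H ⊗[k] H)))) := by
        rw [incl12_mul_comulLeft, mul_assoc, mul_assoc, hy]; simp only [mul_assoc]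
    _ = incl23 k H (flip2 k H (Q.R : H ⊗[k] H)) *
        (perm132 k H (comulRight Q.Δ (flip2 k H (Q.R : H ⊗[k] H))) *
          incl23 k H (Q.R : H ⊗[k] H)) *
        comulRight Q.Δ (Q.R : H ⊗[k] H) * (Q.Φ : H ⊗[k] (H ⊗[k] H)) := by
        rw [perm321_yangBaxter]; simp only [mul_assoc, Units.mul_inv_cancel_left]
    _ = _ := by
        rw [← incl23_mul_comulRight, monodromy_val, map_mul, map_mul]; simp only [mul_assoc]

end QTQuasiHopfAlgebra

end

end QHopf

namespace QHopf

noncomputable section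

/-! ### Nested evaluations -/

namespace QuasiHopfAlgebra

variable {k : Type u} {H : Type w} [Field k] [Ring H] [Algebra k H] (Q : QuasiHopfAlgebra k H)

/-- `Δ ⊗ id ⊗ id`. -/
def comul₁ : H ⊗[k] (H ⊗[k] H) →ₐ[k] H ⊗[k] (H ⊗[k] (H ⊗[k] H)) :=
  (Algebra.TensorProduct.assoc k k k H H (H ⊗[k] H)).toAlgHom.comp
    (Algebra.TensorProduct.map Q.Δ (AlgHom.id k (H ⊗[k] H)))

/-- `id ⊗ Δ ⊗ id`. -/
def comul₂ : H ⊗[k] (H ⊗[k] H) →ₐ[k] H ⊗[k] (H ⊗[k] (H ⊗[k] H)) :=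
  Algebra.TensorProduct.map (AlgHom.id k H) (comulLeft Q.Δ)

/-- `id ⊗ id ⊗ Δ`. -/
def comul₃ : H ⊗[k] (H ⊗[k] H) →ₐ[k] H ⊗[k] (H ⊗[k] (H ⊗[k] H)) :=
  Algebra.TensorProduct.map (AlgHom.id k H) (comulRight Q.Δ)

variable (k H) in
/-- `a ⊗ b ⊗ c ↦ a ⊗ b ⊗ c ⊗ 1`. -/
def incl123 : H ⊗[k] (H ⊗[k] H) →ₐ[k] H ⊗[k] (H ⊗[k] (H ⊗[k] H)) :=
  Algebra.TensorProduct.map (AlgHom.id k H) (incl12 k H)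

variable (k H) in
/-- `a ⊗ b ⊗ c ↦ 1 ⊗ a ⊗ b ⊗ c`. -/
def incl234 : H ⊗[k] (H ⊗[k] H) →ₐ[k] H ⊗[k] (H ⊗[k] (H ⊗[k] H)) :=
  Algebra.TensorProduct.includeRight

variable (k H) in
/-- `a ⊗ b ⊗ c ⊗ d ↦ b ⊗ c ⊗ a ⊗ d`. -/
def permNest : H ⊗[k] (H ⊗[k] (H ⊗[k] H)) ≃ₐ[k] H ⊗[k] (H ⊗[k] (H ⊗[k] H)) :=
  (Algebra.TensorProduct.leftComm k H H (H ⊗[k] H)).trans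
    (Algebra.TensorProduct.congr AlgEquiv.refl (Algebra.TensorProduct.leftComm k H H H))

lemma permNest_tmul (a b c d : H) : permNest k H (a ⊗ₜ (b ⊗ₜ (c ⊗ₜ d))) =
    b ⊗ₜ (c ⊗ₜ (a ⊗ₜ d)) := rfl

lemma cocycle_comul : incl234 k H (Q.Φ : H ⊗[k] (H ⊗[k] H)) *
    Q.comul₂ (Q.Φ : H ⊗[k] (H ⊗[k] H)) * incl123 k H (Q.Φ : H ⊗[k] (H ⊗[k] H)) =
    Q.comul₃ (Q.Φ : H ⊗[k] (H ⊗[k] H)) * Q.comul₁ (Q.Φ : H ⊗[k] (H ⊗[k] H)) :=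
  Q.cocycle

/-- `a ⊗ b ⊗ c ⊗ d ↦ S(a) α b ⊗ S(c) α d`. -/
def capPair : H ⊗[k] (H ⊗[k] (H ⊗[k] H)) →ₗ[k] H ⊗[k] H :=
  sw₄ ((Algebra.TensorProduct.includeLeft : H →ₐ[k] H ⊗[k] H).toLinearMap ∘ₗ Q.S) (Q.α ⊗ₜ 1)
    (Algebra.TensorProduct.includeLeft : H →ₐ[k] H ⊗[k] H).toLinearMap 1
    ((Algebra.TensorProduct.includeRight : H →ₐ[k] H ⊗[k] H).toLinearMap ∘ₗ Q.S) (1 ⊗ₜ Q.α)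
    (Algebra.TensorProduct.includeRight : H →ₐ[k] H ⊗[k] H).toLinearMap

lemma capPair_tmul (a b c d : H) : Q.capPair (a ⊗ₜ (b ⊗ₜ (c ⊗ₜ d))) =
    (Q.S a * Q.α * b) ⊗ₜ (Q.S c * Q.α * d) := by
  simp [capPair]

lemma capPair_mul_tmul (t : H ⊗[k] (H ⊗[k] (H ⊗[k] H))) (a b c d : H) :
    Q.capPair (t * (a ⊗ₜ (b ⊗ₜ (c ⊗ₜ d)))) = (Q.S a ⊗ₜ Q.S c) * Q.capPair t * (b ⊗ₜ d) := by
  induction t using tmul₄_induction with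
  | tmul x y z w => simp [capPair_tmul, Q.S_mul, mul_assoc]
  | add x y hx hy => simp only [map_add, add_mul, mul_add, hx, hy]

/-- `a ⊗ b ⊗ c ⊗ d ↦ S(b) α c ⊗ S(a) α d`. -/
def nestedCap : H ⊗[k] (H ⊗[k] (H ⊗[k] H)) →ₗ[k] H ⊗[k] H :=
  Q.capPair ∘ₗ (permNest k H).toLinearMap

lemma nestedCap_apply (t : H ⊗[k] (H ⊗[k] (H ⊗[k] H))) :
    Q.nestedCap t = Q.capPair (permNest k H t) := rfl

lemma nestedCap_mul_tmul (t : H ⊗[k] (H ⊗[k] (H ⊗[k] H))) (a b c d : H) :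
    Q.nestedCap (t * (a ⊗ₜ (b ⊗ₜ (c ⊗ₜ d)))) = (Q.S b ⊗ₜ Q.S a) * Q.nestedCap t * (c ⊗ₜ d) := by
  rw [nestedCap_apply, map_mul, permNest_tmul, capPair_mul_tmul, nestedCap_apply]

lemma antipode_left_includeLeft (h : H) :
    sw₂ ((Algebra.TensorProduct.includeLeft : H →ₐ[k] H ⊗[k] H).toLinearMap ∘ₗ Q.S) (Q.α ⊗ₜ 1)
    (Algebra.TensorProduct.includeLeft : H →ₐ[k] H ⊗[k] H).toLinearMap (Q.Δ h) =
      Q.counit h • (Q.α ⊗ₜ 1) := by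
  have e : ∀ t, sw₂ ((Algebra.TensorProduct.includeLeft : H →ₐ[k] H ⊗[k] H).toLinearMap ∘ₗ Q.S)
    (Q.α ⊗ₜ 1) (Algebra.TensorProduct.includeLeft : H →ₐ[k] H ⊗[k] H).toLinearMap t =
      sw₂ Q.S Q.α (AlgHom.id k H).toLinearMap t ⊗ₜ 1 := by
    intro t
    induction t using tmul_induction with
    | tmul a b => simp
    | add x y hx hy => simp only [map_add, TensorProduct.add_tmul, hx, hy]
  rw [e, Q.antipodeAlong_id.left, TensorProduct.smul_tmul']

lemma antipode_left_includeRight (h : H) :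
    sw₂ ((Algebra.TensorProduct.includeRight : H →ₐ[k] H ⊗[k] H).toLinearMap ∘ₗ Q.S) (1 ⊗ₜ Q.α)
    (Algebra.TensorProduct.includeRight : H →ₐ[k] H ⊗[k] H).toLinearMap (Q.Δ h) =
      Q.counit h • (1 ⊗ₜ Q.α) := by
  have e : ∀ t, sw₂ ((Algebra.TensorProduct.includeRight : H →ₐ[k] H ⊗[k] H).toLinearMap ∘ₗ Q.S)
    (1 ⊗ₜ Q.α) (Algebra.TensorProduct.includeRight : H →ₐ[k] H ⊗[k] H).toLinearMap t =
      1 ⊗ₜ sw₂ Q.S Q.α (AlgHom.id k H).toLinearMap t := by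
    intro t
    induction t using tmul_induction with
    | tmul a b => simp
    | add x y hx hy => simp only [map_add, TensorProduct.tmul_add, hx, hy]
  rw [e, Q.antipodeAlong_id.left, TensorProduct.tmul_smul]

lemma capPair_comul₁_mul (s : H ⊗[k] (H ⊗[k] H)) (t : H ⊗[k] (H ⊗[k] (H ⊗[k] H))) :
    Q.capPair (Q.comul₁ s * t) =
      Q.capPair ((1 ⊗ₜ (1 ⊗ₜ Q.counitLeft (H ⊗[k] H) s)) * t) :=
  sw₄_absorb_cap₁₂ (fun a b => by simp [Q.S_mul]) Q.antipode_left_includeLeft _ _ _ _ s t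

lemma capPair_comul₃_mul (s : H ⊗[k] (H ⊗[k] H)) (t : H ⊗[k] (H ⊗[k] (H ⊗[k] H))) :
    Q.capPair (Q.comul₃ s * t) = Q.capPair (Algebra.TensorProduct.map (AlgHom.id k H)
        Algebra.TensorProduct.includeLeft (Q.counitLast s) * t) :=
  sw₄_absorb_cap₃₄ (fun a b => by simp [Q.S_mul]) Q.antipode_left_includeRight _ _ _ _ s t

lemma capPair_comul₁_mul_of_eq_one {s : H ⊗[k] (H ⊗[k] H)}
    (hs : Q.counitLeft (H ⊗[k] H) s = 1) (t : H ⊗[k] (H ⊗[k] (H ⊗[k] H))) :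
    Q.capPair (Q.comul₁ s * t) = Q.capPair t := by
  rw [capPair_comul₁_mul, hs]
  exact congrArg Q.capPair (one_mul t)

lemma capPair_comul₃_mul_of_eq_one {s : H ⊗[k] (H ⊗[k] H)}
    (hs : Q.counitLast s = 1) (t : H ⊗[k] (H ⊗[k] (H ⊗[k] H))) :
    Q.capPair (Q.comul₃ s * t) = Q.capPair t := by
  rw [capPair_comul₃_mul, hs, map_one, one_mul]

/-- The inner of the nested caps lies over legs 2 and 3. `permNest` moves it to the front, where it
absorbs the middle coproduct; the two legs that survive lie under the outer cap. -/
lemma nestedCap_comul₂_mul (s : H ⊗[k] (H ⊗[k] H)) (t : H ⊗[k] (H ⊗[k] (H ⊗[k] H))) :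
    Q.nestedCap (Q.comul₂ s * t) =
      Q.capPair ((1 ⊗ₜ (1 ⊗ₜ Q.counitMiddle s)) * permNest k H t) := by
  have h1 : permNest k H (Q.comul₂ s) = Q.comul₁ (perm213 k H s) := by
    induction s using tmul₃_induction with
    | tmul a b c =>
      change permNest k H (a ⊗ₜ TensorProduct.assoc k H H H (Q.Δ b ⊗ₜ c)) =
        TensorProduct.assoc k H H (H ⊗[k] H) (Q.Δ b ⊗ₜ (a ⊗ₜ c))
      generalize Q.Δ b = r
      induction r using tmul_induction with
      | tmul d e => rfl
      | add x y hx hy => simp only [map_add, TensorProduct.add_tmul, TensorProduct.tmul_add, hx, hy]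
    | add x y hx hy => simp only [map_add, hx, hy]
  have h2 : Q.counitLeft (H ⊗[k] H) (perm213 k H s) = Q.counitMiddle s := by
    clear h1
    induction s using tmul₃_induction with
    | tmul a b c => simp [perm213_tmul]
    | add x y hx hy => simp only [map_add, hx, hy]
  rw [nestedCap_apply, map_mul, h1, capPair_comul₁_mul, h2]

/-- `(1 ⊗ Φ⁻¹) (id ⊗ id ⊗ Δ)(Φ)`. -/
def nestAssoc : H ⊗[k] (H ⊗[k] (H ⊗[k] H)) :=
  incl234 k H ((Q.Φ⁻¹ : (H ⊗[k] (H ⊗[k] H))ˣ) : H ⊗[k] (H ⊗[k] H)) *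
    Q.comul₃ (Q.Φ : H ⊗[k] (H ⊗[k] H))

/-- `(Φ ⊗ 1) (Δ ⊗ id ⊗ id)(Φ⁻¹)`. -/
def nestAssoc' : H ⊗[k] (H ⊗[k] (H ⊗[k] H)) :=
  incl123 k H (Q.Φ : H ⊗[k] (H ⊗[k] H)) *
    Q.comul₁ ((Q.Φ⁻¹ : (H ⊗[k] (H ⊗[k] H))ˣ) : H ⊗[k] (H ⊗[k] H))

/-- A form of the cocycle condition. The two rebracketings differ by (id ⊗ Δ ⊗ id)(Φ), which the
inner cap absorbs, so γ can be computed from either one. -/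
lemma nestAssoc_eq : Q.nestAssoc = Q.comul₂ (Q.Φ : H ⊗[k] (H ⊗[k] H)) * Q.nestAssoc' := by
  have h1 : incl234 k H ((Q.Φ⁻¹ : (H ⊗[k] (H ⊗[k] H))ˣ) : H ⊗[k] (H ⊗[k] H)) *
      incl234 k H (Q.Φ : H ⊗[k] (H ⊗[k] H)) = 1 := by rw [← map_mul, Units.inv_mul, map_one]
  have h2 : Q.comul₁ (Q.Φ : H ⊗[k] (H ⊗[k] H)) *
      Q.comul₁ ((Q.Φ⁻¹ : (H ⊗[k] (H ⊗[k] H))ˣ) : H ⊗[k] (H ⊗[k] H)) = 1 := by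
    rw [← map_mul, Units.mul_inv, map_one]
  calc Q.nestAssoc = incl234 k H ((Q.Φ⁻¹ : (H ⊗[k] (H ⊗[k] H))ˣ) : H ⊗[k] (H ⊗[k] H)) *
        (Q.comul₃ (Q.Φ : H ⊗[k] (H ⊗[k] H)) * Q.comul₁ (Q.Φ : H ⊗[k] (H ⊗[k] H))) *
        Q.comul₁ ((Q.Φ⁻¹ : (H ⊗[k] (H ⊗[k] H))ˣ) : H ⊗[k] (H ⊗[k] H)) := by
        rw [mul_assoc, mul_assoc, h2, mul_one, nestAssoc]
    _ = _ := by
        rw [← cocycle_comul, ← mul_assoc, ← mul_assoc, h1, one_mul, nestAssoc', mul_assoc]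

/-- The element `γ` with `S(h₁₂) … γ …` representing the evaluation of `V ⊗ W` through nested
evaluations. -/
def nestedα : H ⊗[k] H := Q.nestedCap Q.nestAssoc

lemma nestedα_eq : Q.nestedα = Q.nestedCap Q.nestAssoc' := by
  rw [nestedα, nestAssoc_eq, nestedCap_comul₂_mul, Q.counitMiddle_reassociator]
  exact congrArg Q.capPair (one_mul _)

/-- `h ↦ S(h₂) ⊗ S(h₁)`. -/
def nestedS : H →ₗ[k] H ⊗[k] H :=
  TensorProduct.map Q.S Q.S ∘ₗ (flip2 k H).toLinearMap ∘ₗ Q.Δ.toLinearMap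

lemma nestedS_mul (a b : H) : Q.nestedS (a * b) = Q.nestedS b * Q.nestedS a := by
  have e : ∀ s t : H ⊗[k] H, TensorProduct.map Q.S Q.S (s * t) =
      TensorProduct.map Q.S Q.S t * TensorProduct.map Q.S Q.S s := by
    intro s t
    induction s using tmul_induction with
    | tmul a b =>
      induction t using tmul_induction with
      | tmul c d => simp [Q.S_mul]
      | add x y hx hy => simp only [map_add, add_mul, mul_add, hx, hy]
    | add x y hx hy => simp only [map_add, add_mul, mul_add, hx, hy]
  change TensorProduct.map Q.S Q.S (flip2 k H (Q.Δ (a * b))) = _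
  rw [map_mul, map_mul, e]
  rfl

lemma sw₂_nestedS_nestedCap (s : H ⊗[k] (H ⊗[k] (H ⊗[k] H))) (t : H ⊗[k] H) :
    sw₂ Q.nestedS (Q.nestedCap s) Q.Δ.toLinearMap t =
      Q.nestedCap (s * Q.comul₃ (comulLeft Q.Δ t)) := by
  induction t using tmul_induction with
  | tmul a b =>
    change TensorProduct.map Q.S Q.S (flip2 k H (Q.Δ a)) * Q.nestedCap s * Q.Δ b =
      Q.nestedCap (s * Q.comul₃ (TensorProduct.assoc k H H H (Q.Δ a ⊗ₜ b)))
    generalize Q.Δ a = r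
    induction r using tmul_induction with
    | tmul c d =>
      change (Q.S d ⊗ₜ Q.S c) * Q.nestedCap s * Q.Δ b = Q.nestedCap (s * (c ⊗ₜ (d ⊗ₜ Q.Δ b)))
      generalize Q.Δ b = r
      induction r using tmul_induction with
      | tmul e f => rw [nestedCap_mul_tmul]
      | add x y hx hy => simp only [map_add, mul_add, TensorProduct.tmul_add, hx, hy]
    | add x y hx hy => simp only [map_add, mul_add, add_mul, TensorProduct.add_tmul, hx, hy]
  | add x y hx hy => simp only [map_add, mul_add, hx, hy]

lemma reassociator_inv_mul_comulRight_comul (h : H) :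
    ((Q.Φ⁻¹ : (H ⊗[k] (H ⊗[k] H))ˣ) : H ⊗[k] (H ⊗[k] H)) * comulRight Q.Δ (Q.Δ h) =
      comulLeft Q.Δ (Q.Δ h) * ((Q.Φ⁻¹ : (H ⊗[k] (H ⊗[k] H))ˣ) : H ⊗[k] (H ⊗[k] H)) := by
  rw [Q.quasi_coassoc, mul_assoc, Units.inv_mul_cancel_left]

lemma reassociator_mul_comulLeft_comul (h : H) :
    (Q.Φ : H ⊗[k] (H ⊗[k] H)) * comulLeft Q.Δ (Q.Δ h) =
      comulRight Q.Δ (Q.Δ h) * (Q.Φ : H ⊗[k] (H ⊗[k] H)) := by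
  rw [Q.quasi_coassoc, mul_assoc, Units.inv_mul, mul_one]

lemma incl234_reassociator_inv_mul (t : H ⊗[k] H) :
    incl234 k H ((Q.Φ⁻¹ : (H ⊗[k] (H ⊗[k] H))ˣ) : H ⊗[k] (H ⊗[k] H)) *
        Q.comul₃ (comulRight Q.Δ t) =
      Q.comul₂ (comulRight Q.Δ t) *
        incl234 k H ((Q.Φ⁻¹ : (H ⊗[k] (H ⊗[k] H))ˣ) : H ⊗[k] (H ⊗[k] H)) := by
  induction t using tmul_induction with
  | tmul a b =>
    change ((1 : H) ⊗ₜ[k] ((Q.Φ⁻¹ : (H ⊗[k] (H ⊗[k] H))ˣ) : H ⊗[k] (H ⊗[k] H))) *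
      (a ⊗ₜ[k] comulRight Q.Δ (Q.Δ b)) = (a ⊗ₜ[k] comulLeft Q.Δ (Q.Δ b)) *
        ((1 : H) ⊗ₜ[k] ((Q.Φ⁻¹ : (H ⊗[k] (H ⊗[k] H))ˣ) : H ⊗[k] (H ⊗[k] H)))
    rw [Algebra.TensorProduct.tmul_mul_tmul, Algebra.TensorProduct.tmul_mul_tmul,
      reassociator_inv_mul_comulRight_comul, one_mul, mul_one]
  | add x y hx hy => simp only [map_add, mul_add, add_mul, hx, hy]

lemma counitMiddle_comulRight (t : H ⊗[k] H) : Q.counitMiddle (comulRight Q.Δ t) = t := by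
  induction t using tmul_induction with
  | tmul a b => exact congrArg (a ⊗ₜ[k] ·) (Q.counitLeft_comul b)
  | add x y hx hy => simp only [map_add, hx, hy]

/-- Quasi-coassociativity brings the iterated coproduct of h to the left of `nestAssoc`. The inner
cap absorbs its middle part, leaving Δ(h) on the legs of the outer cap, which absorbs that too. No β
and no zigzag for `nestedS` are needed, since comparison asks only for this axiom. -/
lemma nestedα_left (h : H) :
    sw₂ Q.nestedS Q.nestedα Q.Δ.toLinearMap (Q.Δ h) = Q.counit h • Q.nestedα := by
  rw [nestedα, sw₂_nestedS_nestedCap]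
  have h1 : Q.nestAssoc * Q.comul₃ (comulLeft Q.Δ (Q.Δ h)) =
      Q.comul₂ (comulRight Q.Δ (Q.Δ h)) * Q.nestAssoc := by
    rw [nestAssoc, mul_assoc, ← map_mul, reassociator_mul_comulLeft_comul, map_mul, ← mul_assoc,
      incl234_reassociator_inv_mul, mul_assoc]
  have h2 : (1 : H) ⊗ₜ[k] ((1 : H) ⊗ₜ[k] Q.Δ h) = Q.comul₃ (1 ⊗ₜ (1 ⊗ₜ h)) := rfl
  rw [h1, nestedCap_comul₂_mul, counitMiddle_comulRight, h2, capPair_comul₃_mul,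
    nestedCap_apply, ← map_smul, ← smul_one_mul (Q.counit h) (permNest k H Q.nestAssoc)]
  congr 2
  simp [Algebra.TensorProduct.one_def, TensorProduct.smul_tmul']

/-- The antipode axioms, transported along `Δ`. -/
lemma antipodeAlong_comul : AntipodeAlong Q Q.Δ (Q.Δ.toLinearMap ∘ₗ Q.S) (Q.Δ Q.α) (Q.Δ Q.β) where
  map_mul a b := by simp [Q.S_mul]
  left h := by
    rw [← map_smul, ← Q.antipodeAlong_id.left]
    generalize Q.Δ h = t
    induction t using tmul_induction with
    | tmul a b => simp
    | add x y hx hy => simp only [_root_.map_add, hx, hy]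
  right h := by
    rw [← map_smul, ← Q.antipodeAlong_id.right]
    generalize Q.Δ h = t
    induction t using tmul_induction with
    | tmul a b => simp
    | add x y hx hy => simp only [_root_.map_add, hx, hy]
  zigzag := by
    rw [← map_one Q.Δ, ← Q.antipodeAlong_id.zigzag]
    generalize (Q.Φ : H ⊗[k] (H ⊗[k] H)) = t
    induction t using tmul₃_induction with
    | tmul a b c => simp
    | add x y hx hy => simp only [_root_.map_add, hx, hy]
  zigzag_inv := by
    rw [← map_one Q.Δ, ← Q.antipodeAlong_id.zigzag_inv]
    generalize ((Q.Φ⁻¹ : (H ⊗[k] (H ⊗[k] H))ˣ) : H ⊗[k] (H ⊗[k] H)) = t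
    induction t using tmul₃_induction with
    | tmul a b c => simp
    | add x y hx hy => simp only [_root_.map_add, hx, hy]

/-- `Σ (S ⊗ S)Δᵒᵖ(t¹) γ Δ(t²) = γ Δ(a)` whenever `Σ S(t¹) α t² = α a`. -/
lemma nestedCap_nestAssoc_mul {t : H ⊗[k] H} {a : H}
    (h : sw₂ Q.S Q.α (AlgHom.id k H).toLinearMap t = Q.α * a) :
    Q.nestedCap (Q.nestAssoc * Q.comul₃ (comulLeft Q.Δ t)) = Q.nestedα * Q.Δ a := by
  have hA := Q.antipodeAlong_comul
  -- Comparison with the antipode transported along Δ gives γ = gΔ(α), with g intertwining the two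
  -- antipodes. Every cap identity with α in H therefore passes to γ.
  set g := comparison Q Q.Δ (Q.Δ.toLinearMap ∘ₗ Q.S) (Q.Δ Q.β) Q.nestedS Q.nestedα with hg
  have h1 : g * Q.Δ Q.α = Q.nestedα := comparison_mul hA Q.nestedS_mul Q.nestedα_left
  have h2 : ∀ h, Q.nestedS h * g = g * Q.Δ (Q.S h) :=
    comparison_comm hA.map_mul hA.right Q.nestedS_mul Q.nestedα_left
  have h3 : ∀ t, sw₂ Q.nestedS Q.nestedα Q.Δ.toLinearMap t =
      g * Q.Δ (sw₂ Q.S Q.α (AlgHom.id k H).toLinearMap t) := by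
    intro t
    induction t using tmul_induction with
    | tmul a b => simp [← h1, ← mul_assoc, h2]
    | add x y hx hy => simp only [map_add, mul_add, hx, hy]
  rw [← sw₂_nestedS_nestedCap, ← nestedα, h3, h, map_mul, ← mul_assoc, h1]

end QuasiHopfAlgebra

end

end QHopf

namespace QHopf

noncomputable section

/-! ### Cancellation of the nested evaluation -/

namespace QuasiHopfAlgebra

variable {k : Type u} {H : Type w} [Field k] [Ring H] [Algebra k H] (Q : QuasiHopfAlgebra k H)

/-- `a ⊗ b ⊗ c ↦ S(a) α b ⊗ c`. -/
def capLeft : H ⊗[k] (H ⊗[k] H) →ₗ[k] H ⊗[k] H :=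
  TensorProduct.map (sw₂ Q.S Q.α (AlgHom.id k H).toLinearMap) LinearMap.id ∘ₗ
    (TensorProduct.assoc k H H H).symm.toLinearMap

lemma capLeft_tmul (a b c : H) : Q.capLeft (a ⊗ₜ (b ⊗ₜ c)) = (Q.S a * Q.α * b) ⊗ₜ c := rfl

lemma capLeft_mul_tmul (t : H ⊗[k] (H ⊗[k] H)) (a : H) (r : H ⊗[k] H) :
    Q.capLeft (t * (a ⊗ₜ r)) = (Q.S a ⊗ₜ 1) * Q.capLeft t * r := by
  induction t using tmul₃_induction with
  | tmul x y z =>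
    induction r using tmul_induction with
    | tmul b c => simp [capLeft_tmul, Q.S_mul, mul_assoc]
    | add x y hx hy => simp only [map_add, mul_add, TensorProduct.tmul_add, hx, hy]
  | add x y hx hy => simp only [map_add, add_mul, mul_add, hx, hy]

lemma capLeft_comulLeft_mul (s : H ⊗[k] H) (t : H ⊗[k] (H ⊗[k] H)) :
    Q.capLeft (comulLeft Q.Δ s * t) = (1 ⊗ₜ Q.counitLeft H s) * Q.capLeft t := by
  induction t using tmul₃_induction with
  | tmul x y z =>
    induction s using tmul_induction with
    | tmul a b =>
      have e : ∀ r : H ⊗[k] H, Q.capLeft (TensorProduct.assoc k H H H (r ⊗ₜ b) *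
          (x ⊗ₜ (y ⊗ₜ z))) =
          (Q.S x * sw₂ Q.S Q.α (AlgHom.id k H).toLinearMap r * y) ⊗ₜ (b * z) := by
        intro r
        induction r using tmul_induction with
        | tmul c d => simp [capLeft_tmul, Q.S_mul, mul_assoc]
        | add x y hx hy =>
          simp only [map_add, add_mul, mul_add, TensorProduct.add_tmul, hx, hy]
      refine (e (Q.Δ a)).trans ?_
      rw [Q.antipodeAlong_id.left]
      simp only [capLeft_tmul, counitLeft_tmul, Algebra.TensorProduct.tmul_mul_tmul, one_mul,
        mul_smul_comm, smul_mul_assoc, TensorProduct.tmul_smul, ← TensorProduct.smul_tmul']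
    | add x y hx hy => simp only [map_add, add_mul, TensorProduct.tmul_add, hx, hy]
  | add x y hx hy => simp only [map_add, mul_add, hx, hy]

/-- `a ⊗ b ⊗ c ⊗ d ↦ a β S(b) α c ⊗ d`. -/
def zigzagLeft : H ⊗[k] (H ⊗[k] (H ⊗[k] H)) →ₗ[k] H ⊗[k] H :=
  sw₄ (Algebra.TensorProduct.includeLeft : H →ₐ[k] H ⊗[k] H).toLinearMap (Q.β ⊗ₜ 1)
    ((Algebra.TensorProduct.includeLeft : H →ₐ[k] H ⊗[k] H).toLinearMap ∘ₗ Q.S) (Q.α ⊗ₜ 1)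
    (Algebra.TensorProduct.includeLeft : H →ₐ[k] H ⊗[k] H).toLinearMap 1
    (Algebra.TensorProduct.includeRight : H →ₐ[k] H ⊗[k] H).toLinearMap

lemma zigzagLeft_tmul (a b c d : H) : Q.zigzagLeft (a ⊗ₜ (b ⊗ₜ (c ⊗ₜ d))) =
    (a * Q.β * Q.S b * Q.α * c) ⊗ₜ d := by
  simp [zigzagLeft, mul_assoc]

lemma antipode_right_includeLeft (h : H) :
    sw₂ (Algebra.TensorProduct.includeLeft : H →ₐ[k] H ⊗[k] H).toLinearMap (Q.β ⊗ₜ 1)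
    ((Algebra.TensorProduct.includeLeft : H →ₐ[k] H ⊗[k] H).toLinearMap ∘ₗ Q.S) (Q.Δ h) =
      Q.counit h • (Q.β ⊗ₜ 1) := by
  have e : ∀ t, sw₂ (Algebra.TensorProduct.includeLeft : H →ₐ[k] H ⊗[k] H).toLinearMap (Q.β ⊗ₜ 1)
    ((Algebra.TensorProduct.includeLeft : H →ₐ[k] H ⊗[k] H).toLinearMap ∘ₗ Q.S) t =
      sw₂ (AlgHom.id k H).toLinearMap Q.β Q.S t ⊗ₜ 1 := by
    intro t
    induction t using tmul_induction with
    | tmul a b => simp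
    | add x y hx hy => simp only [map_add, TensorProduct.add_tmul, hx, hy]
  rw [e, Q.antipodeAlong_id.right, TensorProduct.smul_tmul']

/-- In the second form of `nestAssoc` the cap absorbs the coproduct on legs 2 and 3 and the cup
absorbs the one on legs 1 and 2; the zigzag of Φ is left. -/
lemma zigzagLeft_nestAssoc : Q.zigzagLeft Q.nestAssoc = 1 := by
  have h1 : Q.zigzagLeft (Q.comul₂ (Q.Φ : H ⊗[k] (H ⊗[k] H)) * Q.nestAssoc') =
      Q.zigzagLeft Q.nestAssoc' := by
    refine (sw₄_absorb_cap₂₃ (fun a b => by simp [Q.S_mul]) Q.antipode_left_includeLeft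
      _ _ _ _ _ _).trans ?_
    rw [Q.counitMiddle_reassociator, map_one, one_mul]
    rfl
  have h2 : Q.zigzagLeft Q.nestAssoc' =
      Q.zigzagLeft (incl123 k H (Q.Φ : H ⊗[k] (H ⊗[k] H))) := by
    refine (sw₄_absorb_cup₁₂ (fun a b => by simp [Q.S_mul]) Q.antipode_right_includeLeft
      _ _ _ _ _ _).trans ?_
    rw [Q.counitLeft_reassociator_inv]
    exact congrArg Q.zigzagLeft (mul_one _)
  have h3 : ∀ t, Q.zigzagLeft (incl123 k H t) = sw₃ (AlgHom.id k H).toLinearMap Q.β Q.S Q.α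
      (AlgHom.id k H).toLinearMap t ⊗ₜ 1 := by
    intro t
    induction t using tmul₃_induction with
    | tmul a b c =>
      refine (Q.zigzagLeft_tmul a b c 1).trans ?_
      simp [mul_assoc]
    | add x y hx hy => simp only [map_add, TensorProduct.add_tmul, hx, hy]
  rw [nestAssoc_eq, h1, h2, h3, Q.antipodeAlong_id.zigzag]
  rfl

lemma zigzagLeft_incl234_mul (s : H ⊗[k] (H ⊗[k] H)) (a b : H) (r : H ⊗[k] H) :
    Q.zigzagLeft (incl234 k H s * (a ⊗ₜ (b ⊗ₜ r))) =
      ((a * Q.β * Q.S b) ⊗ₜ 1) * Q.capLeft s * r := by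
  induction s using tmul₃_induction with
  | tmul x y z =>
    induction r using tmul_induction with
    | tmul c d =>
      change Q.zigzagLeft ((1 ⊗ₜ (x ⊗ₜ (y ⊗ₜ z))) * (a ⊗ₜ (b ⊗ₜ (c ⊗ₜ d)))) = _
      simp [capLeft_tmul, zigzagLeft_tmul, Q.S_mul, mul_assoc]
    | add x y hx hy => simp only [map_add, mul_add, TensorProduct.tmul_add, hx, hy]
  | add x y hx hy => simp only [map_add, add_mul, mul_add, hx, hy]

lemma nestedCap_mul_tmul_right (t : H ⊗[k] (H ⊗[k] (H ⊗[k] H))) (a b : H) (r : H ⊗[k] H) :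
    Q.nestedCap (t * (a ⊗ₜ (b ⊗ₜ r))) = (Q.S b ⊗ₜ Q.S a) * Q.nestedCap t * r := by
  induction r using tmul_induction with
  | tmul c d => rw [nestedCap_mul_tmul]
  | add x y hx hy => simp only [map_add, mul_add, TensorProduct.tmul_add, hx, hy]

lemma nestedCap_incl234 (s : H ⊗[k] (H ⊗[k] H)) :
    Q.nestedCap (incl234 k H s) = (1 ⊗ₜ Q.α) * Q.capLeft s := by
  induction s using tmul₃_induction with
  | tmul x y z =>
    refine (Q.capPair_tmul x y 1 z).trans ?_
    simp [capLeft_tmul, Q.S_one]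
  | add x y hx hy => simp only [map_add, mul_add, hx, hy]

/-- The element `γ` can be cancelled from equations between elements commuting with `Δ(H)`. -/
lemma eq_one_of_nestedα_mul {c : H ⊗[k] H} (hc : ∀ h, c * Q.Δ h = Q.Δ h * c)
    (h : Q.nestedα * c = Q.nestedα) : c = 1 := by
  -- The nested cap is undone one evaluation at a time, with c kept on the right: every step
  -- multiplies on the right by coproducts, and c commutes with them. K represents the inner
  -- evaluation alone. In `h1`, the factor (id ⊗ id ⊗ Δ)(Φ⁻¹) cancels half of `nestAssoc` and turns
  -- γ into (1 ⊗ α)K.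
  set K := Q.capLeft ((Q.Φ⁻¹ : (H ⊗[k] (H ⊗[k] H))ˣ) : H ⊗[k] (H ⊗[k] H)) with hK
  have h1 : (1 ⊗ₜ Q.α) * K * c = (1 ⊗ₜ Q.α) * K := by
    have e : ∀ s, Q.nestedCap (Q.nestAssoc * Q.comul₃ s) * c =
        Q.nestedCap (Q.nestAssoc * Q.comul₃ s) := by
      intro s
      induction s using tmul₃_induction with
      | tmul x y z =>
        change Q.nestedCap (Q.nestAssoc * (x ⊗ₜ (y ⊗ₜ Q.Δ z))) * c =
          Q.nestedCap (Q.nestAssoc * (x ⊗ₜ (y ⊗ₜ Q.Δ z)))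
        rw [nestedCap_mul_tmul_right, ← nestedα, mul_assoc, ← hc, mul_assoc _ Q.nestedα,
          ← mul_assoc Q.nestedα, h, mul_assoc]
      | add x y hx hy => simp only [map_add, mul_add, add_mul, hx, hy]
    have e' := e ((Q.Φ⁻¹ : (H ⊗[k] (H ⊗[k] H))ˣ) : H ⊗[k] (H ⊗[k] H))
    rwa [nestAssoc, mul_assoc (incl234 k H _), ← map_mul Q.comul₃, Units.mul_inv, map_one, mul_one,
      nestedCap_incl234] at e'
  -- To insert y after α, Δ(y) is moved through Φ⁻¹ and absorbed by the inner cap, which leaves y in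
  -- the second leg.
  have h2 : ∀ y : H, (1 ⊗ₜ (Q.α * y)) * K * c = (1 ⊗ₜ (Q.α * y)) * K := by
    intro y
    have e : ∀ t : H ⊗[k] H, (1 ⊗ₜ Q.α) * Q.capLeft
          (((Q.Φ⁻¹ : (H ⊗[k] (H ⊗[k] H))ˣ) : H ⊗[k] (H ⊗[k] H)) * comulRight Q.Δ t) * c =
        (1 ⊗ₜ Q.α) * Q.capLeft
          (((Q.Φ⁻¹ : (H ⊗[k] (H ⊗[k] H))ˣ) : H ⊗[k] (H ⊗[k] H)) * comulRight Q.Δ t) := by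
      intro t
      induction t using tmul_induction with
      | tmul a b =>
        have e1 : (1 ⊗ₜ Q.α) * ((Q.S a ⊗ₜ 1) * K * Q.Δ b) =
            (Q.S a ⊗ₜ 1) * ((1 ⊗ₜ Q.α) * K) * Q.Δ b := by
          rw [← mul_assoc, ← mul_assoc, ← mul_assoc, Algebra.TensorProduct.tmul_mul_tmul,
            Algebra.TensorProduct.tmul_mul_tmul, one_mul, one_mul, mul_one, mul_one]
        change (1 ⊗ₜ Q.α) * Q.capLeft (_ * (a ⊗ₜ Q.Δ b)) * c =
          (1 ⊗ₜ Q.α) * Q.capLeft (_ * (a ⊗ₜ Q.Δ b))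
        rw [capLeft_mul_tmul, ← hK, e1, mul_assoc _ (Q.Δ b), ← hc, ← mul_assoc,
          mul_assoc _ _ c, h1]
      | add x y hx hy => simp only [map_add, mul_add, add_mul, hx, hy]
    have e' := e (Q.Δ y)
    rwa [reassociator_inv_mul_comulRight_comul, capLeft_comulLeft_mul, Q.counitLeft_comul,
      ← mul_assoc, Algebra.TensorProduct.tmul_mul_tmul, one_mul] at e'
  -- With arbitrary y available, multiplying by the legs of Φ completes X¹βS(X²)αX³ = 1 and removes
  -- the outer α.
  have h3 : K * c = K := by
    have e : ∀ t, (1 ⊗ₜ sw₃ (AlgHom.id k H).toLinearMap Q.β Q.S Q.α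
        (AlgHom.id k H).toLinearMap t) * K * c = (1 ⊗ₜ sw₃ (AlgHom.id k H).toLinearMap Q.β Q.S Q.α
        (AlgHom.id k H).toLinearMap t) * K := by
      intro t
      induction t using tmul₃_induction with
      | tmul x y z =>
        have e1 : (1 : H) ⊗ₜ[k] sw₃ (AlgHom.id k H).toLinearMap Q.β Q.S Q.α
            (AlgHom.id k H).toLinearMap (x ⊗ₜ (y ⊗ₜ z)) =
            (1 ⊗ₜ (x * Q.β * Q.S y)) * (1 ⊗ₜ (Q.α * z)) := by
          simp [mul_assoc]
        rw [e1, mul_assoc _ _ K, mul_assoc, h2]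
      | add x y hx hy => simp only [map_add, TensorProduct.tmul_add, add_mul, hx, hy]
    have e' := e (Q.Φ : H ⊗[k] (H ⊗[k] H))
    rwa [Q.antipodeAlong_id.zigzag, ← Algebra.TensorProduct.one_def, one_mul] at e'
  -- The inner evaluation is removed in the same way, now by the zigzag on `nestAssoc`.
  have e : ∀ t, Q.zigzagLeft (incl234 k H ((Q.Φ⁻¹ : (H ⊗[k] (H ⊗[k] H))ˣ) : H ⊗[k] (H ⊗[k] H)) *
      Q.comul₃ t) * c =
      Q.zigzagLeft (incl234 k H ((Q.Φ⁻¹ : (H ⊗[k] (H ⊗[k] H))ˣ) : H ⊗[k] (H ⊗[k] H)) *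
      Q.comul₃ t) := by
    intro t
    induction t using tmul₃_induction with
    | tmul x y z =>
      change Q.zigzagLeft (_ * (x ⊗ₜ (y ⊗ₜ Q.Δ z))) * c = Q.zigzagLeft (_ * (x ⊗ₜ (y ⊗ₜ Q.Δ z)))
      rw [zigzagLeft_incl234_mul, ← hK, mul_assoc, ← hc, ← mul_assoc, mul_assoc _ K c, h3]
    | add x y hx hy => simp only [map_add, mul_add, add_mul, hx, hy]
  have e' := e (Q.Φ : H ⊗[k] (H ⊗[k] H))
  rwa [← nestAssoc, zigzagLeft_nestAssoc, one_mul] at e'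

end QuasiHopfAlgebra

/-! ### The antipode and the `R`-matrix -/

namespace QTQuasiHopfAlgebra

open QuasiHopfAlgebra

variable {k : Type u} {H : Type w} [Field k] [Ring H] [Algebra k H] (Q : QTQuasiHopfAlgebra k H)

/-- The first hexagon solved for Φ₃₁₂R₁₃. Its factor (Δ ⊗ id)(R) lies under the first cap and
disappears because (ε ⊗ id)(R) = 1. -/
lemma capPair_incl123_R_mul (t : H ⊗[k] (H ⊗[k] (H ⊗[k] H))) :
    Q.capPair (incl123 k H (perm312 k H (Q.Φ : H ⊗[k] (H ⊗[k] H)) *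
      incl13 k H (Q.R : H ⊗[k] H)) * t) =
    Q.capPair (incl123 k H (((Q.Φ⁻¹ : (H ⊗[k] (H ⊗[k] H))ˣ) : H ⊗[k] (H ⊗[k] H)) *
      incl23 k H ((Q.R⁻¹ : (H ⊗[k] H)ˣ) : H ⊗[k] H) *
      perm132 k H (Q.Φ : H ⊗[k] (H ⊗[k] H))) * t) := by
  have h1 : perm312 k H (Q.Φ : H ⊗[k] (H ⊗[k] H)) * incl13 k H (Q.R : H ⊗[k] H) =
      comulLeft Q.Δ (Q.R : H ⊗[k] H) *
      (((Q.Φ⁻¹ : (H ⊗[k] (H ⊗[k] H))ˣ) : H ⊗[k] (H ⊗[k] H)) *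
      incl23 k H ((Q.R⁻¹ : (H ⊗[k] H)ˣ) : H ⊗[k] H) *
      perm132 k H (Q.Φ : H ⊗[k] (H ⊗[k] H))) := by
    have e1 : incl23 k H (Q.R : H ⊗[k] H) * incl23 k H ((Q.R⁻¹ : (H ⊗[k] H)ˣ) : H ⊗[k] H) = 1 := by
      rw [← map_mul, Units.mul_inv, map_one]
    have e2 : perm132 k H ((Q.Φ⁻¹ : (H ⊗[k] (H ⊗[k] H))ˣ) : H ⊗[k] (H ⊗[k] H)) *
        perm132 k H (Q.Φ : H ⊗[k] (H ⊗[k] H)) = 1 := by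
      rw [← map_mul, Units.inv_mul, map_one]
    rw [Q.comul_id_R]
    simp only [mul_assoc, Units.mul_inv_cancel_left]
    rw [← mul_assoc (incl23 k H _), e1, one_mul, e2, mul_one]
  have h2 : ∀ r : H ⊗[k] H, incl123 k H (comulLeft Q.Δ r) = Q.comul₁ (incl12 k H r) := by
    intro r
    induction r using tmul_induction with
    | tmul a b =>
      change incl123 k H (TensorProduct.assoc k H H H (Q.Δ a ⊗ₜ b)) =
        TensorProduct.assoc k H H (H ⊗[k] H) (Q.Δ a ⊗ₜ (b ⊗ₜ 1))
      generalize Q.Δ a = r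
      induction r using tmul_induction with
      | tmul c d => rfl
      | add x y hx hy => simp only [map_add, TensorProduct.add_tmul, hx, hy]
    | add x y hx hy => simp only [map_add, hx, hy]
  have h3 : ∀ r : H ⊗[k] H, Q.counitLeft (H ⊗[k] H) (incl12 k H r) = Q.counitLeft H r ⊗ₜ 1 := by
    intro r
    induction r using tmul_induction with
    | tmul a b => simp [incl12_tmul, TensorProduct.smul_tmul']
    | add x y hx hy => simp only [map_add, TensorProduct.add_tmul, hx, hy]
  rw [h1, map_mul (incl123 k H), mul_assoc, h2, capPair_comul₁_mul_of_eq_one]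
  rw [h3, counitLeft_R]
  rfl

/-- The counterpart with the second hexagon: (id ⊗ Δ)(R) lies under the second cap. -/
lemma capPair_incl234_R_mul (t : H ⊗[k] (H ⊗[k] (H ⊗[k] H))) :
    Q.capPair (incl234 k H ((perm312 k H).symm
      ((Q.Φ⁻¹ : (H ⊗[k] (H ⊗[k] H))ˣ) : H ⊗[k] (H ⊗[k] H)) * incl13 k H (Q.R : H ⊗[k] H)) * t) =
    Q.capPair (incl234 k H ((Q.Φ : H ⊗[k] (H ⊗[k] H)) *
      incl12 k H ((Q.R⁻¹ : (H ⊗[k] H)ˣ) : H ⊗[k] H) *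
      perm213 k H ((Q.Φ⁻¹ : (H ⊗[k] (H ⊗[k] H))ˣ) : H ⊗[k] (H ⊗[k] H))) * t) := by
  have h1 : (perm312 k H).symm ((Q.Φ⁻¹ : (H ⊗[k] (H ⊗[k] H))ˣ) : H ⊗[k] (H ⊗[k] H)) *
      incl13 k H (Q.R : H ⊗[k] H) = comulRight Q.Δ (Q.R : H ⊗[k] H) *
      ((Q.Φ : H ⊗[k] (H ⊗[k] H)) * incl12 k H ((Q.R⁻¹ : (H ⊗[k] H)ˣ) : H ⊗[k] H) *
      perm213 k H ((Q.Φ⁻¹ : (H ⊗[k] (H ⊗[k] H))ˣ) : H ⊗[k] (H ⊗[k] H))) := by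
    have e1 : incl12 k H (Q.R : H ⊗[k] H) * incl12 k H ((Q.R⁻¹ : (H ⊗[k] H)ˣ) : H ⊗[k] H) = 1 := by
      rw [← map_mul, Units.mul_inv, map_one]
    have e2 : perm213 k H (Q.Φ : H ⊗[k] (H ⊗[k] H)) *
        perm213 k H ((Q.Φ⁻¹ : (H ⊗[k] (H ⊗[k] H))ˣ) : H ⊗[k] (H ⊗[k] H)) = 1 := by
      rw [← map_mul, Units.mul_inv, map_one]
    rw [Q.id_comul_R]
    simp only [mul_assoc, Units.inv_mul_cancel_left]
    rw [← mul_assoc (incl12 k H _), e1, one_mul, e2, mul_one]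
  have h2 : incl234 k H (comulRight Q.Δ (Q.R : H ⊗[k] H)) = Q.comul₃ (1 ⊗ₜ (Q.R : H ⊗[k] H)) := rfl
  rw [h1, map_mul (incl234 k H), mul_assoc, h2, capPair_comul₃_mul_of_eq_one]
  change (1 : H) ⊗ₜ[k] Q.counitRight H (Q.R : H ⊗[k] H) = 1
  rw [counitRight_R]
  rfl

variable (k H) in
/-- `a ⊗ b ⊗ c ⊗ d ↦ a ⊗ c ⊗ b ⊗ d`. -/
def perm1324 : H ⊗[k] (H ⊗[k] (H ⊗[k] H)) ≃ₐ[k] H ⊗[k] (H ⊗[k] (H ⊗[k] H)) :=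
  Algebra.TensorProduct.congr AlgEquiv.refl (perm213 k H)

/-- These are the normal forms of the two sides of (S ⊗ S)(R)γ = γ₂₁R. R⁻¹ on the middle legs undoes
the swap inside (id ⊗ Δ ⊗ id)(Φ); the cocycle condition then trades 1 ⊗ Φ for Φ⁻¹ ⊗ 1, up to
coproducts that the two caps absorb. -/
lemma capPair_nestAssoc_eq :
    Q.capPair (incl234 k H ((Q.Φ : H ⊗[k] (H ⊗[k] H)) *
      incl12 k H ((Q.R⁻¹ : (H ⊗[k] H)ˣ) : H ⊗[k] H)) * perm1324 k H Q.nestAssoc) =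
    Q.capPair (incl123 k H (((Q.Φ⁻¹ : (H ⊗[k] (H ⊗[k] H))ˣ) : H ⊗[k] (H ⊗[k] H)) *
      incl23 k H ((Q.R⁻¹ : (H ⊗[k] H)ˣ) : H ⊗[k] H)) * perm1324 k H Q.nestAssoc') := by
  have h0 : ∀ t, incl12 k H ((Q.R⁻¹ : (H ⊗[k] H)ˣ) : H ⊗[k] H) * perm213 k H (comulLeft Q.Δ t) =
      comulLeft Q.Δ t * incl12 k H ((Q.R⁻¹ : (H ⊗[k] H)ˣ) : H ⊗[k] H) := by
    intro t
    have e1 : incl12 k H (Q.R : H ⊗[k] H) * incl12 k H ((Q.R⁻¹ : (H ⊗[k] H)ˣ) : H ⊗[k] H) = 1 := by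
      rw [← map_mul, Units.mul_inv, map_one]
    have e2 : incl12 k H ((Q.R⁻¹ : (H ⊗[k] H)ˣ) : H ⊗[k] H) * incl12 k H (Q.R : H ⊗[k] H) = 1 := by
      rw [← map_mul, Units.inv_mul, map_one]
    calc _ = incl12 k H ((Q.R⁻¹ : (H ⊗[k] H)ˣ) : H ⊗[k] H) * (perm213 k H (comulLeft Q.Δ t) *
          incl12 k H (Q.R : H ⊗[k] H)) * incl12 k H ((Q.R⁻¹ : (H ⊗[k] H)ˣ) : H ⊗[k] H) := by
          rw [mul_assoc, mul_assoc _ _ (incl12 k H ((Q.R⁻¹ : (H ⊗[k] H)ˣ) : H ⊗[k] H)), e1,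
            mul_one]
      _ = _ := by rw [← incl12_mul_comulLeft, ← mul_assoc, e2, one_mul]
  have h1 : ∀ s, incl234 k H (incl12 k H ((Q.R⁻¹ : (H ⊗[k] H)ˣ) : H ⊗[k] H)) *
      perm1324 k H (Q.comul₂ s) =
      Q.comul₂ s * incl234 k H (incl12 k H ((Q.R⁻¹ : (H ⊗[k] H)ˣ) : H ⊗[k] H)) := by
    intro s
    induction s using tmul_induction with
    | tmul a t =>
      change ((1 : H) ⊗ₜ[k] incl12 k H ((Q.R⁻¹ : (H ⊗[k] H)ˣ) : H ⊗[k] H)) *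
        (a ⊗ₜ[k] perm213 k H (comulLeft Q.Δ t)) = (a ⊗ₜ[k] comulLeft Q.Δ t) *
        ((1 : H) ⊗ₜ[k] incl12 k H ((Q.R⁻¹ : (H ⊗[k] H)ˣ) : H ⊗[k] H))
      rw [Algebra.TensorProduct.tmul_mul_tmul, Algebra.TensorProduct.tmul_mul_tmul, h0, one_mul,
        mul_one]
    | add x y hx hy => simp only [map_add, mul_add, add_mul, hx, hy]
  have h2 : incl234 k H (Q.Φ : H ⊗[k] (H ⊗[k] H)) * Q.comul₂ (Q.Φ : H ⊗[k] (H ⊗[k] H)) =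
      Q.comul₃ (Q.Φ : H ⊗[k] (H ⊗[k] H)) * (Q.comul₁ (Q.Φ : H ⊗[k] (H ⊗[k] H)) *
        incl123 k H ((Q.Φ⁻¹ : (H ⊗[k] (H ⊗[k] H))ˣ) : H ⊗[k] (H ⊗[k] H))) := by
    have e : incl123 k H (Q.Φ : H ⊗[k] (H ⊗[k] H)) *
        incl123 k H ((Q.Φ⁻¹ : (H ⊗[k] (H ⊗[k] H))ˣ) : H ⊗[k] (H ⊗[k] H)) = 1 := by
      rw [← map_mul, Units.mul_inv, map_one]
    rw [← mul_assoc, ← cocycle_comul, mul_assoc, e, mul_one]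
  have h3 : ∀ r : H ⊗[k] H, incl234 k H (incl12 k H r) = incl123 k H (incl23 k H r) := fun _ => rfl
  rw [nestAssoc_eq, map_mul (incl234 k H), map_mul (perm1324 k H), mul_assoc, ← mul_assoc (incl234 k H (incl12 k H _)), h1,
    mul_assoc, ← mul_assoc (incl234 k H _), h2, mul_assoc,
    capPair_comul₃_mul_of_eq_one _ Q.counitLast_reassociator, mul_assoc,
    capPair_comul₁_mul_of_eq_one _ Q.counitLeft_reassociator, h3, map_mul (incl123 k H),
    mul_assoc]

lemma nestedCap_mul_incl12 (t : H ⊗[k] (H ⊗[k] (H ⊗[k] H))) (x : H ⊗[k] H) :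
    Q.nestedCap (t * incl123 k H (incl12 k H x)) =
      TensorProduct.map Q.S Q.S (flip2 k H x) * Q.nestedCap t := by
  induction x using tmul_induction with
  | tmul a b =>
    refine (Q.nestedCap_mul_tmul t a b 1 1).trans ?_
    rw [← Algebra.TensorProduct.one_def, mul_one]
    rfl
  | add x y hx hy => simp only [map_add, mul_add, add_mul, hx, hy]

lemma nestedCap_mul_incl34 (t : H ⊗[k] (H ⊗[k] (H ⊗[k] H))) (x : H ⊗[k] H) :
    Q.nestedCap (t * incl234 k H (incl23 k H x)) = Q.nestedCap t * x := by
  refine (Q.nestedCap_mul_tmul_right t 1 1 x).trans ?_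
  rw [Q.S_one, ← Algebra.TensorProduct.one_def, one_mul]

/-- `(S ⊗ S)(R) γ = γ₂₁ R`. -/
lemma map_S_R_mul_nestedα : TensorProduct.map Q.S Q.S (Q.R : H ⊗[k] H) * Q.nestedα =
    flip2 k H Q.nestedα * (Q.R : H ⊗[k] H) := by
  -- Under the nested cap, (S ⊗ S)(R) is R₂₁ on the first two legs. It passes (Δ ⊗ id ⊗ id)(Φ⁻¹) by
  -- swapping legs, and the hexagon under the first cap then exchanges R for R⁻¹.
  have hl : TensorProduct.map Q.S Q.S (Q.R : H ⊗[k] H) * Q.nestedα =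
      Q.capPair (incl123 k H (((Q.Φ⁻¹ : (H ⊗[k] (H ⊗[k] H))ˣ) : H ⊗[k] (H ⊗[k] H)) *
        incl23 k H ((Q.R⁻¹ : (H ⊗[k] H)ˣ) : H ⊗[k] H)) * perm1324 k H Q.nestAssoc') := by
    set σ : H ⊗[k] (H ⊗[k] (H ⊗[k] H)) ≃ₐ[k] H ⊗[k] (H ⊗[k] (H ⊗[k] H)) :=
      Algebra.TensorProduct.leftComm k H H (H ⊗[k] H) with hσ
    have h1 : ∀ s, Q.comul₁ s * incl123 k H (incl12 k H (flip2 k H (Q.R : H ⊗[k] H))) =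
        incl123 k H (incl12 k H (flip2 k H (Q.R : H ⊗[k] H))) * σ (Q.comul₁ s) := by
      have e1 : ∀ x : H ⊗[k] H, incl123 k H (incl12 k H x) =
          Algebra.TensorProduct.assoc k k k H H (H ⊗[k] H) (x ⊗ₜ 1) := by
        intro x
        induction x using tmul_induction with
        | tmul a b => rfl
        | add x y hx hy => simp only [map_add, TensorProduct.add_tmul, hx, hy]
      have e2 : ∀ (x p : H ⊗[k] H), σ (Algebra.TensorProduct.assoc k k k H H (H ⊗[k] H)
          (x ⊗ₜ p)) = Algebra.TensorProduct.assoc k k k H H (H ⊗[k] H) (flip2 k H x ⊗ₜ p) := by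
        intro x p
        induction x using tmul_induction with
        | tmul a b => rfl
        | add x y hx hy => simp only [map_add, TensorProduct.add_tmul, hx, hy]
      intro s
      induction s using tmul_induction with
      | tmul a p =>
        have e3 : Q.comul₁ (a ⊗ₜ p) =
          Algebra.TensorProduct.assoc k k k H H (H ⊗[k] H) (Q.Δ a ⊗ₜ p) := rfl
        rw [e3, e2, e1, ← map_mul, ← map_mul, Algebra.TensorProduct.tmul_mul_tmul,
          Algebra.TensorProduct.tmul_mul_tmul, flip2_R_mul_flip2_comul, one_mul, mul_one]
      | add x y hx hy => simp only [map_add, mul_add, add_mul, hx, hy]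
    have h2 : ∀ s, permNest k H (incl123 k H s) = incl123 k H (perm312 k H s) := by
      intro s
      induction s using tmul₃_induction with
      | tmul a b c => rfl
      | add x y hx hy => simp only [map_add, hx, hy]
    have h3 : ∀ s, permNest k H (σ s) = perm1324 k H s := by
      intro s
      induction s using tmul₄_induction with
      | tmul a b c d => rfl
      | add x y hx hy => simp only [map_add, hx, hy]
    have h4 : ∀ s, incl123 k H (perm132 k H s) = perm1324 k H (incl123 k H s) := by
      intro s
      induction s using tmul₃_induction with
      | tmul a b c => rfl
      | add x y hx hy => simp only [map_add, hx, hy]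
    have e : (Q.R : H ⊗[k] H) = flip2 k H (flip2 k H (Q.R : H ⊗[k] H)) := (flip2_flip2 _).symm
    rw [nestedα_eq, e, ← nestedCap_mul_incl12, nestAssoc', mul_assoc, h1, ← mul_assoc,
      ← map_mul (incl123 k H), nestedCap_apply, map_mul (permNest k H), h2, h3,
      map_mul (perm312 k H), perm312_incl12, flip2_flip2,
      capPair_incl123_R_mul, map_mul (incl123 k H), mul_assoc, h4, ← map_mul (perm1324 k H)]
  -- Symmetrically, R acts on the last two legs, passes (id ⊗ id ⊗ Δ)(Φ), and the hexagon under the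
  -- second cap is used.
  have hr : flip2 k H Q.nestedα * (Q.R : H ⊗[k] H) =
      Q.capPair (incl234 k H ((Q.Φ : H ⊗[k] (H ⊗[k] H)) *
        incl12 k H ((Q.R⁻¹ : (H ⊗[k] H)ˣ) : H ⊗[k] H)) * perm1324 k H Q.nestAssoc) := by
    set σ : H ⊗[k] (H ⊗[k] (H ⊗[k] H)) ≃ₐ[k] H ⊗[k] (H ⊗[k] (H ⊗[k] H)) :=
      Algebra.TensorProduct.congr AlgEquiv.refl (perm132 k H) with hσ
    set τ : H ⊗[k] (H ⊗[k] (H ⊗[k] H)) ≃ₐ[k] H ⊗[k] (H ⊗[k] (H ⊗[k] H)) :=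
      Algebra.TensorProduct.congr AlgEquiv.refl (perm312 k H).symm with hτ
    have h1 : ∀ s, Q.comul₃ s * incl234 k H (incl23 k H (flip2 k H (Q.R : H ⊗[k] H))) =
        incl234 k H (incl23 k H (flip2 k H (Q.R : H ⊗[k] H))) * σ (Q.comul₃ s) := by
      intro s
      induction s using tmul₃_induction with
      | tmul a b c =>
        change (a ⊗ₜ[k] (b ⊗ₜ[k] Q.Δ c)) * (1 ⊗ₜ (1 ⊗ₜ flip2 k H (Q.R : H ⊗[k] H))) =
          (1 ⊗ₜ (1 ⊗ₜ flip2 k H (Q.R : H ⊗[k] H))) * (a ⊗ₜ[k] (b ⊗ₜ[k] flip2 k H (Q.Δ c)))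
        simp only [Algebra.TensorProduct.tmul_mul_tmul, flip2_R_mul_flip2_comul, one_mul, mul_one]
      | add x y hx hy => simp only [map_add, mul_add, add_mul, hx, hy]
    have h2 : ∀ s, flip2 k H (Q.nestedCap s) = Q.capPair (τ s) := by
      intro s
      induction s using tmul₄_induction with
      | tmul a b c d =>
        rw [nestedCap_apply, permNest_tmul, capPair_tmul, flip2_tmul]
        exact (Q.capPair_tmul a d b c).symm
      | add x y hx hy => simp only [map_add, hx, hy]
    have h3 : ∀ s, τ (σ s) = perm1324 k H s := by
      intro s
      induction s using tmul₄_induction with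
      | tmul a b c d => rfl
      | add x y hx hy => simp only [map_add, hx, hy]
    have h4 : ∀ s, incl234 k H (perm213 k H s) = perm1324 k H (incl234 k H s) := fun _ => rfl
    have h5 : ∀ s, τ (incl234 k H s) = incl234 k H ((perm312 k H).symm s) := fun _ => rfl
    have e : flip2 k H Q.nestedα * (Q.R : H ⊗[k] H) =
        flip2 k H (Q.nestedα * flip2 k H (Q.R : H ⊗[k] H)) := by rw [map_mul, flip2_flip2]
    rw [e, nestedα, ← nestedCap_mul_incl34, nestAssoc, mul_assoc, h1, ← mul_assoc,
      ← map_mul (incl234 k H), h2, map_mul τ, h3, h5, map_mul (perm312 k H).symm,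
      perm312_symm_incl23, flip2_flip2,
      capPair_incl234_R_mul, map_mul (incl234 k H), mul_assoc, h4, ← map_mul (perm1324 k H)]
  rw [hl, hr, capPair_nestAssoc_eq]

lemma map_S_mul (s t : H ⊗[k] H) : TensorProduct.map Q.S Q.S (s * t) =
    TensorProduct.map Q.S Q.S t * TensorProduct.map Q.S Q.S s := by
  induction s using tmul_induction with
  | tmul a b =>
    induction t using tmul_induction with
    | tmul c d => simp [Q.S_mul]
    | add x y hx hy => simp only [map_add, add_mul, mul_add, hx, hy]
  | add x y hx hy => simp only [map_add, add_mul, mul_add, hx, hy]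

lemma map_S_monodromy_mul_nestedα :
    TensorProduct.map Q.S Q.S (flip2 k H (Q.monodromy : H ⊗[k] H)) * Q.nestedα =
      Q.nestedα * (Q.monodromy : H ⊗[k] H) := by
  have h1 : TensorProduct.map Q.S Q.S (flip2 k H (Q.R : H ⊗[k] H)) * flip2 k H Q.nestedα =
      Q.nestedα * flip2 k H (Q.R : H ⊗[k] H) := by
    have e : ∀ t : H ⊗[k] H, TensorProduct.map Q.S Q.S (flip2 k H t) =
        flip2 k H (TensorProduct.map Q.S Q.S t) := by
      intro t
      induction t using tmul_induction with
      | tmul a b => rfl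
      | add x y hx hy => simp only [map_add, hx, hy]
    rw [e, ← map_mul, map_S_R_mul_nestedα, map_mul, flip2_flip2]
  rw [monodromy_val, map_mul, flip2_flip2, map_S_mul, mul_assoc, map_S_R_mul_nestedα, ← mul_assoc,
    h1, mul_assoc]

/-- An inverse monodromy on the two legs that carry antipodes can be moved to the right of γ. One of
the two factors m⁻¹ in `comul_uSu` arises in this way. -/
lemma nestedCap_mul_monodromy_inv : Q.nestedCap (Q.nestAssoc *
    incl123 k H (incl12 k H ((Q.monodromy⁻¹ : (H ⊗[k] H)ˣ) : H ⊗[k] H))) =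
      Q.nestedα * ((Q.monodromy⁻¹ : (H ⊗[k] H)ˣ) : H ⊗[k] H) := by
  have h1 : TensorProduct.map Q.S Q.S
      (flip2 k H ((Q.monodromy⁻¹ : (H ⊗[k] H)ˣ) : H ⊗[k] H)) *
      TensorProduct.map Q.S Q.S (flip2 k H (Q.monodromy : H ⊗[k] H)) = 1 := by
    rw [← map_S_mul, ← map_mul, Units.mul_inv, map_one, Algebra.TensorProduct.one_def,
      TensorProduct.map_tmul, Q.S_one]
  rw [nestedCap_mul_incl12, ← nestedα, Units.eq_mul_inv_iff_mul_eq, mul_assoc,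
    ← map_S_monodromy_mul_nestedα, ← mul_assoc, h1, one_mul]

end QTQuasiHopfAlgebra

end

end QHopf

namespace QHopf

noncomputable section

/-! ### The comultiplication of `u S(u)` -/

namespace QTQuasiHopfAlgebra

open QuasiHopfAlgebra

variable {k : Type u} {H : Type w} [Field k] [Ring H] [Algebra k H] (Q : QTQuasiHopfAlgebra k H)

lemma capPair_monodromy_left_mul (t : H ⊗[k] (H ⊗[k] (H ⊗[k] H))) :
    Q.capPair (incl123 k H (incl12 k H (Q.monodromy : H ⊗[k] H)) * t) =
      ((Q.u * Q.S Q.u) ⊗ₜ 1) * Q.capPair t := by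
  have e : ∀ (c : H ⊗[k] H) (x y z w : H), Q.capPair (incl123 k H (incl12 k H c) *
      (x ⊗ₜ (y ⊗ₜ (z ⊗ₜ w)))) = (Q.S x * Q.cap Q.α c * y) ⊗ₜ (Q.S z * Q.α * w) := by
    intro c x y z w
    induction c using tmul_induction with
    | tmul a b =>
      change Q.capPair ((a ⊗ₜ (b ⊗ₜ (1 ⊗ₜ 1))) * (x ⊗ₜ (y ⊗ₜ (z ⊗ₜ w)))) = _
      simp [capPair_tmul, Q.S_mul, mul_assoc]
    | add x y hx hy => simp only [map_add, add_mul, mul_add, TensorProduct.add_tmul, hx, hy]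
  induction t using tmul₄_induction with
  | tmul x y z w =>
    rw [e, cap_monodromy, capPair_tmul, Algebra.TensorProduct.tmul_mul_tmul, one_mul,
      ← mul_assoc (Q.S x), ← uSu_central]
    simp only [mul_assoc]
  | add x y hx hy => simp only [map_add, mul_add, hx, hy]

lemma capPair_monodromy_right_mul (t : H ⊗[k] (H ⊗[k] (H ⊗[k] H))) :
    Q.capPair ((1 ⊗ₜ (1 ⊗ₜ (Q.monodromy : H ⊗[k] H))) * t) =
      (1 ⊗ₜ (Q.u * Q.S Q.u)) * Q.capPair t := by
  have e : ∀ (c : H ⊗[k] H) (x y z w : H), Q.capPair ((1 ⊗ₜ (1 ⊗ₜ c)) *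
      (x ⊗ₜ (y ⊗ₜ (z ⊗ₜ w)))) = (Q.S x * Q.α * y) ⊗ₜ (Q.S z * Q.cap Q.α c * w) := by
    intro c x y z w
    induction c using tmul_induction with
    | tmul a b => simp [capPair_tmul, Q.S_mul, mul_assoc]
    | add x y hx hy => simp only [map_add, add_mul, mul_add, TensorProduct.tmul_add, hx, hy]
  induction t using tmul₄_induction with
  | tmul x y z w =>
    rw [e, cap_monodromy, capPair_tmul, Algebra.TensorProduct.tmul_mul_tmul, one_mul,
      ← mul_assoc (Q.S z), ← uSu_central]
    simp only [mul_assoc]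
  | add x y hx hy => simp only [map_add, mul_add, hx, hy]

lemma comulRight_monodromy : comulRight Q.Δ (Q.monodromy : H ⊗[k] H) =
    (Q.Φ : H ⊗[k] (H ⊗[k] H)) * (incl12 k H (Q.monodromy : H ⊗[k] H) *
      comulLeft Q.Δ (Q.monodromy : H ⊗[k] H)) *
        ((Q.Φ⁻¹ : (H ⊗[k] (H ⊗[k] H))ˣ) : H ⊗[k] (H ⊗[k] H)) *
          incl23 k H ((Q.monodromy⁻¹ : (H ⊗[k] H)ˣ) : H ⊗[k] H) := by
  have e : incl23 k H (Q.monodromy : H ⊗[k] H) *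
      incl23 k H ((Q.monodromy⁻¹ : (H ⊗[k] H)ˣ) : H ⊗[k] H) = 1 := by
    rw [← map_mul, Units.mul_inv, map_one]
  rw [← mul_assoc (Q.Φ : H ⊗[k] (H ⊗[k] H)), monodromy_assoc, mul_assoc _ (Q.Φ : H ⊗[k] (H ⊗[k] H)),
    Units.mul_inv, mul_one, incl23_mul_comulRight_of_comm _ Q.monodromy_mul_comul, mul_assoc, e,
    mul_one]

/-- The monodromy between the blocks of legs 12 and 34 is split into pieces that the nested cap can
process: m on the inner pair of legs, a factor in the image of id ⊗ Δ ⊗ id whose middle coproduct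
the inner cap absorbs, and an inverse monodromy within each block. -/
lemma nestAssoc_mul_monodromy :
    Q.nestAssoc * Q.comul₃ (comulLeft Q.Δ (Q.monodromy : H ⊗[k] H)) =
      incl234 k H (incl12 k H (Q.monodromy : H ⊗[k] H)) *
        (Q.comul₂ ((1 ⊗ₜ (Q.monodromy : H ⊗[k] H)) * comulRight Q.Δ (Q.monodromy : H ⊗[k] H)) *
        (Q.nestAssoc *
          incl123 k H (incl12 k H ((Q.monodromy⁻¹ : (H ⊗[k] H)ˣ) : H ⊗[k] H)) *
          incl234 k H (incl23 k H ((Q.monodromy⁻¹ : (H ⊗[k] H)ˣ) : H ⊗[k] H)))) := by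
  set m := (Q.monodromy : H ⊗[k] H) with hm
  set m' := ((Q.monodromy⁻¹ : (H ⊗[k] H)ˣ) : H ⊗[k] H) with hm'
  have h1 : (Q.Φ : H ⊗[k] (H ⊗[k] H)) * comulLeft Q.Δ m =
      incl23 k H m * comulRight Q.Δ m * (Q.Φ : H ⊗[k] (H ⊗[k] H)) * incl12 k H m' := by
    have e : incl12 k H m * incl12 k H m' = 1 := by rw [← map_mul, Units.mul_inv, map_one]
    rw [← monodromy_assoc, mul_assoc _ (incl12 k H _),
      incl12_mul_comulLeft_of_comm _ Q.monodromy_mul_comul, mul_assoc, mul_assoc, e, mul_one]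
  have h2 : ∀ x : H ⊗[k] H, Q.comul₃ (incl12 k H x) = incl123 k H (incl12 k H x) := by
    intro x
    induction x using tmul_induction with
    | tmul a b =>
      change a ⊗ₜ[k] (b ⊗ₜ[k] Q.Δ 1) = a ⊗ₜ[k] (b ⊗ₜ[k] (1 ⊗ₜ[k] 1))
      rw [map_one]
      rfl
    | add x y hx hy => simp only [map_add, hx, hy]
  have h3 : ∀ s, incl234 k H (incl23 k H m') * Q.comul₃ s =
      Q.comul₃ s * incl234 k H (incl23 k H m') := by
    intro s
    induction s using tmul₃_induction with
    | tmul a b c =>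
      change (1 ⊗ₜ (1 ⊗ₜ m')) * (a ⊗ₜ[k] (b ⊗ₜ[k] Q.Δ c)) =
        (a ⊗ₜ[k] (b ⊗ₜ[k] Q.Δ c)) * (1 ⊗ₜ (1 ⊗ₜ m'))
      simp only [Algebra.TensorProduct.tmul_mul_tmul, one_mul, mul_one, hm',
        monodromy_inv_mul_comul]
    | add x y hx hy => simp only [map_add, mul_add, add_mul, hx, hy]
  have h4 : incl234 k H ((Q.Φ⁻¹ : (H ⊗[k] (H ⊗[k] H))ˣ) : H ⊗[k] (H ⊗[k] H)) *
      Q.comul₃ (incl23 k H m) = incl234 k H (incl12 k H m) * Q.comul₂ (1 ⊗ₜ m) *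
        incl234 k H ((Q.Φ⁻¹ : (H ⊗[k] (H ⊗[k] H))ˣ) : H ⊗[k] (H ⊗[k] H)) *
          incl234 k H (incl23 k H m') := by
    change _ * incl234 k H (comulRight Q.Δ m) = _ * incl234 k H (comulLeft Q.Δ m) * _ * _
    simp only [← map_mul]
    rw [hm, comulRight_monodromy]
    simp only [mul_assoc, Units.inv_mul_cancel_left]
    rfl
  rw [nestAssoc, mul_assoc, ← map_mul Q.comul₃, h1]
  simp only [map_mul Q.comul₃, map_mul Q.comul₂]
  rw [h2]
  simp only [← mul_assoc]
  rw [h4, mul_assoc _ (incl234 k H (incl23 k H m')), h3]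
  simp only [mul_assoc]
  rw [← h2, ← map_mul Q.comul₃, h3, ← mul_assoc (incl234 k H _) (Q.comul₃ (comulRight Q.Δ m)),
    incl234_reassociator_inv_mul, map_mul Q.comul₃]
  simp only [mul_assoc]

/-- `Δ(u S(u)) = (u S(u) ⊗ u S(u)) (R₂₁ R)⁻²`. -/
lemma comul_uSu : Q.Δ (Q.u * Q.S Q.u) =
    ((Q.u * Q.S Q.u) ⊗ₜ (Q.u * Q.S Q.u)) *
      (((Q.monodromy⁻¹ : (H ⊗[k] H)ˣ) : H ⊗[k] H) *
        ((Q.monodromy⁻¹ : (H ⊗[k] H)ˣ) : H ⊗[k] H)) := by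
  set a := Q.u * Q.S Q.u with ha
  set m := (Q.monodromy : H ⊗[k] H) with hm
  set m' := ((Q.monodromy⁻¹ : (H ⊗[k] H)ˣ) : H ⊗[k] H) with hm'
  have ca : ∀ h, a * h = h * a := Q.uSu_central
  have caa : ∀ t : H ⊗[k] H, (a ⊗ₜ a) * t = t * (a ⊗ₜ a) := by
    intro t
    induction t using tmul_induction with
    | tmul x y => simp [ca]
    | add x y hx hy => simp only [mul_add, add_mul, hx, hy]
  -- The same element is computed twice. As a whole the inserted m turns α into αa and gives γΔ(a).
  -- In pieces, the inner and outer caps produce a in the first and second leg, and each inverse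
  -- monodromy contributes m⁻¹ on the right of γ.
  have h1 : Q.nestedα * Q.Δ a = Q.nestedα * ((a ⊗ₜ a) * (m' * m')) := by
    have e1 : sw₂ Q.S Q.α (AlgHom.id k H).toLinearMap m = Q.α * a :=
      Q.cap_monodromy.trans (ca Q.α)
    have e2 : ∀ X, Q.nestedCap (incl234 k H (incl12 k H m) * X) =
        (a ⊗ₜ 1) * Q.nestedCap X := by
      intro X
      have e : ∀ x : H ⊗[k] H, permNest k H (incl234 k H (incl12 k H x)) =
          incl123 k H (incl12 k H x) := by
        intro x
        induction x using tmul_induction with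
        | tmul a b => rfl
        | add x y hx hy => simp only [map_add, hx, hy]
      rw [nestedCap_apply, map_mul (permNest k H), e, hm, capPair_monodromy_left_mul]
      rfl
    have e3 : Q.counitMiddle ((1 ⊗ₜ m) * comulRight Q.Δ m) = m := by
      rw [map_mul, counitMiddle_tmul, hm, counitLeft_monodromy, counitMiddle_comulRight]
      exact one_mul _
    rw [← nestedCap_nestAssoc_mul _ e1, hm, nestAssoc_mul_monodromy, e2, nestedCap_comul₂_mul, e3,
      capPair_monodromy_right_mul, ← nestedCap_apply, nestedCap_mul_incl34,
      nestedCap_mul_monodromy_inv, ← mul_assoc, Algebra.TensorProduct.tmul_mul_tmul, one_mul,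
      mul_one, mul_assoc Q.nestedα, ← mul_assoc, caa]
    simp only [mul_assoc, caa, hm']
  obtain ⟨v, hv⟩ := Q.isUnit_uSu.map Q.Δ
  have hv' : (v : H ⊗[k] H) = Q.Δ a := hv
  have cv : ∀ h, ((v⁻¹ : (H ⊗[k] H)ˣ) : H ⊗[k] H) * Q.Δ h =
      Q.Δ h * ((v⁻¹ : (H ⊗[k] H)ˣ) : H ⊗[k] H) := by
    intro h
    rw [Units.inv_mul_eq_iff_eq_mul, ← mul_assoc, hv', ← map_mul, ca, map_mul, ← hv', mul_assoc,
      Units.mul_inv, mul_one]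
  -- The quotient of the two sides commutes with Δ(H), which is what cancelling γ requires.
  have h2 : (a ⊗ₜ a) * (m' * m') * ((v⁻¹ : (H ⊗[k] H)ˣ) : H ⊗[k] H) = 1 := by
    refine Q.eq_one_of_nestedα_mul (fun h => ?_) ?_
    · have cm : ∀ h, m' * Q.Δ h = Q.Δ h * m' := Q.monodromy_inv_mul_comul
      rw [mul_assoc, cv, ← mul_assoc, mul_assoc _ (m' * m'), mul_assoc m', cm, ← mul_assoc m', cm,
        ← mul_assoc, ← mul_assoc, caa]
      simp only [mul_assoc, caa]
    · rw [← mul_assoc, ← h1, mul_assoc, ← hv', Units.mul_inv, mul_one]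
  rw [← hv', ← one_mul (v : H ⊗[k] H), ← h2, mul_assoc, Units.inv_mul, mul_one]

end QTQuasiHopfAlgebra

end

end QHopf

namespace QHopf

noncomputable section

/-! ### The algebra `H(θ)` and its structure maps -/

namespace HTheta

variable {k : Type u} {H : Type w} [Field k] [Ring H] [Algebra k H] (Q : QTQuasiHopfAlgebra k H)

variable {Q} in
-- The image of H and θ generate H(θ), so axioms stable under sums and products need to be checked
-- only there.
theorem induction {p : HTheta Q → Prop} (x : HTheta Q) (ι : ∀ h, p (ι Q h)) (θ : p (θ Q))
    (add : ∀ x y, p x → p y → p (x + y)) (mul : ∀ x y, p x → p y → p (x * y)) : p x := by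
  obtain ⟨f, rfl⟩ := RingQuot.mkAlgHom_surjective k (ThetaRel Q) x
  change p (proj Q f)
  induction f using Polynomial.induction_on with
  | C a => exact ι a
  | add f g hf hg =>
    rw [map_add]
    exact add _ _ hf hg
  | monomial n a h =>
    rw [pow_succ, ← mul_assoc, map_mul]
    exact mul _ _ h θ

lemma θ_mul (x : HTheta Q) : θ Q * x = x * θ Q := by
  obtain ⟨f, rfl⟩ := RingQuot.mkAlgHom_surjective k (ThetaRel Q) x
  change proj Q Polynomial.X * proj Q f = proj Q f * proj Q Polynomial.X
  rw [← map_mul, ← map_mul, Polynomial.X_mul]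

lemma θ_mul_θ : θ Q * θ Q = ι Q (Q.u * Q.S Q.u) := by
  change proj Q Polynomial.X * proj Q Polynomial.X = _
  rw [← map_mul, ← pow_two]
  exact RingQuot.mkAlgHom_rel k ThetaRel.theta_sq

variable {Q} in
lemma lift_ι {A : Type*} [Ring A] [Algebra k A] (f : H →ₐ[k] A) (a : A)
    (comm : ∀ h, Commute (f h) a) (sq : a * a = f (Q.u * Q.S Q.u)) (h : H) :
    lift f a comm sq (ι Q h) = f h := by
  refine (RingQuot.liftAlgHom_mkAlgHom_apply k _ _ _).trans ?_
  exact Polynomial.eval₂_C _ _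

variable {Q} in
lemma lift_θ {A : Type*} [Ring A] [Algebra k A] (f : H →ₐ[k] A) (a : A)
    (comm : ∀ h, Commute (f h) a) (sq : a * a = f (Q.u * Q.S Q.u)) :
    lift f a comm sq (θ Q) = a := by
  refine (RingQuot.liftAlgHom_mkAlgHom_apply k _ _ _).trans ?_
  exact Polynomial.eval₂_X _ _

lemma θ_tmul_θ_mul (t : HTheta Q ⊗[k] HTheta Q) :
    (θ Q ⊗ₜ[k] θ Q) * t = t * (θ Q ⊗ₜ[k] θ Q) := by
  induction t using tmul_induction with
  | tmul a b => simp [θ_mul]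
  | add x y hx hy => simp only [mul_add, add_mul, hx, hy]

/-- `ι ⊗ ι`. -/
def ι₂ : H ⊗[k] H →ₐ[k] HTheta Q ⊗[k] HTheta Q := Algebra.TensorProduct.map (ι Q) (ι Q)

/-- `ι ⊗ ι ⊗ ι`. -/
def ι₃ : H ⊗[k] (H ⊗[k] H) →ₐ[k] HTheta Q ⊗[k] (HTheta Q ⊗[k] HTheta Q) :=
  Algebra.TensorProduct.map (ι Q) (ι₂ Q)

/-- `ι ⊗ ι ⊗ ι ⊗ ι`. -/
def ι₄ : H ⊗[k] (H ⊗[k] (H ⊗[k] H)) →ₐ[k]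
    HTheta Q ⊗[k] (HTheta Q ⊗[k] (HTheta Q ⊗[k] HTheta Q)) :=
  Algebra.TensorProduct.map (ι Q) (ι₃ Q)

lemma ι₂_tmul (a b : H) : ι₂ Q (a ⊗ₜ b) = ι Q a ⊗ₜ ι Q b := rfl

lemma ι₃_tmul (a b c : H) : ι₃ Q (a ⊗ₜ (b ⊗ₜ c)) = ι Q a ⊗ₜ (ι Q b ⊗ₜ ι Q c) := rfl

/-- The comultiplication of `H(θ)`. -/
def comul : HTheta Q →ₐ[k] HTheta Q ⊗[k] HTheta Q :=
  lift ((ι₂ Q).comp Q.Δ)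
    ((θ Q ⊗ₜ[k] θ Q) * ι₂ Q ((Q.monodromy⁻¹ : (H ⊗[k] H)ˣ) : H ⊗[k] H))
    (fun h => by
      rw [commute_iff_eq, AlgHom.comp_apply, ← mul_assoc, ← θ_tmul_θ_mul, mul_assoc, mul_assoc,
        ← map_mul, ← map_mul, Q.monodromy_inv_mul_comul])
    -- Compatibility with θ² = u S(u) is exactly `comul_uSu`, as θ ⊗ θ commutes with everything.
    (by
      rw [AlgHom.comp_apply, Q.comul_uSu, mul_assoc, ← mul_assoc (ι₂ Q _), ← θ_tmul_θ_mul,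
        mul_assoc (θ Q ⊗ₜ[k] θ Q), ← mul_assoc, Algebra.TensorProduct.tmul_mul_tmul, θ_mul_θ,
        ← ι₂_tmul, ← map_mul, ← map_mul])

lemma comul_ι (h : H) : comul Q (ι Q h) = ι₂ Q (Q.Δ h) := lift_ι _ _ _ _ _

lemma comul_θ : comul Q (θ Q) =
    (θ Q ⊗ₜ[k] θ Q) * ι₂ Q ((Q.monodromy⁻¹ : (H ⊗[k] H)ˣ) : H ⊗[k] H) := lift_θ _ _ _ _

/-- The counit of `H(θ)`. -/
def counit : HTheta Q →ₐ[k] k :=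
  lift Q.counit 1 (fun _ => Commute.one_right _) (by rw [Q.counit_uSu, mul_one])

lemma counit_ι (h : H) : counit Q (ι Q h) = Q.counit h := lift_ι _ _ _ _ _

lemma counit_θ : counit Q (θ Q) = 1 := lift_θ _ _ _ _

/-- The antipode of `H(θ)`, as an algebra map to the opposite algebra. -/
def antipodeOp : HTheta Q →ₐ[k] (HTheta Q)ᵐᵒᵖ :=
  lift ((AlgHom.op (ι Q)).comp Q.SOp) (MulOpposite.op (θ Q))
    (fun h => by
      change MulOpposite.op (ι Q (Q.S h)) * MulOpposite.op (θ Q) =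
        MulOpposite.op (θ Q) * MulOpposite.op (ι Q (Q.S h))
      rw [← MulOpposite.op_mul, ← MulOpposite.op_mul, θ_mul])
    (by
      change MulOpposite.op (θ Q) * MulOpposite.op (θ Q) =
        MulOpposite.op (ι Q (Q.S (Q.u * Q.S Q.u)))
      rw [← MulOpposite.op_mul, θ_mul_θ, Q.S_uSu])

/-- The antipode of `H(θ)`. -/
def antipode : HTheta Q →ₗ[k] HTheta Q :=
  (MulOpposite.opLinearEquiv k).symm.toLinearMap ∘ₗ (antipodeOp Q).toLinearMap

lemma antipode_ι (h : H) : antipode Q (ι Q h) = ι Q (Q.S h) :=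
  congrArg MulOpposite.unop (lift_ι _ _ _ _ _)

lemma antipode_θ : antipode Q (θ Q) = θ Q :=
  congrArg MulOpposite.unop (lift_θ _ _ _ _)

lemma antipode_one : antipode Q 1 = 1 :=
  congrArg MulOpposite.unop (map_one (antipodeOp Q))

lemma antipode_mul (x y : HTheta Q) : antipode Q (x * y) = antipode Q y * antipode Q x :=
  congrArg MulOpposite.unop (map_mul (antipodeOp Q) x y)

/-! ### Compatibility of the structure maps with `ι` -/

lemma ι₃_assoc (s : H ⊗[k] H) (b : H) :
    ι₃ Q (TensorProduct.assoc k H H H (s ⊗ₜ b)) =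
      TensorProduct.assoc k _ _ _ (ι₂ Q s ⊗ₜ ι Q b) := by
  induction s using tmul_induction with
  | tmul a c => rfl
  | add x y hx hy => simp only [map_add, TensorProduct.add_tmul, hx, hy]

lemma ι₄_assoc (s p : H ⊗[k] H) :
    ι₄ Q (TensorProduct.assoc k H H (H ⊗[k] H) (s ⊗ₜ p)) =
      TensorProduct.assoc k _ _ _ (ι₂ Q s ⊗ₜ ι₂ Q p) := by
  induction s using tmul_induction with
  | tmul a c => rfl
  | add x y hx hy => simp only [map_add, TensorProduct.add_tmul, hx, hy]

lemma comulLeft_ι₂ (t : H ⊗[k] H) : comulLeft (comul Q) (ι₂ Q t) = ι₃ Q (comulLeft Q.Δ t) := by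
  induction t using tmul_induction with
  | tmul a b =>
    rw [QuasiHopfAlgebra.comulLeft_tmul, ι₃_assoc, ← comul_ι]
    rfl
  | add x y hx hy => simp only [map_add, hx, hy]

lemma comulRight_ι₂ (t : H ⊗[k] H) :
    comulRight (comul Q) (ι₂ Q t) = ι₃ Q (comulRight Q.Δ t) := by
  induction t using tmul_induction with
  | tmul a b =>
    change ι Q a ⊗ₜ[k] comul Q (ι Q b) = ι Q a ⊗ₜ[k] ι₂ Q (Q.Δ b)
    rw [comul_ι]
  | add x y hx hy => simp only [map_add, hx, hy]

lemma incl12_ι₂ (t : H ⊗[k] H) : incl12 k _ (ι₂ Q t) = ι₃ Q (incl12 k H t) := by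
  induction t using tmul_induction with
  | tmul a b => simp [incl12_tmul, ι₂_tmul, ι₃_tmul]
  | add x y hx hy => simp only [map_add, hx, hy]

lemma incl13_ι₂ (t : H ⊗[k] H) : incl13 k _ (ι₂ Q t) = ι₃ Q (incl13 k H t) := by
  induction t using tmul_induction with
  | tmul a b => simp [incl13_tmul, ι₂_tmul, ι₃_tmul]
  | add x y hx hy => simp only [map_add, hx, hy]

lemma incl23_ι₂ (t : H ⊗[k] H) : incl23 k _ (ι₂ Q t) = ι₃ Q (incl23 k H t) := by
  induction t using tmul_induction with
  | tmul a b => simp [incl23_tmul, ι₂_tmul, ι₃_tmul]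
  | add x y hx hy => simp only [map_add, hx, hy]

lemma flip2_ι₂ (t : H ⊗[k] H) : flip2 k _ (ι₂ Q t) = ι₂ Q (flip2 k H t) := by
  induction t using tmul_induction with
  | tmul a b => rfl
  | add x y hx hy => simp only [map_add, hx, hy]

lemma perm312_ι₃ (t : H ⊗[k] (H ⊗[k] H)) : perm312 k _ (ι₃ Q t) = ι₃ Q (perm312 k H t) := by
  induction t using tmul₃_induction with
  | tmul a b c => rfl
  | add x y hx hy => simp only [map_add, hx, hy]

lemma perm312_symm_ι₃ (t : H ⊗[k] (H ⊗[k] H)) :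
    (perm312 k _).symm (ι₃ Q t) = ι₃ Q ((perm312 k H).symm t) := by
  rw [AlgEquiv.symm_apply_eq, perm312_ι₃, AlgEquiv.apply_symm_apply]

lemma perm132_ι₃ (t : H ⊗[k] (H ⊗[k] H)) : perm132 k _ (ι₃ Q t) = ι₃ Q (perm132 k H t) := by
  induction t using tmul₃_induction with
  | tmul a b c => rfl
  | add x y hx hy => simp only [map_add, hx, hy]

lemma perm213_ι₃ (t : H ⊗[k] (H ⊗[k] H)) : perm213 k _ (ι₃ Q t) = ι₃ Q (perm213 k H t) := by
  induction t using tmul₃_induction with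
  | tmul a b c => rfl
  | add x y hx hy => simp only [map_add, hx, hy]

lemma sw₂_antipode_ι₂ (x : H) (t : H ⊗[k] H) :
    sw₂ (antipode Q) (ι Q x) (AlgHom.id k _).toLinearMap (ι₂ Q t) = ι Q (Q.cap x t) := by
  induction t using tmul_induction with
  | tmul a b => simp [ι₂_tmul, antipode_ι]
  | add x y hx hy => simp only [map_add, hx, hy]

lemma sw₂_ι₂_antipode (x : H) (t : H ⊗[k] H) :
    sw₂ (AlgHom.id k _).toLinearMap (ι Q x) (antipode Q) (ι₂ Q t) = ι Q (Q.cup x t) := by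
  induction t using tmul_induction with
  | tmul a b => simp [ι₂_tmul, antipode_ι]
  | add x y hx hy => simp only [map_add, hx, hy]

/-! ### Antipode axioms for `H(θ)` and coproducts of `θ ⊗ θ` -/

lemma antipode_left (x : HTheta Q) :
    sw₂ (antipode Q) (ι Q Q.α) (AlgHom.id k _).toLinearMap (comul Q x) =
      counit Q x • ι Q Q.α := by
  induction x using induction with
  | ι h => rw [comul_ι, sw₂_antipode_ι₂, Q.cap_comul, map_smul, counit_ι]
  -- Both legs contribute a central θ, as S(θ) = θ; the resulting θ² = u S(u) cancels against the
  -- cap of m⁻¹.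
  | θ =>
    have e : ∀ t, sw₂ (antipode Q) (ι Q Q.α) (AlgHom.id k _).toLinearMap
        ((θ Q ⊗ₜ[k] θ Q) * ι₂ Q t) = θ Q * θ Q * ι Q (Q.cap Q.α t) := by
      intro t
      induction t using tmul_induction with
      | tmul a b =>
        rw [ι₂_tmul, Algebra.TensorProduct.tmul_mul_tmul, sw₂_tmul, antipode_mul, antipode_θ,
          antipode_ι, AlgHom.toLinearMap_apply, AlgHom.id_apply, ← θ_mul, sw₂_tmul, map_mul,
          map_mul, AlgHom.toLinearMap_apply, AlgHom.id_apply, mul_assoc, mul_assoc,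
          ← mul_assoc (ι Q Q.α), ← θ_mul, mul_assoc (θ Q), ← mul_assoc (ι Q (Q.S a)), ← θ_mul]
        simp only [mul_assoc]
      | add x y hx hy => simp only [map_add, mul_add, hx, hy]
    rw [comul_θ, e, θ_mul_θ, ← map_mul, Q.uSu_mul_cap_monodromy_inv, counit_θ, one_smul]
  | add x y hx hy => simp only [map_add, add_smul, hx, hy]
  | mul x y hx hy =>
    rw [map_mul, sw₂_mul_cap (antipode_mul Q), hx, sw₂_smul, hy, map_mul, mul_smul]

lemma antipode_right (x : HTheta Q) :
    sw₂ (AlgHom.id k _).toLinearMap (ι Q Q.β) (antipode Q) (comul Q x) =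
      counit Q x • ι Q Q.β := by
  induction x using induction with
  | ι h => rw [comul_ι, sw₂_ι₂_antipode, Q.cup_comul, map_smul, counit_ι]
  | θ =>
    have e : ∀ t, sw₂ (AlgHom.id k _).toLinearMap (ι Q Q.β) (antipode Q)
        ((θ Q ⊗ₜ[k] θ Q) * ι₂ Q t) = θ Q * θ Q * ι Q (Q.cup Q.β t) := by
      intro t
      induction t using tmul_induction with
      | tmul a b =>
        rw [ι₂_tmul, Algebra.TensorProduct.tmul_mul_tmul, sw₂_tmul, antipode_mul, antipode_θ,
          antipode_ι, AlgHom.toLinearMap_apply, AlgHom.id_apply, ← θ_mul, sw₂_tmul, map_mul,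
          map_mul, AlgHom.toLinearMap_apply, AlgHom.id_apply, mul_assoc, mul_assoc,
          ← mul_assoc (ι Q Q.β), ← θ_mul, mul_assoc (θ Q), ← mul_assoc (ι Q a), ← θ_mul]
        simp only [mul_assoc]
      | add x y hx hy => simp only [map_add, mul_add, hx, hy]
    rw [comul_θ, e, θ_mul_θ, ← map_mul, Q.uSu_mul_cup_monodromy_inv, counit_θ, one_smul]
  | add x y hx hy => simp only [map_add, add_smul, hx, hy]
  | mul x y hx hy =>
    rw [map_mul, sw₂_mul_cup (antipode_mul Q), hy, sw₂_smul, hx, map_mul, mul_smul, smul_comm]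

lemma comulLeft_θ_tmul_θ : comulLeft (comul Q) (θ Q ⊗ₜ θ Q) =
    (θ Q ⊗ₜ (θ Q ⊗ₜ θ Q)) *
      ι₃ Q (incl12 k H ((Q.monodromy⁻¹ : (H ⊗[k] H)ˣ) : H ⊗[k] H)) := by
  rw [QuasiHopfAlgebra.comulLeft_tmul, comul_θ]
  generalize ((Q.monodromy⁻¹ : (H ⊗[k] H)ˣ) : H ⊗[k] H) = t
  induction t using tmul_induction with
  | tmul a b => simp [incl12_tmul, ι₂_tmul, ι₃_tmul]
  | add x y hx hy => simp only [map_add, mul_add, TensorProduct.add_tmul, hx, hy]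

lemma comulRight_θ_tmul_θ : comulRight (comul Q) (θ Q ⊗ₜ θ Q) =
    (θ Q ⊗ₜ (θ Q ⊗ₜ θ Q)) *
      ι₃ Q (incl23 k H ((Q.monodromy⁻¹ : (H ⊗[k] H)ˣ) : H ⊗[k] H)) := by
  rw [QuasiHopfAlgebra.comulRight_tmul, comul_θ]
  generalize ((Q.monodromy⁻¹ : (H ⊗[k] H)ˣ) : H ⊗[k] H) = t
  induction t using tmul_induction with
  | tmul a b => simp [incl23_tmul, ι₂_tmul, ι₃_tmul]
  | add x y hx hy => simp only [map_add, mul_add, TensorProduct.tmul_add, hx, hy]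

lemma θ₃_mul (t : HTheta Q ⊗[k] (HTheta Q ⊗[k] HTheta Q)) :
    (θ Q ⊗ₜ[k] (θ Q ⊗ₜ[k] θ Q)) * t = t * (θ Q ⊗ₜ[k] (θ Q ⊗ₜ[k] θ Q)) := by
  induction t using tmul₃_induction with
  | tmul a b c => simp [θ_mul]
  | add x y hx hy => simp only [mul_add, add_mul, hx, hy]

end HTheta

/-! ### Identities for the inverse monodromy -/

namespace QTQuasiHopfAlgebra

variable {k : Type u} {H : Type w} [Field k] [Ring H] [Algebra k H] (Q : QTQuasiHopfAlgebra k H)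

/-- This is quasi-coassociativity at θ. The two monodromy factors on each side of `monodromy_assoc`
commute, so their order survives inversion. -/
lemma monodromy_inv_assoc :
    incl23 k H ((Q.monodromy⁻¹ : (H ⊗[k] H)ˣ) : H ⊗[k] H) *
      comulRight Q.Δ ((Q.monodromy⁻¹ : (H ⊗[k] H)ˣ) : H ⊗[k] H) * (Q.Φ : H ⊗[k] (H ⊗[k] H)) =
    (Q.Φ : H ⊗[k] (H ⊗[k] H)) * (incl12 k H ((Q.monodromy⁻¹ : (H ⊗[k] H)ˣ) : H ⊗[k] H) *
      comulLeft Q.Δ ((Q.monodromy⁻¹ : (H ⊗[k] H)ˣ) : H ⊗[k] H)) := by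
  set a : (H ⊗[k] (H ⊗[k] H))ˣ := Units.map (incl12 k H).toMonoidHom Q.monodromy with ha
  set b : (H ⊗[k] (H ⊗[k] H))ˣ := Units.map (comulLeft Q.Δ).toMonoidHom Q.monodromy with hb
  set c : (H ⊗[k] (H ⊗[k] H))ˣ := Units.map (incl23 k H).toMonoidHom Q.monodromy with hc
  set d : (H ⊗[k] (H ⊗[k] H))ˣ := Units.map (comulRight Q.Δ).toMonoidHom Q.monodromy with hd
  have h : Q.Φ * a * b = c * d * Q.Φ := Units.ext Q.monodromy_assoc
  have c1 : a * b = b * a :=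
    Units.ext (Q.incl12_mul_comulLeft_of_comm Q.monodromy_mul_comul (Q.monodromy : H ⊗[k] H))
  have c2 : c * d = d * c :=
    Units.ext (Q.incl23_mul_comulRight_of_comm Q.monodromy_mul_comul (Q.monodromy : H ⊗[k] H))
  have h' : c⁻¹ * d⁻¹ * Q.Φ = Q.Φ * (a⁻¹ * b⁻¹) := by
    rw [← mul_inv_rev, ← mul_inv_rev, inv_mul_eq_iff_eq_mul, ← mul_assoc, eq_mul_inv_iff_mul_eq,
      ← c1, ← c2, ← mul_assoc, h]
  exact congrArg Units.val h'

/-- Needed for Δᶜᵒᵖ(θ)R = RΔ(θ); before inversion it reads m₂₁R = RR₂₁R = Rm. -/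
lemma flip2_monodromy_inv_mul_R :
    flip2 k H ((Q.monodromy⁻¹ : (H ⊗[k] H)ˣ) : H ⊗[k] H) * (Q.R : H ⊗[k] H) =
      (Q.R : H ⊗[k] H) * ((Q.monodromy⁻¹ : (H ⊗[k] H)ˣ) : H ⊗[k] H) := by
  have e : flip2 k H ((Q.monodromy⁻¹ : (H ⊗[k] H)ˣ) : H ⊗[k] H) *
      flip2 k H (Q.monodromy : H ⊗[k] H) = 1 := by rw [← map_mul, Units.inv_mul, map_one]
  have h : flip2 k H (Q.monodromy : H ⊗[k] H) * (Q.R : H ⊗[k] H) =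
      (Q.R : H ⊗[k] H) * (Q.monodromy : H ⊗[k] H) := by
    rw [monodromy_val, map_mul, flip2_flip2, mul_assoc]
  rw [Units.eq_mul_inv_iff_mul_eq, mul_assoc, ← h, ← mul_assoc, e, one_mul]

end QTQuasiHopfAlgebra

end

end QHopf

namespace QHopf

noncomputable section

/-! ### The quasitriangular quasi-Hopf algebra `H(θ)` -/

namespace HTheta

variable {k : Type u} {H : Type w} [Field k] [Ring H] [Algebra k H] (Q : QTQuasiHopfAlgebra k H)

/-- The reassociator of `H(θ)`. -/
def reassociator : (HTheta Q ⊗[k] (HTheta Q ⊗[k] HTheta Q))ˣ :=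
  Units.map (ι₃ Q : _ →* _) Q.Φ

lemma reassociator_val : (reassociator Q : HTheta Q ⊗[k] (HTheta Q ⊗[k] HTheta Q)) =
    ι₃ Q (Q.Φ : H ⊗[k] (H ⊗[k] H)) := rfl

lemma reassociator_inv_val :
    (((reassociator Q)⁻¹ : (HTheta Q ⊗[k] (HTheta Q ⊗[k] HTheta Q))ˣ) :
      HTheta Q ⊗[k] (HTheta Q ⊗[k] HTheta Q)) =
    ι₃ Q ((Q.Φ⁻¹ : (H ⊗[k] (H ⊗[k] H))ˣ) : H ⊗[k] (H ⊗[k] H)) := rfl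

lemma quasi_coassoc (x : HTheta Q) : comulRight (comul Q) (comul Q x) *
      (reassociator Q : HTheta Q ⊗[k] (HTheta Q ⊗[k] HTheta Q)) =
    (reassociator Q : HTheta Q ⊗[k] (HTheta Q ⊗[k] HTheta Q)) *
      comulLeft (comul Q) (comul Q x) := by
  induction x using induction with
  | ι h =>
    rw [comul_ι, comulRight_ι₂, comulLeft_ι₂, reassociator_val, ← map_mul, ← map_mul,
      Q.reassociator_mul_comulLeft_comul]
  | θ =>
    rw [comul_θ, map_mul, map_mul, comulLeft_θ_tmul_θ, comulRight_θ_tmul_θ, comulRight_ι₂,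
      comulLeft_ι₂, reassociator_val, mul_assoc, mul_assoc, mul_assoc, ← map_mul, ← map_mul,
      ← mul_assoc (incl23 k H _), Q.monodromy_inv_assoc, ← map_mul (ι₃ Q) (incl12 k H _),
      ← mul_assoc (ι₃ Q _), ← θ₃_mul, mul_assoc, ← map_mul]
  | add x y hx hy => simp only [map_add, mul_add, add_mul, hx, hy]
  | mul x y hx hy =>
    rw [map_mul, map_mul, map_mul, mul_assoc, hy, ← mul_assoc, hx, mul_assoc]

lemma counitRight_comul (x : HTheta Q) : TensorProduct.rid k (HTheta Q)
    (Algebra.TensorProduct.map (AlgHom.id k (HTheta Q)) (counit Q) (comul Q x)) = x := by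
  set F : HTheta Q ⊗[k] HTheta Q →ₐ[k] HTheta Q :=
    (Algebra.TensorProduct.rid k k (HTheta Q)).toAlgHom.comp
      (Algebra.TensorProduct.map (AlgHom.id k (HTheta Q)) (counit Q)) with hF
  have h1 : ∀ t, F (ι₂ Q t) = ι Q (Q.counitRight H t) := by
    intro t
    induction t using tmul_induction with
    | tmul a b => simp [hF, ι₂_tmul, counit_ι]
    | add x y hx hy => simp only [map_add, hx, hy]
  change F (comul Q x) = x
  induction x using induction with
  | ι h => rw [comul_ι, h1, Q.counitRight_comul]
  | θ =>
    rw [comul_θ, map_mul, h1, Q.counitRight_monodromy_inv, map_one, mul_one]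
    simp [hF, counit_θ]
  | add x y hx hy => simp only [map_add, hx, hy]
  | mul x y hx hy => simp only [map_mul, hx, hy]

lemma counitLeft_comul (x : HTheta Q) : TensorProduct.lid k (HTheta Q)
    (Algebra.TensorProduct.map (counit Q) (AlgHom.id k (HTheta Q)) (comul Q x)) = x := by
  set F : HTheta Q ⊗[k] HTheta Q →ₐ[k] HTheta Q :=
    (Algebra.TensorProduct.lid k (HTheta Q)).toAlgHom.comp
      (Algebra.TensorProduct.map (counit Q) (AlgHom.id k (HTheta Q))) with hF
  have h1 : ∀ t, F (ι₂ Q t) = ι Q (Q.counitLeft H t) := by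
    intro t
    induction t using tmul_induction with
    | tmul a b => simp [hF, ι₂_tmul, counit_ι]
    | add x y hx hy => simp only [map_add, hx, hy]
  change F (comul Q x) = x
  induction x using induction with
  | ι h => rw [comul_ι, h1, Q.counitLeft_comul]
  | θ =>
    rw [comul_θ, map_mul, h1, Q.counitLeft_monodromy_inv, map_one, mul_one]
    simp [hF, counit_θ]
  | add x y hx hy => simp only [map_add, hx, hy]
  | mul x y hx hy => simp only [map_mul, hx, hy]

lemma cocycle :
    (Algebra.TensorProduct.includeRight (ι₃ Q (Q.Φ : H ⊗[k] (H ⊗[k] H))) :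
        HTheta Q ⊗[k] (HTheta Q ⊗[k] (HTheta Q ⊗[k] HTheta Q))) *
      Algebra.TensorProduct.map (AlgHom.id k _) (comulLeft (comul Q))
        (ι₃ Q (Q.Φ : H ⊗[k] (H ⊗[k] H))) *
      Algebra.TensorProduct.map (AlgHom.id k _) (incl12 k _) (ι₃ Q (Q.Φ : H ⊗[k] (H ⊗[k] H))) =
    Algebra.TensorProduct.map (AlgHom.id k _) (comulRight (comul Q))
        (ι₃ Q (Q.Φ : H ⊗[k] (H ⊗[k] H))) *
      Algebra.TensorProduct.assoc k k k _ _ (HTheta Q ⊗[k] HTheta Q)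
        (Algebra.TensorProduct.map (comul Q) (AlgHom.id k (HTheta Q ⊗[k] HTheta Q))
          (ι₃ Q (Q.Φ : H ⊗[k] (H ⊗[k] H)))) := by
  have h1 : ∀ s, (Algebra.TensorProduct.includeRight (ι₃ Q s) :
      HTheta Q ⊗[k] (HTheta Q ⊗[k] (HTheta Q ⊗[k] HTheta Q))) =
      ι₄ Q (Algebra.TensorProduct.includeRight s) := by
    intro s
    change 1 ⊗ₜ[k] ι₃ Q s = ι Q 1 ⊗ₜ[k] ι₃ Q s
    rw [map_one]
  have h2 : ∀ s, Algebra.TensorProduct.map (AlgHom.id k _) (comulLeft (comul Q)) (ι₃ Q s) =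
      ι₄ Q (Algebra.TensorProduct.map (AlgHom.id k H) (comulLeft Q.Δ) s) := by
    intro s
    induction s using tmul_induction with
    | tmul a t => exact congrArg (ι Q a ⊗ₜ[k] ·) (comulLeft_ι₂ Q t)
    | add x y hx hy => simp only [map_add, hx, hy]
  have h3 : ∀ s, Algebra.TensorProduct.map (AlgHom.id k _) (incl12 k _) (ι₃ Q s) =
      ι₄ Q (Algebra.TensorProduct.map (AlgHom.id k H) (incl12 k H) s) := by
    intro s
    induction s using tmul_induction with
    | tmul a t => exact congrArg (ι Q a ⊗ₜ[k] ·) (incl12_ι₂ Q t)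
    | add x y hx hy => simp only [map_add, hx, hy]
  have h4 : ∀ s, Algebra.TensorProduct.map (AlgHom.id k _) (comulRight (comul Q)) (ι₃ Q s) =
      ι₄ Q (Algebra.TensorProduct.map (AlgHom.id k H) (comulRight Q.Δ) s) := by
    intro s
    induction s using tmul_induction with
    | tmul a t => exact congrArg (ι Q a ⊗ₜ[k] ·) (comulRight_ι₂ Q t)
    | add x y hx hy => simp only [map_add, hx, hy]
  have h5 : ∀ s, Algebra.TensorProduct.assoc k k k _ _ (HTheta Q ⊗[k] HTheta Q)
        (Algebra.TensorProduct.map (comul Q) (AlgHom.id k (HTheta Q ⊗[k] HTheta Q)) (ι₃ Q s)) =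
      ι₄ Q (Algebra.TensorProduct.assoc k k k H H (H ⊗[k] H)
        (Algebra.TensorProduct.map Q.Δ (AlgHom.id k (H ⊗[k] H)) s)) := by
    intro s
    induction s using tmul_induction with
    | tmul a t =>
      change TensorProduct.assoc k _ _ _ (comul Q (ι Q a) ⊗ₜ ι₂ Q t) =
        ι₄ Q (TensorProduct.assoc k H H (H ⊗[k] H) (Q.Δ a ⊗ₜ t))
      rw [ι₄_assoc, comul_ι]
    | add x y hx hy => simp only [map_add, hx, hy]
  rw [h1, h2, h3, h4, h5, ← map_mul, ← map_mul, ← map_mul, Q.cocycle]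

/-- The quasi-Hopf algebra `H(θ)`. -/
def quasiHopfAlgebra : QuasiHopfAlgebra k (HTheta Q) where
  Δ := comul Q
  counit := counit Q
  Φ := reassociator Q
  S := antipode Q
  α := ι Q Q.α
  β := ι Q Q.β
  quasi_coassoc x := by rw [Units.eq_mul_inv_iff_mul_eq, quasi_coassoc]
  id_counit := counitRight_comul Q
  counit_id := counitLeft_comul Q
  cocycle := cocycle Q
  counit_reassociator := by
    rw [reassociator_val, ← map_one (ι₂ Q), ← Q.counit_reassociator]
    generalize (Q.Φ : H ⊗[k] (H ⊗[k] H)) = s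
    induction s using tmul₃_induction with
    | tmul a b c => simp [ι₂_tmul, ι₃_tmul, counit_ι]
    | add x y hx hy => simp only [_root_.map_add, hx, hy]
  S_one := antipode_one Q
  S_mul := antipode_mul Q
  antipode_left x := by
    rw [← antipode_left]
    generalize comul Q x = t
    induction t using tmul_induction with
    | tmul a b => simp [mulMap, mul_assoc]
    | add x y hx hy => simp only [_root_.map_add, hx, hy]
  antipode_right x := by
    rw [← antipode_right]
    generalize comul Q x = t
    induction t using tmul_induction with
    | tmul a b => simp [mulMap]
    | add x y hx hy => simp only [_root_.map_add, hx, hy]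
  reassociator_antipode := by
    rw [reassociator_val, ← map_one (ι Q), ← Q.reassociator_antipode]
    generalize (Q.Φ : H ⊗[k] (H ⊗[k] H)) = s
    induction s using tmul₃_induction with
    | tmul a b c => simp [ι₃_tmul, mulMap₃, mulMap, antipode_ι]
    | add x y hx hy => simp only [_root_.map_add, hx, hy]
  reassociator_inv_antipode := by
    rw [reassociator_inv_val, ← map_one (ι Q), ← Q.reassociator_inv_antipode]
    generalize ((Q.Φ⁻¹ : (H ⊗[k] (H ⊗[k] H))ˣ) : H ⊗[k] (H ⊗[k] H)) = s
    induction s using tmul₃_induction with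
    | tmul a b c => simp [ι₃_tmul, mulMap₃, mulMap, antipode_ι]
    | add x y hx hy => simp only [_root_.map_add, hx, hy]

lemma flip2_comul_mul_R (x : HTheta Q) :
    flip2 k _ (comul Q x) * ι₂ Q (Q.R : H ⊗[k] H) = ι₂ Q (Q.R : H ⊗[k] H) * comul Q x := by
  induction x using induction with
  | ι h => rw [comul_ι, flip2_ι₂, ← map_mul, Q.comul_op, map_mul]
  | θ =>
    rw [comul_θ, map_mul, flip2_ι₂, flip2_tmul, mul_assoc, ← map_mul,
      Q.flip2_monodromy_inv_mul_R, map_mul, ← mul_assoc, θ_tmul_θ_mul, mul_assoc]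
  | add x y hx hy => simp only [map_add, mul_add, add_mul, hx, hy]
  | mul x y hx hy => rw [map_mul, map_mul, mul_assoc, hy, ← mul_assoc, hx, mul_assoc]

/-- The `R`-matrix of `H(θ)`. -/
def rMatrix : (HTheta Q ⊗[k] HTheta Q)ˣ := Units.map (ι₂ Q : _ →* _) Q.R

/-- The quasitriangular quasi-Hopf algebra `H(θ)`. -/
def qtQuasiHopfAlgebra : QTQuasiHopfAlgebra k (HTheta Q) where
  toQuasiHopfAlgebra := quasiHopfAlgebra Q
  R := rMatrix Q
  comul_id_R := by
    change comulLeft (comul Q) (ι₂ Q (Q.R : H ⊗[k] H)) =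
      perm312 k _ (ι₃ Q (Q.Φ : H ⊗[k] (H ⊗[k] H))) * incl13 k _ (ι₂ Q (Q.R : H ⊗[k] H)) *
      perm132 k _ (ι₃ Q ((Q.Φ⁻¹ : (H ⊗[k] (H ⊗[k] H))ˣ) : H ⊗[k] (H ⊗[k] H))) *
      incl23 k _ (ι₂ Q (Q.R : H ⊗[k] H)) * ι₃ Q (Q.Φ : H ⊗[k] (H ⊗[k] H))
    rw [comulLeft_ι₂, perm312_ι₃, incl13_ι₂, perm132_ι₃, incl23_ι₂, Q.comul_id_R]
    simp only [map_mul (ι₃ Q)]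
  id_comul_R := by
    change comulRight (comul Q) (ι₂ Q (Q.R : H ⊗[k] H)) =
      (perm312 k _).symm (ι₃ Q ((Q.Φ⁻¹ : (H ⊗[k] (H ⊗[k] H))ˣ) : H ⊗[k] (H ⊗[k] H))) *
      incl13 k _ (ι₂ Q (Q.R : H ⊗[k] H)) * perm213 k _ (ι₃ Q (Q.Φ : H ⊗[k] (H ⊗[k] H))) *
      incl12 k _ (ι₂ Q (Q.R : H ⊗[k] H)) *
      ι₃ Q ((Q.Φ⁻¹ : (H ⊗[k] (H ⊗[k] H))ˣ) : H ⊗[k] (H ⊗[k] H))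
    rw [comulRight_ι₂, perm312_symm_ι₃, incl13_ι₂, perm213_ι₃, incl12_ι₂, Q.id_comul_R]
    simp only [map_mul (ι₃ Q)]
  comul_op := flip2_comul_mul_R Q

lemma isExtension : IsExtension Q (qtQuasiHopfAlgebra Q) where
  Δ_ι := comul_ι Q
  Δ_θ := comul_θ Q
  counit_ι := counit_ι Q
  counit_θ := counit_θ Q
  S_ι := antipode_ι Q
  S_θ := antipode_θ Q
  Φ_eq := rfl
  α_eq := rfl
  β_eq := rfl
  R_eq := rfl

/-- A factor of an invertible product of commuting elements is invertible, and θ² is the image of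
the invertible u S(u). -/
lemma isUnit_θ : IsUnit (θ Q) := by
  have h : IsUnit (θ Q * θ Q) := by
    rw [θ_mul_θ]
    exact Q.isUnit_uSu.map (ι Q)
  exact ((Commute.refl (θ Q)).isUnit_mul_iff.1 h).1

/-- `θ` as a unit of `H(θ)`. -/
def θUnit : (HTheta Q)ˣ := (isUnit_θ Q).unit

lemma θUnit_val : (θUnit Q : HTheta Q) = θ Q := rfl

lemma isRibbonElement : (qtQuasiHopfAlgebra Q).IsRibbonElement (θUnit Q)⁻¹ where
  central x := by
    rw [Units.inv_mul_eq_iff_eq_mul, ← mul_assoc, θUnit_val, θ_mul, mul_assoc, ← θUnit_val,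
      Units.mul_inv, mul_one]
  comul := by
    have hm : ((qtQuasiHopfAlgebra Q).monodromy : HTheta Q ⊗[k] HTheta Q) =
        ι₂ Q (Q.monodromy : H ⊗[k] H) := by
      change flip2 k _ (ι₂ Q (Q.R : H ⊗[k] H)) * ι₂ Q (Q.R : H ⊗[k] H) = _
      rw [flip2_ι₂, ← map_mul]
      rfl
    set x : HTheta Q := (((θUnit Q)⁻¹ : (HTheta Q)ˣ) : HTheta Q) with hx
    have h1 : θ Q * x = 1 := (θUnit Q).mul_inv
    have h2 : comul Q x * comul Q (θ Q) = 1 := by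
      rw [← map_mul, ← θ_mul, h1, map_one]
    -- A right inverse of Δ(θ), while Δ(θ⁻¹) is a left inverse; the two must coincide.
    have h3 : comul Q (θ Q) * ((x ⊗ₜ x) * ι₂ Q (Q.monodromy : H ⊗[k] H)) = 1 := by
      rw [comul_θ, θ_tmul_θ_mul, mul_assoc, ← mul_assoc (θ Q ⊗ₜ[k] θ Q),
        Algebra.TensorProduct.tmul_mul_tmul, h1, ← Algebra.TensorProduct.one_def, one_mul,
        ← map_mul, Units.inv_mul, map_one]
    rw [hm]
    exact left_inv_eq_right_inv h2 h3
  antipode := by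
    set x : HTheta Q := (((θUnit Q)⁻¹ : (HTheta Q)ˣ) : HTheta Q) with hx
    have h1 : θ Q * x = 1 := (θUnit Q).mul_inv
    have h2 : antipode Q x * θ Q = 1 := by
      rw [← antipode_θ Q, ← antipode_mul, h1, antipode_one]
    exact left_inv_eq_right_inv h2 h1

end HTheta

end

end QHopf

namespace QHopf

noncomputable section

/-! ### The twist of `R(_H M^fd, c)` -/

section Raw

variable {k : Type u} {H : Type w} [Field k] [Ring H] [Algebra k H] (Q : QTQuasiHopfAlgebra k H)

/-- `comul_uSu` in terms of square roots of the action of u S(u); it gives closure of R(C, c) under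
tensor products. -/
lemma map_act_map_act {V W : Type u} [AddCommGroup V] [Module k V] [AddCommGroup W] [Module k W]
    {e : H →ₐ[k] Module.End k V} {f : H →ₐ[k] Module.End k W} {φ : V →ₗ[k] V} {ψ : W →ₗ[k] W} (hφ : ∀ a v, φ (e a v) = e a (φ v))
    (hψ : ∀ a v, ψ (f a v) = f a (ψ v)) (hφφ : φ ∘ₗ φ = e (Q.u * Q.S Q.u))
    (hψψ : ψ ∘ₗ ψ = f (Q.u * Q.S Q.u)) (z : V ⊗[k] W) :
    TensorProduct.map φ ψ (act e f ((Q.monodromy⁻¹ : (H ⊗[k] H)ˣ) : H ⊗[k] H)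
      (TensorProduct.map φ ψ (act e f ((Q.monodromy⁻¹ : (H ⊗[k] H)ˣ) : H ⊗[k] H) z))) =
    act e f (Q.Δ (Q.u * Q.S Q.u)) z := by
  rw [← act_intertwine hφ hψ, Q.comul_uSu, map_mul, map_mul, act_tmul_eq, ← hφφ, ← hψψ,
    TensorProduct.map_comp]
  rfl

variable {V : Type u} [AddCommGroup V] [Module k V] [FiniteDimensional k V] (e : H →ₐ[k] Module.End k V)

lemma evMap_act_eq_cap (t : H ⊗[k] H) (φ : Module.Dual k V) (v : V) :
    evMap Q e (act (dualRep Q e) e t (φ ⊗ₜ v)) = φ (e (Q.cap Q.α t) v) := by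
  rw [evMap_act]
  congr 3
  induction t using tmul_induction with
  | tmul a b => simp [mulMap, mul_assoc]
  | add x y hx hy => simp only [map_add, hx, hy]

lemma toEnd_act_coevMap (t : H ⊗[k] H) :
    toEnd k V (act e (dualRep Q e) t (coevMap Q e 1)) = e (Q.cup Q.β t) := by
  refine LinearMap.ext fun v => ?_
  rw [toEnd_act, toEnd_coev]
  congr 1
  induction t using tmul_induction with
  | tmul a b => simp [mul_assoc]
  | add x y hx hy => simp only [map_add, hx, hy]

lemma toEnd_map (f : V →ₗ[k] V) (g : V →ₗ[k] V)
    (z : V ⊗[k] Module.Dual k V) :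
    toEnd k V (TensorProduct.map f (Module.Dual.transpose g) z) = f ∘ₗ toEnd k V z ∘ₗ g := by
  induction z using tmul_induction with
  | tmul v φ => ext x; simp [toEnd_tmul, Module.Dual.transpose_apply]
  | add x y hx hy => simp only [map_add, hx, hy, LinearMap.add_comp, LinearMap.comp_add]

/-- A central a inserted next to β can be carried to the front of X¹βS(X²)αX³ = 1. -/
lemma zigzag_of_central {a : H} (ha : ∀ h, a * h = h * a) {z : V ⊗[k] Module.Dual k V}
    (hz : toEnd k V z = e (a * Q.β)) (v : V) :
    TensorProduct.rid k V (TensorProduct.map LinearMap.id (evMap Q e)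
      (assocMap Q e (dualRep Q e) e (z ⊗ₜ v))) = e a v := by
  simp only [assocMap, LinearMap.comp_apply, LinearEquiv.coe_coe]
  rw [zigzag_aux, hz]
  have h2 : ∀ t : H ⊗[k] (H ⊗[k] H), LinearMap.mul' k (Module.End k V)
      (TensorProduct.map e.toLinearMap (LinearMap.mulLeft k (e (a * Q.β)) ∘ₗ e.toLinearMap ∘ₗ
          mulMap Q.S (LinearMap.mulLeft k Q.α)) t) =
      e (a * mulMap₃ (LinearMap.mulRight k Q.β) Q.S (LinearMap.mulLeft k Q.α) t) := by
    intro t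
    induction t using tmul_induction with
    | tmul b c =>
      simp only [mulMap₃, TensorProduct.map_tmul, LinearMap.mul'_apply, LinearMap.comp_apply,
        AlgHom.toLinearMap_apply, LinearMap.mulLeft_apply, LinearMap.mulRight_apply, ← map_mul]
      rw [mul_assoc a, ← mul_assoc b a, ← ha b]
      simp only [mul_assoc]
    | add x y hx hy => simp only [map_add, mul_add, hx, hy]
  rw [h2, Q.reassociator_antipode, mul_one]

end Raw

namespace FDMod

variable {k : Type u} {H : Type w} [Field k] [Ring H] [Algebra k H] {Q : QTQuasiHopfAlgebra k H}

lemma doubleBraiding_hom_lin (X Y : FDMod Q) :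
    (doubleBraiding X Y).hom.lin = act X.ρ Y.ρ (Q.monodromy : H ⊗[k] H) := by
  refine LinearMap.ext fun (z : X.V ⊗[k] Y.V) => ?_
  change braidMap Q Y.ρ X.ρ (braidMap Q X.ρ Y.ρ z) = _
  simp only [braidMap, LinearMap.comp_apply, LinearEquiv.coe_coe]
  rw [act_comm, TensorProduct.comm_comm, act_mul_apply]
  rfl

lemma doubleBraiding_inv_lin (X Y : FDMod Q) : (doubleBraiding X Y).inv.lin =
    act X.ρ Y.ρ ((Q.monodromy⁻¹ : (H ⊗[k] H)ˣ) : H ⊗[k] H) := by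
  refine LinearMap.ext fun (z : X.V ⊗[k] Y.V) => ?_
  have h : (doubleBraiding X Y).hom.lin ((doubleBraiding X Y).inv.lin z) = z :=
    LinearMap.congr_fun (congrArg Hom.lin (doubleBraiding X Y).inv_hom_id) z
  rw [doubleBraiding_hom_lin] at h
  refine Eq.trans ?_ (congrArg (act X.ρ Y.ρ ((Q.monodromy⁻¹ : (H ⊗[k] H)ˣ) : H ⊗[k] H)) h)
  refine Eq.trans ?_ (act_mul_apply (act X.ρ Y.ρ) _ _ _).symm
  rw [Units.inv_mul, map_one]
  rfl

/-- The double braiding acts on the coevaluation by m and replaces β by m¹βS(m²) = u S(u)β; the rest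
of the loop is a zigzag with this central factor. -/
lemma twistLoop_lin (X : FDMod Q) : (twistLoop X).lin = X.ρ (Q.u * Q.S Q.u) := by
  refine LinearMap.ext fun v => ?_
  refine Eq.trans ?_ (zigzag_of_central Q X.ρ Q.uSu_central (z := act X.ρ (dualRep Q X.ρ)
    (Q.monodromy : H ⊗[k] H) (coevMap Q X.ρ 1)) ?_ v)
  · change TensorProduct.rid k X.V (TensorProduct.map LinearMap.id (evMap Q X.ρ)
      (assocMap Q X.ρ (dualRep Q X.ρ) X.ρ
        ((doubleBraiding X (dual X)).hom.lin (coevMap Q X.ρ 1) ⊗ₜ v))) = _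
    rw [doubleBraiding_hom_lin]
    rfl
  · rw [toEnd_act_coevMap, Q.cup_monodromy]

/-- `η_V⁻²` is the action of `u S(u)`. -/
lemma twistSquare : TwistSquare.{u, w} Q := fun X => by
  rw [← twistLoop_lin, ← X.η_sq]
  rfl

lemma iso_hom_inv_apply {X Y : FDMod Q} (f : X ≅ Y) (v : X.V) : f.inv.lin (f.hom.lin v) = v :=
  LinearMap.congr_fun (congrArg Hom.lin f.hom_inv_id) v

lemma iso_inv_hom_apply {X Y : FDMod Q} (f : X ≅ Y) (v : Y.V) : f.hom.lin (f.inv.lin v) = v :=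
  LinearMap.congr_fun (congrArg Hom.lin f.inv_hom_id) v

/-- Compatibility of the twist with evaluation and coevaluation comes down to this cancellation. -/
lemma η_uSu_η (X : RCat (FDMod.{u, w} Q)) (v : X.obj.V) :
    X.η.hom.lin (X.obj.ρ (Q.u * Q.S Q.u) (X.η.hom.lin v)) = v := by
  rw [← twistSquare X, LinearMap.comp_apply, iso_inv_hom_apply, iso_hom_inv_apply]

lemma dualIso_hom_lin {X : FDMod Q} (η : X ≅ X) :
    (RCat.dualIso η).hom.lin = Module.Dual.transpose η.hom.lin :=
  congrArg Hom.lin (rightAdjointMate_eq η.hom)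

lemma dualIso_inv_lin {X : FDMod Q} (η : X ≅ X) :
    (RCat.dualIso η).inv.lin = Module.Dual.transpose η.inv.lin :=
  congrArg Hom.lin (rightAdjointMate_eq η.inv)

lemma tensorTwist_hom_lin {X Y : FDMod Q} (η : X ≅ X) (ξ : Y ≅ Y) (z : X.V ⊗[k] Y.V) :
    (tensorTwist η ξ).hom.lin z = TensorProduct.map η.hom.lin ξ.hom.lin
      (act X.ρ Y.ρ (Q.monodromy : H ⊗[k] H) z) := by
  rw [← doubleBraiding_hom_lin]
  rfl

lemma tensorTwist_inv_lin {X Y : FDMod Q} (η : X ≅ X) (ξ : Y ≅ Y) (z : X.V ⊗[k] Y.V) :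
    (tensorTwist η ξ).inv.lin z = TensorProduct.map η.inv.lin ξ.inv.lin
      (act X.ρ Y.ρ ((Q.monodromy⁻¹ : (H ⊗[k] H)ˣ) : H ⊗[k] H) z) := by
  rw [act_intertwine η.inv.comm ξ.inv.comm, ← doubleBraiding_inv_lin]
  rfl

instance isRibbonClosed : RCat.IsRibbonClosed (FDMod.{u, w} Q) where
  tensor X Y := hom_ext <| LinearMap.ext fun (z : X.obj.V ⊗[k] Y.obj.V) => by
    rw [twistLoop_lin]
    change (tensorTwist X.η Y.η).inv.lin ((tensorTwist X.η Y.η).inv.lin z) =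
      act X.obj.ρ Y.obj.ρ (Q.Δ (Q.u * Q.S Q.u)) z
    rw [tensorTwist_inv_lin, tensorTwist_inv_lin]
    exact map_act_map_act Q X.η.inv.comm Y.η.inv.comm (twistSquare X) (twistSquare Y) z
  unit := hom_ext <| by
    rw [twistLoop_lin]
    change LinearMap.id = Algebra.lmul k k (Q.counit (Q.u * Q.S Q.u))
    rw [Q.counit_uSu, map_one]
    rfl
  dual X := hom_ext <| LinearMap.ext fun (φ : Module.Dual k X.obj.V) => LinearMap.ext fun v => by
    rw [twistLoop_lin, comp_lin, dualIso_inv_lin]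
    change φ (X.η.inv.lin (X.η.inv.lin v)) = φ (X.obj.ρ (Q.S (Q.u * Q.S Q.u)) v)
    rw [Q.S_uSu, ← twistSquare X]
    rfl
  ev X := hom_ext <| TensorProduct.ext' fun (φ : Module.Dual k X.obj.V) v => by
    change evMap Q X.obj.ρ ((tensorTwist (RCat.dualIso X.η) X.η).hom.lin (φ ⊗ₜ v)) =
      evMap Q X.obj.ρ (φ ⊗ₜ v)
    -- The transposed twist on V* becomes a second η on V, and the cap of m gives u S(u)α; the two
    -- copies of η cancel u S(u).
    rw [tensorTwist_hom_lin, act_intertwine (RCat.dualIso X.η).hom.comm X.η.hom.comm,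
      dualIso_hom_lin]
    refine (evMap_act_eq_cap Q X.obj.ρ _ _ _).trans ?_
    change φ (X.η.hom.lin (X.obj.ρ _ (X.η.hom.lin v))) = φ (X.obj.ρ Q.α v)
    rw [Q.cap_monodromy, ← act_mul_apply, ← X.η.hom.comm, η_uSu_η]
  coev X := hom_ext <| LinearMap.ext_ring <| by
    change coevMap Q X.obj.ρ 1 = (tensorTwist X.η (RCat.dualIso X.η)).hom.lin
      (coevMap Q X.obj.ρ 1)
    refine Eq.trans ?_
      (tensorTwist_hom_lin X.η (RCat.dualIso X.η) (coevMap Q X.obj.ρ 1)).symm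
    rw [dualIso_hom_lin]
    apply toEnd_injective
    refine (toEnd_coev Q X.obj.ρ).trans (Eq.trans ?_ (toEnd_map (V := X.obj.V) _ _ _).symm)
    refine LinearMap.ext fun v => ?_
    have h := toEnd_act_coevMap Q X.obj.ρ (Q.monodromy : H ⊗[k] H)
    refine Eq.trans ?_ (congrArg (fun f : Module.End k X.obj.V =>
      X.η.hom.lin (f (X.η.hom.lin v))) h.symm)
    rw [Q.cup_monodromy, ← act_mul_apply, ← X.η.hom.comm, η_uSu_η]

end FDMod

end

end QHopf

namespace QHopf

noncomputable section

/-! ### The isomorphism `R(_H M^fd, c) ≅ _{H(θ)} M^fd` -/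

section

variable {k : Type u} {H : Type w} [Field k] [Ring H] [Algebra k H] {Q : QTQuasiHopfAlgebra k H}

lemma HTheta.algHom_ext {A : Type*} [Ring A] [Algebra k A] {f g : HTheta Q →ₐ[k] A}
    (hι : ∀ h, f (HTheta.ι Q h) = g (HTheta.ι Q h)) (hθ : f (HTheta.θ Q) = g (HTheta.θ Q)) :
    f = g := by
  refine AlgHom.ext fun x => ?_
  induction x using HTheta.induction with
  | ι h => exact hι h
  | θ => exact hθ
  | add x y hx hy => rw [map_add, map_add, hx, hy]
  | mul x y hx hy => rw [map_mul, map_mul, hx, hy]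

namespace FDMod

/-- Strictness is a statement about equality of objects. The vector space is kept fixed and only the
action varies, so substitution turns every transport into the identity map. -/
lemma eq_mk (X : FDMod Q) {ρ : H →ₐ[k] Module.End k X.V} (h : X.ρ = ρ) :
    X = ⟨X.V, ρ⟩ := by
  subst h
  rfl

lemma eqToHom_lin (X : FDMod Q) {ρ : H →ₐ[k] Module.End k X.V} (h : X.ρ = ρ)
    (e : X = ⟨X.V, ρ⟩) : (eqToHom e).lin = (LinearMap.id : X.V →ₗ[k] X.V) := by
  subst h
  rfl

lemma eqToHom_whiskerRight_lin (X : FDMod Q) {ρ : H →ₐ[k] Module.End k X.V} (h : X.ρ = ρ)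
    (e : X = ⟨X.V, ρ⟩) (Z : FDMod Q) :
    (eqToHom e ▷ Z).lin = (LinearMap.id : X.V ⊗[k] Z.V →ₗ[k] X.V ⊗[k] Z.V) := by
  obtain ⟨V, ρ'⟩ := X
  dsimp only at h e
  subst h
  rw [eqToHom_refl, id_whiskerRight]
  rfl

lemma whiskerLeft_eqToHom_lin (X : FDMod Q) {ρ : H →ₐ[k] Module.End k X.V} (h : X.ρ = ρ)
    (e : X = ⟨X.V, ρ⟩) (Z : FDMod Q) :
    (Z ◁ eqToHom e).lin = (LinearMap.id : Z.V ⊗[k] X.V →ₗ[k] Z.V ⊗[k] X.V) := by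
  obtain ⟨V, ρ'⟩ := X
  dsimp only at h e
  subst h
  rw [eqToHom_refl, whiskerLeft_id]
  rfl

lemma associator_hom_lin (X Y Z : FDMod Q) :
    (α_ X Y Z).hom.lin = assocMap Q X.ρ Y.ρ Z.ρ := rfl

lemma leftUnitor_hom_lin (X : FDMod Q) :
    (λ_ X).hom.lin = (TensorProduct.lid k X.V).toLinearMap := rfl

lemma rightUnitor_hom_lin (X : FDMod Q) :
    (ρ_ X).hom.lin = (TensorProduct.rid k X.V).toLinearMap := rfl

lemma braiding_hom_lin (X Y : FDMod Q) : (β_ X Y).hom.lin = braidMap Q X.ρ Y.ρ := rfl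

lemma evaluation_lin (X : FDMod Q) : (ε_ X Xᘁ).lin = evMap Q X.ρ := rfl

lemma coevaluation_lin (X : FDMod Q) : (η_ X Xᘁ).lin = coevMap Q X.ρ := rfl

end FDMod

namespace RCat

lemma eq_mk (X : RCat (FDMod.{u, w} Q)) {ρ : H →ₐ[k] Module.End k X.obj.V} (h : X.obj.ρ = ρ)
    (η : (⟨X.obj.V, ρ⟩ : FDMod Q) ≅ ⟨X.obj.V, ρ⟩)
    (η_sq : η.inv ≫ η.inv = twistLoop _) (hη : X.η.inv.lin = η.inv.lin) :
    X = ⟨⟨X.obj.V, ρ⟩, η, η_sq⟩ := by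
  obtain ⟨X, ξ, hξ⟩ := X
  subst h
  obtain rfl : ξ = η := Iso.ext_inv (FDMod.hom_ext hη)
  rfl

lemma eqToHom_f_lin (X : RCat (FDMod.{u, w} Q)) {ρ : H →ₐ[k] Module.End k X.obj.V}
    (h : X.obj.ρ = ρ) (η : (⟨X.obj.V, ρ⟩ : FDMod Q) ≅ ⟨X.obj.V, ρ⟩)
    (η_sq : η.inv ≫ η.inv = twistLoop _) (hη : X.η.inv.lin = η.inv.lin)
    (e : X = ⟨⟨X.obj.V, ρ⟩, η, η_sq⟩) : (Hom.f (eqToHom e)).lin =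
      (LinearMap.id : X.obj.V →ₗ[k] X.obj.V) := by
  obtain ⟨X, ξ, hξ⟩ := X
  subst h
  obtain rfl : ξ = η := Iso.ext_inv (FDMod.hom_ext hη)
  rfl

lemma associator_hom_f (X Y Z : RCat (FDMod.{u, w} Q)) :
    Hom.f (α_ X Y Z).hom = (α_ X.obj Y.obj Z.obj).hom := rfl

lemma leftUnitor_hom_f (X : RCat (FDMod.{u, w} Q)) : Hom.f (λ_ X).hom = (λ_ X.obj).hom := rfl

lemma rightUnitor_hom_f (X : RCat (FDMod.{u, w} Q)) : Hom.f (ρ_ X).hom = (ρ_ X.obj).hom := rfl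

lemma braiding_hom_f (X Y : RCat (FDMod.{u, w} Q)) :
    Hom.f (β_ X Y).hom = (β_ X.obj Y.obj).hom := rfl

lemma evaluation_f (X : RCat (FDMod.{u, w} Q)) : Hom.f (ε_ X Xᘁ) = ε_ X.obj X.objᘁ := rfl

lemma coevaluation_f (X : RCat (FDMod.{u, w} Q)) : Hom.f (η_ X Xᘁ) = η_ X.obj X.objᘁ := rfl

end RCat

namespace HTheta

variable {Qθ : QTQuasiHopfAlgebra k (HTheta Q)}

/-- The automorphism of the restriction to `H` of an `H(θ)`-module given by `θ⁻¹`. -/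
def thetaInvIso (Y : FDMod.{u, w} Qθ) :
    (⟨Y.V, Y.ρ.comp (ι Q)⟩ : FDMod.{u, w} Q) ≅ ⟨Y.V, Y.ρ.comp (ι Q)⟩ :=
  -- Built with θ as forward map and then inverted, so that the inverse of the twist is the action
  -- of θ by definition.
  (FDMod.mkIso (X := ⟨Y.V, Y.ρ.comp (ι Q)⟩) (Y := ⟨Y.V, Y.ρ.comp (ι Q)⟩)
    ⟨Y.ρ (θ Q), fun h v => by
      change Y.ρ _ (Y.ρ _ v) = Y.ρ _ (Y.ρ _ v)
      rw [act_mul_apply, act_mul_apply, θ_mul]⟩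
    (Y.ρ (((θUnit Q)⁻¹ : (HTheta Q)ˣ) : HTheta Q))
    (LinearMap.ext fun v => by
      rw [LinearMap.comp_apply, act_mul_apply, ← θUnit_val, Units.inv_mul, map_one]; rfl)
    (LinearMap.ext fun v => by
      rw [LinearMap.comp_apply, act_mul_apply, ← θUnit_val, Units.mul_inv, map_one]; rfl)).symm

lemma thetaInvIso_sq (Y : FDMod.{u, w} Qθ) :
    (thetaInvIso Y).inv ≫ (thetaInvIso Y).inv = twistLoop _ :=
  FDMod.hom_ext <| by
    rw [FDMod.twistLoop_lin]
    change Y.ρ (θ Q) * Y.ρ (θ Q) = Y.ρ (ι Q _)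
    rw [← map_mul, θ_mul_θ]

/-- An `H(θ)`-module, restricted to `H`, with the automorphism given by `θ⁻¹`. -/
def restrict (Y : FDMod.{u, w} Qθ) : RCat (FDMod.{u, w} Q) :=
  ⟨⟨Y.V, Y.ρ.comp (ι Q)⟩, thetaInvIso Y, thetaInvIso_sq Y⟩

variable (Qθ) in
/-- The inverse of `thetaFunctor`. -/
def restrictFunctor : FDMod.{u, w} Qθ ⥤ RCat (FDMod.{u, w} Q) where
  obj := restrict
  map {X Y} f := (⟨⟨f.lin, fun h v => f.comm (ι Q h) v⟩, FDMod.hom_ext <| LinearMap.ext fun v =>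
    f.comm _ v⟩ : RCat.Hom (restrict X) (restrict Y))
  map_id _ := rfl
  map_comp _ _ := rfl

variable (Qθ) in
/-- The functor `(V, η_V) ↦ V`, with `θ` acting by `η_V⁻¹`. -/
abbrev extendFunctor : RCat (FDMod.{u, w} Q) ⥤ FDMod.{u, w} Qθ :=
  thetaFunctor FDMod.twistSquare Qθ

/-- The `H(θ)`-module structure on an object of `R(_H M^fd, c)`. -/
def ext (X : RCat (FDMod.{u, w} Q)) : HTheta Q →ₐ[k] Module.End k X.obj.V :=
  lift X.obj.ρ X.η.inv.lin (fun h => LinearMap.ext fun v => (X.η.inv.comm h v).symm)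
    (FDMod.twistSquare X)

lemma ext_ι (X : RCat (FDMod.{u, w} Q)) (h : H) : ext X (ι Q h) = X.obj.ρ h :=
  lift_ι (sq := FDMod.twistSquare X) ..

lemma ext_θ (X : RCat (FDMod.{u, w} Q)) : ext X (θ Q) = X.η.inv.lin :=
  lift_θ (sq := FDMod.twistSquare X) ..

lemma ext_comp_ι (X : RCat (FDMod.{u, w} Q)) : (ext X).comp (ι Q) = X.obj.ρ :=
  AlgHom.ext fun h => ext_ι X h

lemma ext_θ_inv (X : RCat (FDMod.{u, w} Q)) :
    ext X (((θUnit Q)⁻¹ : (HTheta Q)ˣ) : HTheta Q) = X.η.hom.lin := by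
  refine LinearMap.ext fun v => ?_
  have h : ext X (θ Q) (X.η.hom.lin v) = v := by rw [ext_θ, FDMod.iso_hom_inv_apply]
  conv_lhs => rw [← h]
  rw [act_mul_apply, ← θUnit_val, Units.inv_mul, map_one]
  rfl

lemma ext_restrict (Y : FDMod.{u, w} Qθ) : ext (restrict Y) = Y.ρ :=
  algHom_ext (fun h => ext_ι (restrict Y) h) (ext_θ (restrict Y))

lemma act_ext (X Y : RCat (FDMod.{u, w} Q)) (t : H ⊗[k] H) :
    act (ext X) (ext Y) (ι₂ Q t) = act X.obj.ρ Y.obj.ρ t := by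
  rw [← ext_comp_ι X, ← ext_comp_ι Y]
  exact (act_map _ _ _ _ t).symm

lemma act₃_ext (X Y Z : RCat (FDMod.{u, w} Q)) (t : H ⊗[k] (H ⊗[k] H)) :
    act (ext X) (act (ext Y) (ext Z)) (ι₃ Q t) =
      act X.obj.ρ (act Y.obj.ρ Z.obj.ρ) t := by
  have h : (act (ext Y) (ext Z)).comp (ι₂ Q) = act Y.obj.ρ Z.obj.ρ :=
    AlgHom.ext (act_ext Y Z)
  rw [← h]
  conv_rhs => rw [← ext_comp_ι X]
  exact (act_map _ _ _ _ t).symm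

namespace IsExtension

variable (hE : IsExtension Q Qθ)
include hE

/-- At θ, the formula Δ(θ) = (θ ⊗ θ)m⁻¹ is precisely the inverse of the twist (η_V ⊗
η_W)c_{W,V}c_{V,W} of the tensor product. -/
lemma ext_tensor (X Y : RCat (FDMod.{u, w} Q)) :
    tens Qθ (ext X) (ext Y) = ext (X ⊗ Y) := by
  refine algHom_ext (fun h => ?_) ?_
  · refine Eq.trans ?_ (ext_ι (X ⊗ Y) h).symm
    refine (congrArg (act (ext X) (ext Y)) (hE.Δ_ι h)).trans ?_
    exact act_ext X Y (Q.Δ h)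
  · refine Eq.trans ?_ (ext_θ (X ⊗ Y)).symm
    refine (congrArg (act (ext X) (ext Y)) hE.Δ_θ).trans ?_
    change act (ext X) (ext Y) ((θ Q ⊗ₜ[k] θ Q) *
      ι₂ Q ((Q.monodromy⁻¹ : (H ⊗[k] H)ˣ) : H ⊗[k] H)) = _
    rw [map_mul, act_ext, act_tmul_eq, ext_θ, ext_θ]
    exact LinearMap.ext fun z => (FDMod.tensorTwist_inv_lin X.η Y.η z).symm

lemma ext_unit : triv Qθ = ext (𝟙_ (RCat (FDMod.{u, w} Q))) := by
  refine algHom_ext (fun h => ?_) ?_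
  · exact (congrArg (Algebra.lmul k k) (hE.counit_ι h)).trans
      (ext_ι (𝟙_ (RCat (FDMod.{u, w} Q))) h).symm
  · exact ((congrArg (Algebra.lmul k k) hE.counit_θ).trans (map_one (Algebra.lmul k k))).trans
      (ext_θ (𝟙_ (RCat (FDMod.{u, w} Q)))).symm

lemma ext_dual (X : RCat (FDMod.{u, w} Q)) :
    ext (RCat.dual X) = dualRep Qθ (ext X) := by
  refine algHom_ext (fun h => ?_) ?_
  · refine (ext_ι (RCat.dual X) h).trans ?_
    refine LinearMap.ext fun (φ : Module.Dual k X.obj.V) => LinearMap.ext fun v => ?_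
    change φ (X.obj.ρ (Q.S h) v) = φ (ext X (Qθ.S (ι Q h)) v)
    rw [hE.S_ι, ext_ι]
  · refine (ext_θ (RCat.dual X)).trans ((FDMod.dualIso_inv_lin X.η).trans ?_)
    refine LinearMap.ext fun (φ : Module.Dual k X.obj.V) => LinearMap.ext fun v => ?_
    change φ (X.η.inv.lin v) = φ (ext X (Qθ.S (θ Q)) v)
    rw [hE.S_θ, ext_θ]

/-- The reassociator of H(θ) comes from H, so the constraint is the same linear map. The same
applies below to the R-matrix, α and β. -/
lemma assocMap_ext (X Y Z : RCat (FDMod.{u, w} Q)) :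
    assocMap Qθ (ext X) (ext Y) (ext Z) = assocMap Q X.obj.ρ Y.obj.ρ Z.obj.ρ := by
  rw [assocMap, assocMap, ← act₃_ext, hE.Φ_eq]
  rfl

lemma braidMap_ext (X Y : RCat (FDMod.{u, w} Q)) :
    braidMap Qθ (ext X) (ext Y) = braidMap Q X.obj.ρ Y.obj.ρ := by
  rw [braidMap, braidMap, ← act_ext, hE.R_eq]
  rfl

lemma evMap_ext (X : RCat (FDMod.{u, w} Q)) :
    evMap Qθ (ext X) = evMap Q X.obj.ρ := by
  rw [evMap, evMap, hE.α_eq, ext_ι]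

lemma coevMap_ext (X : RCat (FDMod.{u, w} Q)) :
    coevMap Qθ (ext X) = coevMap Q X.obj.ρ := by
  rw [coevMap, coevMap, hE.β_eq, ext_ι]

end IsExtension

end HTheta

end

end

end QHopf

namespace QHopf

noncomputable section

variable {k : Type u} {H : Type w} [Field k] [Ring H] [Algebra k H] {Q : QTQuasiHopfAlgebra k H}

namespace HTheta

variable {Qθ : QTQuasiHopfAlgebra k (HTheta Q)}

/-! ### Extension to `H(θ)` and restriction to `H` are mutually inverse -/

lemma extend_restrict (Y : FDMod.{u, w} Qθ) :
    (extendFunctor Qθ).obj ((restrictFunctor Qθ).obj Y) = Y :=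
  FDMod.eq_mk ((extendFunctor Qθ).obj (restrict Y)) (ext_restrict Y)

lemma restrict_extend (X : RCat (FDMod.{u, w} Q)) :
    X = (restrictFunctor Qθ).obj ((extendFunctor Qθ).obj X) :=
  RCat.eq_mk X (ext_comp_ι X).symm _ (thetaInvIso_sq ((extendFunctor Qθ).obj X)) (ext_θ X).symm

lemma eqToHom_extend_restrict (Y : FDMod.{u, w} Qθ) :
    (eqToHom (extend_restrict Y)).lin = (LinearMap.id : Y.V →ₗ[k] Y.V) :=
  FDMod.eqToHom_lin ((extendFunctor Qθ).obj (restrict Y)) (ext_restrict Y) _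

lemma eqToHom_restrict_extend (X : RCat (FDMod.{u, w} Q)) :
    (RCat.Hom.f (eqToHom (restrict_extend (Qθ := Qθ) X))).lin =
      (LinearMap.id : X.obj.V →ₗ[k] X.obj.V) :=
  RCat.eqToHom_f_lin X (ext_comp_ι X).symm _ (thetaInvIso_sq ((extendFunctor Qθ).obj X))
    (ext_θ X).symm _

lemma extendFunctor_map_lin {X Y : RCat (FDMod.{u, w} Q)} (f : X ⟶ Y) :
    ((extendFunctor Qθ).map f).lin = f.f.lin := rfl

variable (Qθ) in
lemma extendFunctor_comp_restrictFunctor :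
    extendFunctor Qθ ⋙ restrictFunctor Qθ = 𝟭 (RCat (FDMod.{u, w} Q)) := by
  refine (CategoryTheory.Functor.ext restrict_extend fun X Y f => ?_).symm
  have h : f ≫ eqToHom (restrict_extend (Qθ := Qθ) Y) = eqToHom (restrict_extend (Qθ := Qθ) X) ≫
      (restrictFunctor Qθ).map ((extendFunctor Qθ).map f) := by
    refine RCat.hom_ext (FDMod.hom_ext ?_)
    rw [RCat.comp_f, RCat.comp_f, FDMod.comp_lin, FDMod.comp_lin, eqToHom_restrict_extend,
      eqToHom_restrict_extend]
    rfl
  exact ((comp_eqToHom_iff _ _ _).1 h).trans (Category.assoc _ _ _)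

variable (Qθ) in
lemma restrictFunctor_comp_extendFunctor :
    restrictFunctor Qθ ⋙ extendFunctor Qθ = 𝟭 (FDMod.{u, w} Qθ) := by
  refine CategoryTheory.Functor.ext extend_restrict fun X Y f => ?_
  have h : (extendFunctor Qθ).map ((restrictFunctor Qθ).map f) ≫ eqToHom (extend_restrict Y) =
      eqToHom (extend_restrict X) ≫ f := by
    refine FDMod.hom_ext ?_
    rw [FDMod.comp_lin, FDMod.comp_lin, eqToHom_extend_restrict, eqToHom_extend_restrict]
    rfl
  exact ((comp_eqToHom_iff _ _ _).1 h).trans (Category.assoc _ _ _)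

/-! ### Strict compatibility with tensor products, braiding and duals -/

namespace IsExtension

variable (hE : IsExtension Q Qθ)
include hE

lemma extend_unit : 𝟙_ (FDMod.{u, w} Qθ) = (extendFunctor Qθ).obj (𝟙_ _) :=
  FDMod.eq_mk (𝟙_ (FDMod.{u, w} Qθ)) hE.ext_unit

lemma eqToHom_extend_unit :
    (eqToHom (extend_unit.{u, w} hE)).lin = (LinearMap.id : k →ₗ[k] k) :=
  FDMod.eqToHom_lin (𝟙_ (FDMod.{u, w} Qθ)) hE.ext_unit _

variable (X Y Z : RCat (FDMod.{u, w} Q))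

lemma extend_tensor :
    (extendFunctor Qθ).obj X ⊗ (extendFunctor Qθ).obj Y = (extendFunctor Qθ).obj (X ⊗ Y) :=
  FDMod.eq_mk ((extendFunctor Qθ).obj X ⊗ (extendFunctor Qθ).obj Y) (hE.ext_tensor X Y)

lemma eqToHom_extend_tensor : (eqToHom (hE.extend_tensor X Y)).lin =
    (LinearMap.id : (X.obj.V ⊗[k] Y.obj.V) →ₗ[k] (X.obj.V ⊗[k] Y.obj.V)) :=
  FDMod.eqToHom_lin ((extendFunctor Qθ).obj X ⊗ (extendFunctor Qθ).obj Y) (hE.ext_tensor X Y) _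

lemma extend_dual : (extendFunctor Qθ).obj Xᘁ = ((extendFunctor Qθ).obj X)ᘁ :=
  FDMod.eq_mk ((extendFunctor Qθ).obj Xᘁ) (hE.ext_dual X)

lemma eqToHom_extend_dual_whiskerRight (Z : FDMod.{u, w} Qθ) :
    (eqToHom (hE.extend_dual X) ▷ Z).lin =
      (LinearMap.id : Module.Dual k X.obj.V ⊗[k] Z.V →ₗ[k] Module.Dual k X.obj.V ⊗[k] Z.V) :=
  FDMod.eqToHom_whiskerRight_lin ((extendFunctor Qθ).obj Xᘁ) (hE.ext_dual X) _ _

lemma whiskerLeft_eqToHom_extend_dual_symm (Z : FDMod.{u, w} Qθ) :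
    (Z ◁ eqToHom (hE.extend_dual X).symm).lin =
      (LinearMap.id : Z.V ⊗[k] Module.Dual k X.obj.V →ₗ[k] Z.V ⊗[k] Module.Dual k X.obj.V) :=
  FDMod.whiskerLeft_eqToHom_lin (((extendFunctor Qθ).obj X)ᘁ) (hE.ext_dual X).symm _ _

lemma eqToHom_extend_tensor_whiskerRight :
    (eqToHom (hE.extend_tensor X Y) ▷ (extendFunctor Qθ).obj Z).lin =
      (LinearMap.id : ((X.obj.V ⊗[k] Y.obj.V) ⊗[k] Z.obj.V) →ₗ[k]
        ((X.obj.V ⊗[k] Y.obj.V) ⊗[k] Z.obj.V)) :=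
  FDMod.eqToHom_whiskerRight_lin ((extendFunctor Qθ).obj X ⊗ (extendFunctor Qθ).obj Y)
    (hE.ext_tensor X Y) _ _

lemma whiskerLeft_eqToHom_extend_tensor :
    ((extendFunctor Qθ).obj X ◁ eqToHom (hE.extend_tensor Y Z)).lin =
      (LinearMap.id : (X.obj.V ⊗[k] (Y.obj.V ⊗[k] Z.obj.V)) →ₗ[k]
        (X.obj.V ⊗[k] (Y.obj.V ⊗[k] Z.obj.V))) :=
  FDMod.whiskerLeft_eqToHom_lin ((extendFunctor Qθ).obj Y ⊗ (extendFunctor Qθ).obj Z)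
    (hE.ext_tensor Y Z) _ _

lemma eqToHom_extend_unit_whiskerRight :
    (eqToHom (extend_unit.{u, w} hE) ▷ (extendFunctor Qθ).obj X).lin =
      (LinearMap.id : (k ⊗[k] X.obj.V) →ₗ[k] (k ⊗[k] X.obj.V)) :=
  FDMod.eqToHom_whiskerRight_lin (𝟙_ (FDMod.{u, w} Qθ)) hE.ext_unit _ _

lemma whiskerLeft_eqToHom_extend_unit :
    ((extendFunctor Qθ).obj X ◁ eqToHom (extend_unit.{u, w} hE)).lin =
      (LinearMap.id : (X.obj.V ⊗[k] k) →ₗ[k] (X.obj.V ⊗[k] k)) :=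
  FDMod.whiskerLeft_eqToHom_lin (𝟙_ (FDMod.{u, w} Qθ)) hE.ext_unit _ _

variable {X Y} in
lemma extend_whiskerRight (f : X ⟶ Y) :
    (extendFunctor Qθ).map f ▷ (extendFunctor Qθ).obj Z ≫ eqToHom (hE.extend_tensor Y Z) =
      eqToHom (hE.extend_tensor X Z) ≫ (extendFunctor Qθ).map (f ▷ Z) := by
  refine FDMod.hom_ext ?_
  rw [FDMod.comp_lin, FDMod.comp_lin, hE.eqToHom_extend_tensor, hE.eqToHom_extend_tensor]
  rfl

variable {X Y} in
lemma extend_whiskerLeft (f : X ⟶ Y) :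
    (extendFunctor Qθ).obj Z ◁ (extendFunctor Qθ).map f ≫ eqToHom (hE.extend_tensor Z Y) =
      eqToHom (hE.extend_tensor Z X) ≫ (extendFunctor Qθ).map (Z ◁ f) := by
  refine FDMod.hom_ext ?_
  rw [FDMod.comp_lin, FDMod.comp_lin, hE.eqToHom_extend_tensor, hE.eqToHom_extend_tensor]
  rfl

/-- On underlying spaces every transport along an equality of objects is the identity, so coherence
reduces to the equality of the two associativity maps. -/
lemma extend_associativity :
    eqToHom (hE.extend_tensor X Y) ▷ (extendFunctor Qθ).obj Z ≫
        eqToHom (hE.extend_tensor (X ⊗ Y) Z) ≫ (extendFunctor Qθ).map (α_ X Y Z).hom =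
      (α_ _ _ _).hom ≫ (extendFunctor Qθ).obj X ◁ eqToHom (hE.extend_tensor Y Z) ≫
        eqToHom (hE.extend_tensor X (Y ⊗ Z)) := by
  refine FDMod.hom_ext ?_
  rw [FDMod.comp_lin, FDMod.comp_lin, FDMod.comp_lin, FDMod.comp_lin,
    hE.eqToHom_extend_tensor_whiskerRight, hE.whiskerLeft_eqToHom_extend_tensor, hE.eqToHom_extend_tensor,
    hE.eqToHom_extend_tensor, extendFunctor_map_lin, RCat.associator_hom_f,
    FDMod.associator_hom_lin, FDMod.associator_hom_lin]
  exact LinearMap.ext fun z => (LinearMap.congr_fun (hE.assocMap_ext X Y Z) z).symm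

lemma extend_left_unitality :
    (λ_ ((extendFunctor Qθ).obj X)).hom =
      eqToHom (extend_unit.{u, w} hE) ▷ (extendFunctor Qθ).obj X ≫
        eqToHom (hE.extend_tensor (𝟙_ _) X) ≫ (extendFunctor Qθ).map (λ_ X).hom := by
  refine FDMod.hom_ext ?_
  rw [FDMod.comp_lin, FDMod.comp_lin, hE.eqToHom_extend_unit_whiskerRight, hE.eqToHom_extend_tensor,
    extendFunctor_map_lin, RCat.leftUnitor_hom_f, FDMod.leftUnitor_hom_lin,
    FDMod.leftUnitor_hom_lin]
  rfl

lemma extend_right_unitality :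
    (ρ_ ((extendFunctor Qθ).obj X)).hom =
      (extendFunctor Qθ).obj X ◁ eqToHom (extend_unit.{u, w} hE) ≫
        eqToHom (hE.extend_tensor X (𝟙_ _)) ≫ (extendFunctor Qθ).map (ρ_ X).hom := by
  refine FDMod.hom_ext ?_
  rw [FDMod.comp_lin, FDMod.comp_lin, hE.whiskerLeft_eqToHom_extend_unit, hE.eqToHom_extend_tensor,
    extendFunctor_map_lin, RCat.rightUnitor_hom_f, FDMod.rightUnitor_hom_lin,
    FDMod.rightUnitor_hom_lin]
  rfl

lemma extend_braiding :
    eqToHom (hE.extend_tensor X Y) ≫ (extendFunctor Qθ).map (β_ X Y).hom =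
      (β_ _ _).hom ≫ eqToHom (hE.extend_tensor Y X) := by
  refine FDMod.hom_ext ?_
  rw [FDMod.comp_lin, FDMod.comp_lin, hE.eqToHom_extend_tensor, hE.eqToHom_extend_tensor,
    extendFunctor_map_lin, RCat.braiding_hom_f, FDMod.braiding_hom_lin, FDMod.braiding_hom_lin]
  exact LinearMap.ext fun z => (LinearMap.congr_fun (hE.braidMap_ext X Y) z).symm

lemma extend_evaluation :
    eqToHom (hE.extend_tensor Xᘁ X) ≫ (extendFunctor Qθ).map (ε_ X Xᘁ) =
      eqToHom (hE.extend_dual X) ▷ (extendFunctor Qθ).obj X ≫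
        ε_ ((extendFunctor Qθ).obj X) ((extendFunctor Qθ).obj X)ᘁ ≫
          eqToHom (extend_unit.{u, w} hE) := by
  refine FDMod.hom_ext ?_
  rw [FDMod.comp_lin, FDMod.comp_lin, FDMod.comp_lin, hE.eqToHom_extend_tensor,
    hE.eqToHom_extend_dual_whiskerRight, hE.eqToHom_extend_unit, extendFunctor_map_lin,
    RCat.evaluation_f, FDMod.evaluation_lin, FDMod.evaluation_lin]
  exact LinearMap.ext fun z => (LinearMap.congr_fun (hE.evMap_ext X) z).symm

lemma extend_coevaluation :
    eqToHom (extend_unit.{u, w} hE) ≫ (extendFunctor Qθ).map (η_ X Xᘁ) =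
      η_ ((extendFunctor Qθ).obj X) ((extendFunctor Qθ).obj X)ᘁ ≫
        (extendFunctor Qθ).obj X ◁ eqToHom (hE.extend_dual X).symm ≫
          eqToHom (hE.extend_tensor X Xᘁ) := by
  refine FDMod.hom_ext ?_
  rw [FDMod.comp_lin, FDMod.comp_lin, FDMod.comp_lin, hE.eqToHom_extend_tensor,
    hE.whiskerLeft_eqToHom_extend_dual_symm, hE.eqToHom_extend_unit, extendFunctor_map_lin,
    RCat.coevaluation_f, FDMod.coevaluation_lin, FDMod.coevaluation_lin]
  exact LinearMap.ext fun z => (LinearMap.congr_fun (hE.coevMap_ext X) z).symm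

/-- `extendFunctor` is strict monoidal. -/
def coreMonoidal : (extendFunctor.{u, w} Qθ).CoreMonoidal where
  εIso := eqToIso (extend_unit.{u, w} hE)
  μIso X Y := eqToIso (hE.extend_tensor X Y)
  μIso_hom_natural_left f Z := hE.extend_whiskerRight Z f
  μIso_hom_natural_right Z f := hE.extend_whiskerLeft Z f
  associativity := hE.extend_associativity
  left_unitality := hE.extend_left_unitality
  right_unitality := hE.extend_right_unitality

/-- `extendFunctor` is braided. -/
abbrev braided : (extendFunctor.{u, w} Qθ).Braided where
  toMonoidal := hE.coreMonoidal.toMonoidal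
  braided := hE.extend_braiding

/-- Besides the strictness lemmas, this needs only that θ⁻¹ acts by η_V, which makes the twists
correspond. -/
theorem isRibbonIsomorphism (hη : Qθ.IsRibbonElement (θUnit Q)⁻¹) :
    letI : RibbonCategory (FDMod.{u, w} Qθ) := FDMod.ribbonCategory hη
    IsRibbonIsomorphism (extendFunctor.{u, w} Qθ) :=
  letI : RibbonCategory (FDMod.{u, w} Qθ) := FDMod.ribbonCategory hη
  ⟨⟨restrictFunctor Qθ, extendFunctor_comp_restrictFunctor Qθ,
    restrictFunctor_comp_extendFunctor Qθ⟩, hE.braided, ⟨extend_unit.{u, w} hE, rfl⟩,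
    fun X Y => ⟨hE.extend_tensor X Y, rfl⟩, fun X => FDMod.hom_ext (ext_θ_inv X).symm,
    fun X => ⟨hE.extend_dual X, hE.extend_evaluation X, hE.extend_coevaluation X⟩⟩

end IsExtension

end HTheta

end

end QHopf

/-- The closure statement supplies the ribbon structure on R(C, c), and the ribbon element θ⁻¹
supplies the one on H(θ)-modules; the extension property ties the two together. -/
theorem mainTheorem2 {k : Type u} {H : Type w} [Field k] [Ring H] [Algebra k H]
    (Q : QHopf.QTQuasiHopfAlgebra k H) :
    ∃ (_ : QHopf.RCat.IsRibbonClosed (QHopf.FDMod.{u, w} Q))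
      (Qθ : QHopf.QTQuasiHopfAlgebra k (QHopf.HTheta Q)) (t : (QHopf.HTheta Q)ˣ)
      (hη : Qθ.IsRibbonElement t⁻¹) (hQ : QHopf.TwistSquare.{u, w} Q),
      (t : QHopf.HTheta Q) = QHopf.HTheta.θ Q ∧
      QHopf.HTheta.IsExtension Q Qθ ∧
      letI : QHopf.RibbonCategory (QHopf.FDMod.{u, w} Qθ) := QHopf.FDMod.ribbonCategory hη
      QHopf.IsRibbonIsomorphism (QHopf.thetaFunctor hQ Qθ) :=
  ⟨QHopf.FDMod.isRibbonClosed, QHopf.HTheta.qtQuasiHopfAlgebra Q, QHopf.HTheta.θUnit Q,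
    QHopf.HTheta.isRibbonElement Q, QHopf.FDMod.twistSquare, rfl, QHopf.HTheta.isExtension Q,
    (QHopf.HTheta.isExtension Q).isRibbonIsomorphism (QHopf.HTheta.isRibbonElement Q)⟩
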